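/- Let $\mathbf K$ be a (strict) 2-category. A *tangentad* $(\mathbb X,\mathbb T)$ in $\mathbf K$ is an object $\mathbb X$ with a tangent structure: a 1-morphism $T\colon\mathbb X\to\mathbb X$ and 2-morphisms $p\colon T\Rightarrow\mathrm{id}$, $z\colon\mathrm{id}\Rightarrow T$, $s\colon T_2\Rightarrow T$, $l\colon T\Rightarrow T^2$, $c\colon T^2\Rightarrow T^2$ satisfying the axioms of a tangent category, where $T_n$ is the $n$-fold pullback of $p$ along itself and where these pullbacks, which are required to be preserved by all iterates of $T$, and the pullback expressing the universality of the vertical lift $l$ are pointwise (preserved by precomposition with every 1-morphism of $\mathbf K$). A *lax tangent morphism* $(F,\alpha)\colon(\mathbb X,\mathbb T)\to(\mathbb X',\mathbb T')$ is a 1-morphism $F$ with a 2-morphism $\alpha\colon FT\Rightarrow T'F$ compatible with $p,z,s,l,c$; it is *strict* if $\alpha$ is an identity. A tangent 2-morphism $(F,\alpha)\Rightarrow(G,\beta)$ is a 2-morphism $\varphi\colon F\Rightarrow G$ with $T'\varphi\circ\alpha=\beta\circ\varphi_T$. These form the 2-category $\mathrm{Tng}(\mathbf K)$, and $(T,c)$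 is a lax tangent endomorphism of $(\mathbb X,\mathbb T)$. A *vector field* on a lax tangent morphism $(G,\beta)\colon(\mathbb X',\mathbb T')\to(\mathbb X,\mathbb T)$ is a tangent 2-morphism $u\colon(G,\beta)\Rightarrow(T,c)\circ(G,\beta)$ with $p_G\circ u=\mathrm{id}_G$; a morphism from $(G,\beta;u)$ to $(G',\beta';u')$ is a tangent 2-morphism $\varphi\colon (G,\beta)\Rightarrow (G',\beta')$ with $T\varphi\circ u=u'\circ\varphi$. Denote by $\mathrm{VF}[\mathbb X',\mathbb T'\,|\,\mathbb X,\mathbb T]$ the resulting category. Two vector fields on the same $(G,\beta)$ have the sum $u+u'=s_G\circ\langle u,u'\rangle$, and they *commute* if $Tu'\circ u=c_G\circ Tu\circ u'$. Assume that $\mathbf K$ admits the construction of vector fields: every tangentad $(\mathbb X,\mathbb T)$ has a tangentad $\mathrm{VF}(\mathbb X,\mathbb T)$ with a strict tangent morphism $U\colon\mathrm{VF}(\mathbb X,\mathbb T)\to(\mathbb X,\mathbb T)$ and a vector field $\hat v$ on $U$ that is universal, i.e. for every tangentad $(\mathbb X',\mathbb T')$ the functor $\Gamma_{\hat v}\colon\mathrm{Tng}(\mathbf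 K)[(\mathbb X',\mathbb T'),\mathrm{VF}(\mathbb X,\mathbb T)]\to\mathrm{VF}[\mathbb X',\mathbb T'\,|\,\mathbb X,\mathbb T]$, $H\mapsto(U\circ H;\hat v_H)$, is an isomorphism of categories. Fix such choices. Assume moreover that for every tangentad $(\mathbb X,\mathbb T)$ the 2-pullback of (the underlying 1-morphism of) $U$ along itself exists in $\mathbf K$. For a lax tangent morphism $(F,\alpha)\colon(\mathbb X,\mathbb T)\to(\mathbb X',\mathbb T')$ let $\mathrm{VF}(F,\alpha)$ be the 1-morphism corresponding under $\Gamma$ to the vector field $\alpha_U\circ F\hat v$ on $(F,\alpha)\circ U$, and for a tangent 2-morphism $\varphi$ let $\mathrm{VF}(\varphi)$ be the 2-morphism corresponding to $\varphi_U$. Let $0\colon(\mathbb X,\mathbb T)\to\mathrm{VF}(\mathbb X,\mathbb T)$ correspond to the vector field $z$ on the identity. **Theorem.** 1. For every tangentad $(\mathbb X,\mathbb T)$ there is a tangentad $\mathrm{VF}_2(\mathbb X,\mathbb T)$ with strict tangent morphisms $\pi_1,\pi_2\colon\mathrm{VF}_2(\mathbb X,\mathbb T)\to\mathrm{VF}(\mathbb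 X,\mathbb T)$ which is the 2-pullback of $U$ along itself both in $\mathrm{Tng}(\mathbf K)$ and in $\mathbf K$. 2. For every choice of such $\mathrm{VF}_2(\mathbb X,\mathbb T)$, let $+\colon\mathrm{VF}_2(\mathbb X,\mathbb T)\to\mathrm{VF}(\mathbb X,\mathbb T)$ correspond to the sum of the vector fields $\hat v_{\pi_1}$ and $\hat v_{\pi_2}$. Then $\mathrm{VF}\colon\mathrm{Tng}(\mathbf K)\to\mathrm{Tng}(\mathbf K)$ is a 2-functor and, together with the unit $\eta=0\colon(\mathbb X,\mathbb T)\to\mathrm{VF}(\mathbb X,\mathbb T)$ and the multiplication $$\mu\colon\mathrm{VF}^2(\mathbb X,\mathbb T)\xrightarrow{\langle U_{\mathrm{VF}},\mathrm{VF}U\rangle}\mathrm{VF}_2(\mathbb X,\mathbb T)\xrightarrow{+}\mathrm{VF}(\mathbb X,\mathbb T),$$ which are 2-natural, it is a (strict) 2-monad on $\mathrm{Tng}(\mathbf K)$. Moreover $\mu$ sums pairs of commuting vector fields: for every 1-morphism $H\colon(\mathbb X',\mathbb T')\to\mathrm{VF}^2(\mathbb X,\mathbb T)$ the vector fields $u$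 and $v$ corresponding to $U_{\mathrm{VF}}\circ H$ and $\mathrm{VF}U\circ H$ have the same base and commute, and $\mu\circ H$ corresponds to $u+v$. -/

import Mathlib

open CategoryTheory Bicategory

universe w v u

attribute [-instance] CategoryTheory.catToReflQuiver

namespace TangentadTheory


/-- `P`, with the projections `π i`, is the `n`-fold pullback of `q` along itself (for `0 < n`). -/
def IsFibrePower {C : Type*} [Category C] {n : ℕ} {E B P : C} (q : E ⟶ B)
    (π : Fin n → (P ⟶ E)) : Prop :=
  (∀ i j, π i ≫ q = π j ≫ q) ∧
    ∀ (Z : C) (f : Fin n → (Z ⟶ E)), (∀ i j, f i ≫ q = f j ≫ q) →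
      ∃! h : Z ⟶ P, ∀ i, h ≫ π i = f i

/-- The iterates `T^m` of an endo-1-morphism. -/
def iter {K : Type u} [Bicategory.{w, v} K] {X : K} (T : X ⟶ X) : ℕ → (X ⟶ X)
  | 0 => 𝟙 X
  | m + 1 => iter T m ≫ T

/-- A tangentad in `K`. Composition is diagrammatic: `T ∘ F` is `F ≫ T`, the whiskering `T φ` is
`φ ▷ T`, and `φ_F` is `F ◁ φ`. -/
structure Tangentad (K : Type u) [Bicategory.{w, v} K] where
  /-- base object -/
  obj : K
  /-- tangent bundle 1-morphism -/
  T : obj ⟶ obj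
  /-- projection -/
  p : T ⟶ 𝟙 obj
  /-- zero morphism -/
  z : 𝟙 obj ⟶ T
  /-- the two-fold pullback of the projection along itself -/
  T₂ : obj ⟶ obj
  π₁ : T₂ ⟶ T
  π₂ : T₂ ⟶ T
  /-- sum morphism -/
  s : T₂ ⟶ T
  /-- vertical lift -/
  l : T ⟶ T ≫ T
  /-- canonical flip -/
  c : T ≫ T ⟶ T ≫ T
  /-- `T₂` is a pointwise pullback, preserved by all iterates of `T` -/
  isPullback : ∀ (m : ℕ) {Y : K} (F : Y ⟶ obj),
    IsPullback (F ◁ (π₁ ▷ iter T m)) (F ◁ (π₂ ▷ iter T m))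
      (F ◁ (p ▷ iter T m)) (F ◁ (p ▷ iter T m))
  /-- all `n`-fold pointwise pullbacks of `p` exist and are preserved by all iterates of `T` -/
  exists_power : ∀ n : ℕ, 0 < n → ∃ (Tn : obj ⟶ obj) (π : Fin n → (Tn ⟶ T)),
    ∀ (m : ℕ) {Y : K} (F : Y ⟶ obj),
      IsFibrePower (F ◁ (p ▷ iter T m)) (fun i => F ◁ (π i ▷ iter T m))
  -- `(p, z, s)` is an additive bundle
  z_p : z ≫ p = 𝟙 (𝟙 obj)
  s_p : s ≫ p = π₁ ≫ p
  s_assoc : ∀ {Z : obj ⟶ obj} (a b a' b' : Z ⟶ T₂), a ≫ π₂ = b ≫ π₁ →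
    a' ≫ π₁ = a ≫ s → a' ≫ π₂ = b ≫ π₂ → b' ≫ π₁ = a ≫ π₁ → b' ≫ π₂ = b ≫ s →
      a' ≫ s = b' ≫ s
  s_unit : ∀ e : T ⟶ T₂, e ≫ π₁ = p ≫ z → e ≫ π₂ = 𝟙 T → e ≫ s = 𝟙 T
  s_comm : ∀ τ : T₂ ⟶ T₂, τ ≫ π₁ = π₂ → τ ≫ π₂ = π₁ → τ ≫ s = s
  -- `(z, l) : p ⟶ T p` is an additive bundle morphism
  l_p : l ≫ p ▷ T ≫ (λ_ T).hom = p ≫ z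
  z_l : z ≫ l = z ≫ (λ_ T).inv ≫ z ▷ T
  s_l : ∃ l₂ : T₂ ⟶ T₂ ≫ T, l₂ ≫ π₁ ▷ T = π₁ ≫ l ∧ l₂ ≫ π₂ ▷ T = π₂ ≫ l ∧
    s ≫ l = l₂ ≫ s ▷ T
  -- `(𝟙, c) : T p ⟶ p_T` is an additive bundle morphism
  c_p : c ≫ T ◁ p ≫ (ρ_ T).hom = p ▷ T ≫ (λ_ T).hom
  z_c : z ▷ T ≫ c = (λ_ T).hom ≫ (ρ_ T).inv ≫ T ◁ z
  s_c : ∃ c₂ : T₂ ≫ T ⟶ T ≫ T₂, c₂ ≫ T ◁ π₁ = π₁ ▷ T ≫ c ∧ c₂ ≫ T ◁ π₂ = π₂ ▷ T ≫ c ∧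
    s ▷ T ≫ c = c₂ ≫ T ◁ s
  -- coherence of the vertical lift and of the canonical flip
  l_coassoc : l ≫ l ▷ T ≫ (α_ T T T).hom = l ≫ T ◁ l
  l_c : l ≫ c = l
  l_c_c : T ◁ l ≫ (α_ T T T).inv ≫ c ▷ T ≫ (α_ T T T).hom ≫ T ◁ c =
    c ≫ l ▷ T ≫ (α_ T T T).hom
  c_c : c ≫ c = 𝟙 (T ≫ T)
  c_braid : c ▷ T ≫ (α_ T T T).hom ≫ T ◁ c ≫ (α_ T T T).inv ≫ c ▷ T ≫ (α_ T T T).hom =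
    (α_ T T T).hom ≫ T ◁ c ≫ (α_ T T T).inv ≫ c ▷ T ≫ (α_ T T T).hom ≫ T ◁ c
  /-- universality of the vertical lift -/
  lift_universal : ∃ ν : T₂ ⟶ T₂ ≫ T,
    ν ≫ π₁ ▷ T = π₁ ≫ l ∧ ν ≫ π₂ ▷ T = π₂ ≫ (ρ_ T).inv ≫ T ◁ z ∧
    ∀ {Y : K} (F : Y ⟶ obj), IsPullback (F ◁ (ν ≫ s ▷ T)) (F ◁ (π₁ ≫ p))
      (F ◁ (p ▷ T ≫ (λ_ T).hom)) (F ◁ z)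

section
variable {K : Type u} [Bicategory.{w, v} K]

/-- A lax tangent 1-morphism `(F, α)`. -/
structure LaxMor (X Y : Tangentad K) where
  F : X.obj ⟶ Y.obj
  /-- the lax distributive law `F ∘ T ⟶ T' ∘ F` -/
  law : X.T ≫ F ⟶ F ≫ Y.T
  law_p : law ≫ F ◁ Y.p ≫ (ρ_ F).hom = X.p ▷ F ≫ (λ_ F).hom
  z_law : X.z ▷ F ≫ law = (λ_ F).hom ≫ (ρ_ F).inv ≫ F ◁ Y.z
  s_law : ∃ law₂ : X.T₂ ≫ F ⟶ F ≫ Y.T₂, law₂ ≫ F ◁ Y.π₁ = X.π₁ ▷ F ≫ law ∧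
    law₂ ≫ F ◁ Y.π₂ = X.π₂ ▷ F ≫ law ∧ X.s ▷ F ≫ law = law₂ ≫ F ◁ Y.s
  l_law : X.l ▷ F ≫ (α_ _ _ _).hom ≫ X.T ◁ law ≫ (α_ _ _ _).inv ≫ law ▷ Y.T ≫
    (α_ _ _ _).hom = law ≫ F ◁ Y.l
  c_law : X.c ▷ F ≫ (α_ _ _ _).hom ≫ X.T ◁ law ≫ (α_ _ _ _).inv ≫ law ▷ Y.T ≫
    (α_ _ _ _).hom =
    (α_ _ _ _).hom ≫ X.T ◁ law ≫ (α_ _ _ _).inv ≫ law ▷ Y.T ≫ (α_ _ _ _).hom ≫ F ◁ Y.c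

/-- A tangent 2-morphism. -/
@[ext]
structure TanHom {X Y : Tangentad K} (M N : LaxMor X Y) where
  hom : M.F ⟶ N.F
  comm : M.law ≫ hom ▷ Y.T = X.T ◁ hom ≫ N.law

instance (X Y : Tangentad K) : Category (LaxMor X Y) where
  Hom M N := TanHom M N
  id M := ⟨𝟙 _, by simp⟩
  comp f g := ⟨f.hom ≫ g.hom, by
    rw [comp_whiskerRight, ← Category.assoc, f.comm, Category.assoc, g.comm,
      whiskerLeft_comp, Category.assoc]⟩
  id_comp f := TanHom.ext (Category.id_comp _)
  comp_id f := TanHom.ext (Category.comp_id _)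
  assoc f g h := TanHom.ext (Category.assoc _ _ _)

/-- The identity lax tangent morphism. -/
def LaxMor.id (X : Tangentad K) : LaxMor X X where
  F := 𝟙 X.obj
  law := (ρ_ X.T).hom ≫ (λ_ X.T).inv
  law_p := by simp [unitors_equal]
  z_law := by simp
  s_law := ⟨(ρ_ X.T₂).hom ≫ (λ_ X.T₂).inv, by simp, by simp, by simp⟩
  l_law := by
    simp
  c_law := by
    simp

/-- Composition of lax tangent morphisms. -/
def LaxMor.comp {X Y Z : Tangentad K} (M : LaxMor X Y) (N : LaxMor Y Z) : LaxMor X Z where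
  F := M.F ≫ N.F
  law := (α_ _ _ _).inv ≫ M.law ▷ N.F ≫ (α_ _ _ _).hom ≫ M.F ◁ N.law ≫ (α_ _ _ _).inv
  law_p := by
    have h1 := congrArg (fun t => t ▷ N.F) M.law_p
    have h2 := congrArg (fun t => M.F ◁ t) N.law_p
    simp only [comp_whiskerRight, whiskerLeft_comp] at h1 h2
    calc _ = 𝟙 _ ⊗≫ M.law ▷ N.F ⊗≫ (M.F ◁ N.law ≫ M.F ◁ N.F ◁ Z.p ≫ M.F ◁ (ρ_ N.F).hom) := by
            bicategory
      _ = 𝟙 _ ⊗≫ (M.law ▷ N.F ≫ (M.F ◁ Y.p) ▷ N.F ≫ (ρ_ M.F).hom ▷ N.F) := by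
            rw [h2]; bicategory
      _ = _ := by rw [h1]; bicategory
  z_law := by
    have h1 := congrArg (fun t => t ▷ N.F) M.z_law
    have h2 := congrArg (fun t => M.F ◁ t) N.z_law
    simp only [comp_whiskerRight, whiskerLeft_comp] at h1 h2
    calc _ = 𝟙 _ ⊗≫ (X.z ▷ M.F ▷ N.F ≫ M.law ▷ N.F) ⊗≫ M.F ◁ N.law ⊗≫ 𝟙 _ := by
            bicategory
      _ = 𝟙 _ ⊗≫ (M.F ◁ Y.z ▷ N.F ≫ M.F ◁ N.law) ⊗≫ 𝟙 _ := by
            rw [h1]; bicategory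
      _ = _ := by rw [h2]; bicategory
  s_law := by
    obtain ⟨a, a1, a2, a3⟩ := M.s_law
    obtain ⟨b, b1, b2, b3⟩ := N.s_law
    have key : ∀ (x : X.T₂ ⟶ X.T) (y : Y.T₂ ⟶ Y.T) (t : Z.T₂ ⟶ Z.T),
        a ≫ M.F ◁ y = x ▷ M.F ≫ M.law → b ≫ N.F ◁ t = y ▷ N.F ≫ N.law →
        ((α_ _ _ _).inv ≫ a ▷ N.F ≫ (α_ _ _ _).hom ≫ M.F ◁ b ≫ (α_ _ _ _).inv) ≫
          (M.F ≫ N.F) ◁ t = x ▷ (M.F ≫ N.F) ≫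
          (α_ _ _ _).inv ≫ M.law ▷ N.F ≫ (α_ _ _ _).hom ≫ M.F ◁ N.law ≫ (α_ _ _ _).inv := by
      intro x y t h1 h2
      replace h1 := congrArg (fun t => t ▷ N.F) h1
      replace h2 := congrArg (fun t => M.F ◁ t) h2
      simp only [comp_whiskerRight, whiskerLeft_comp] at h1 h2
      calc _ = 𝟙 _ ⊗≫ a ▷ N.F ⊗≫ (M.F ◁ b ≫ M.F ◁ N.F ◁ t) ⊗≫ 𝟙 _ := by bicategory
        _ = 𝟙 _ ⊗≫ (a ▷ N.F ≫ (M.F ◁ y) ▷ N.F) ⊗≫ M.F ◁ N.law ⊗≫ 𝟙 _ := by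
            rw [h2]; bicategory
        _ = _ := by rw [h1]; bicategory
    exact ⟨_, key _ _ _ a1 b1, key _ _ _ a2 b2, (key _ _ _ a3.symm b3.symm).symm⟩
  l_law := by
    have h1 := congrArg (fun t => t ▷ N.F) M.l_law
    have h2 := congrArg (fun t => M.F ◁ t) N.l_law
    simp only [comp_whiskerRight, whiskerLeft_comp] at h1 h2
    calc _ = 𝟙 _ ⊗≫ X.l ▷ M.F ▷ N.F ⊗≫ X.T ◁ M.law ▷ N.F ⊗≫
            ((X.T ≫ M.F) ◁ N.law ≫ M.law ▷ (N.F ≫ Z.T)) ⊗≫ M.F ◁ N.law ▷ Z.T ⊗≫ 𝟙 _ := by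
            bicategory
      _ = 𝟙 _ ⊗≫ (X.l ▷ M.F ▷ N.F ≫ (α_ _ _ _).hom ▷ N.F ≫ (X.T ◁ M.law) ▷ N.F ≫
            (α_ _ _ _).inv ▷ N.F ≫ M.law ▷ Y.T ▷ N.F ≫ (α_ _ _ _).hom ▷ N.F) ⊗≫
            M.F ◁ Y.T ◁ N.law ⊗≫ M.F ◁ N.law ▷ Z.T ⊗≫ 𝟙 _ := by
            rw [whisker_exchange]; bicategory
      _ = 𝟙 _ ⊗≫ M.law ▷ N.F ⊗≫ (M.F ◁ Y.l ▷ N.F ≫ M.F ◁ (α_ _ _ _).hom ≫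
            M.F ◁ Y.T ◁ N.law ≫ M.F ◁ (α_ _ _ _).inv ≫ M.F ◁ N.law ▷ Z.T ≫
            M.F ◁ (α_ _ _ _).hom) ⊗≫ 𝟙 _ := by
            rw [h1]; bicategory
      _ = _ := by rw [h2]; bicategory
  c_law := by
    have h1 := congrArg (fun t => t ▷ N.F) M.c_law
    have h2 := congrArg (fun t => M.F ◁ t) N.c_law
    simp only [comp_whiskerRight, whiskerLeft_comp] at h1 h2
    calc _ = 𝟙 _ ⊗≫ X.c ▷ M.F ▷ N.F ⊗≫ X.T ◁ M.law ▷ N.F ⊗≫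
            ((X.T ≫ M.F) ◁ N.law ≫ M.law ▷ (N.F ≫ Z.T)) ⊗≫ M.F ◁ N.law ▷ Z.T ⊗≫ 𝟙 _ := by
            bicategory
      _ = 𝟙 _ ⊗≫ (X.c ▷ M.F ▷ N.F ≫ (α_ _ _ _).hom ▷ N.F ≫ (X.T ◁ M.law) ▷ N.F ≫
            (α_ _ _ _).inv ▷ N.F ≫ M.law ▷ Y.T ▷ N.F ≫ (α_ _ _ _).hom ▷ N.F) ⊗≫
            M.F ◁ Y.T ◁ N.law ⊗≫ M.F ◁ N.law ▷ Z.T ⊗≫ 𝟙 _ := by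
            rw [whisker_exchange]; bicategory
      _ = 𝟙 _ ⊗≫ X.T ◁ M.law ▷ N.F ⊗≫ M.law ▷ Y.T ▷ N.F ⊗≫
            (M.F ◁ Y.c ▷ N.F ≫ M.F ◁ (α_ _ _ _).hom ≫
            M.F ◁ Y.T ◁ N.law ≫ M.F ◁ (α_ _ _ _).inv ≫ M.F ◁ N.law ▷ Z.T ≫
            M.F ◁ (α_ _ _ _).hom) ⊗≫ 𝟙 _ := by
            rw [h1]; bicategory
      _ = 𝟙 _ ⊗≫ X.T ◁ M.law ▷ N.F ⊗≫ (M.law ▷ (Y.T ≫ N.F) ≫ (M.F ≫ Y.T) ◁ N.law) ⊗≫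
            M.F ◁ N.law ▷ Z.T ⊗≫ M.F ◁ N.F ◁ Z.c ⊗≫ 𝟙 _ := by
            rw [h2]; bicategory
      _ = _ := by rw [← whisker_exchange]; bicategory

@[simp] theorem TanHom.id_hom {X Y : Tangentad K} (M : LaxMor X Y) :
    TanHom.hom (𝟙 M) = 𝟙 M.F := rfl

@[simp] theorem TanHom.comp_hom {X Y : Tangentad K} {M N P : LaxMor X Y} (f : M ⟶ N)
    (g : N ⟶ P) : TanHom.hom (f ≫ g) = f.hom ≫ g.hom := rfl

theorem TanHom.ext' {X Y : Tangentad K} {M N : LaxMor X Y} {f g : M ⟶ N}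
    (h : TanHom.hom f = TanHom.hom g) : f = g := TanHom.ext h

/-- An invertible 2-morphism of `K` compatible with the distributive laws, as an isomorphism. -/
def TanHom.mkIso {X Y : Tangentad K} {M N : LaxMor X Y} (e : M.F ≅ N.F)
    (h : M.law ≫ e.hom ▷ Y.T = X.T ◁ e.hom ≫ N.law) : M ≅ N where
  hom := ⟨e.hom, h⟩
  inv := ⟨e.inv, by
    have : X.T ◁ e.hom ≫ N.law ≫ e.inv ▷ Y.T = M.law := by
      rw [← Category.assoc, ← h, Category.assoc, ← comp_whiskerRight]; simp
    rw [← this, ← Category.assoc, ← whiskerLeft_comp]; simp⟩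
  hom_inv_id := TanHom.ext' (by simp)
  inv_hom_id := TanHom.ext' (by simp)

/-- The 2-category of tangentads, lax tangent 1-morphisms and tangent 2-morphisms. -/
instance : Bicategory (Tangentad K) where
  Hom X Y := LaxMor X Y
  id X := LaxMor.id X
  comp M N := LaxMor.comp M N
  homCategory _ _ := inferInstance
  whiskerLeft {X Y Z} M N N' f := ⟨M.F ◁ TanHom.hom f, by
    have h := congrArg (fun t => M.F ◁ t) f.comm
    simp only [whiskerLeft_comp] at h
    dsimp only [LaxMor.comp]
    calc _ = 𝟙 _ ⊗≫ M.law ▷ N.F ⊗≫ (M.F ◁ N.law ≫ M.F ◁ f.hom ▷ Z.T) ⊗≫ 𝟙 _ := by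
          bicategory
      _ = 𝟙 _ ⊗≫ (M.law ▷ N.F ≫ (M.F ≫ Y.T) ◁ f.hom) ⊗≫ M.F ◁ N'.law ⊗≫ 𝟙 _ := by
          rw [h]; bicategory
      _ = _ := by rw [← whisker_exchange]; bicategory⟩
  whiskerRight {X Y Z M M'} f N := ⟨TanHom.hom f ▷ N.F, by
    have h := congrArg (fun t => t ▷ N.F) f.comm
    simp only [comp_whiskerRight] at h
    dsimp only [LaxMor.comp]
    calc _ = 𝟙 _ ⊗≫ M.law ▷ N.F ⊗≫ (M.F ◁ N.law ≫ f.hom ▷ (N.F ≫ Z.T)) ⊗≫ 𝟙 _ := by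
          bicategory
      _ = 𝟙 _ ⊗≫ (M.law ▷ N.F ≫ f.hom ▷ Y.T ▷ N.F) ⊗≫ M'.F ◁ N.law ⊗≫ 𝟙 _ := by
          rw [whisker_exchange]; bicategory
      _ = _ := by rw [h]; bicategory⟩
  associator M N P := TanHom.mkIso (α_ M.F N.F P.F) (by dsimp only [LaxMor.comp]; bicategory)
  leftUnitor M := TanHom.mkIso (λ_ M.F) (by dsimp only [LaxMor.comp, LaxMor.id]; bicategory)
  rightUnitor M := TanHom.mkIso (ρ_ M.F) (by dsimp only [LaxMor.comp, LaxMor.id]; bicategory)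
  whiskerLeft_id _ _ := TanHom.ext' (by simp [LaxMor.comp])
  whiskerLeft_comp _ _ _ _ _ _ := TanHom.ext' (Bicategory.whiskerLeft_comp _ _ _)
  id_whiskerLeft _ := TanHom.ext' (Bicategory.id_whiskerLeft _)
  comp_whiskerLeft _ _ _ _ _ := TanHom.ext' (by simp [LaxMor.comp, TanHom.mkIso])
  id_whiskerRight _ _ := TanHom.ext' (by simp [LaxMor.comp])
  comp_whiskerRight _ _ _ := TanHom.ext' (Bicategory.comp_whiskerRight _ _ _)
  whiskerRight_id _ := TanHom.ext' (Bicategory.whiskerRight_id _)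
  whiskerRight_comp _ _ _ := TanHom.ext' (by simp [LaxMor.comp, TanHom.mkIso])
  whisker_assoc _ _ _ _ _ := TanHom.ext' (by simp [LaxMor.comp, TanHom.mkIso])
  whisker_exchange _ _ := TanHom.ext' (Bicategory.whisker_exchange _ _)
  pentagon _ _ _ _ := TanHom.ext' (by simp [LaxMor.comp, TanHom.mkIso])
  triangle _ _ := TanHom.ext' (by simp [LaxMor.comp, LaxMor.id, TanHom.mkIso])

/-- The underlying 1-morphism of `K`. -/
abbrev und {X Y : Tangentad K} (M : X ⟶ Y) : X.obj ⟶ Y.obj := LaxMor.F M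

/-- The underlying 2-morphism of `K`. -/
abbrev und₂ {X Y : Tangentad K} {M N : X ⟶ Y} (f : M ⟶ N) : und M ⟶ und N := TanHom.hom f

theorem eq_of_iso {X Y : Tangentad K} {M N : X ⟶ Y} (e : M ≅ N) (h : und M = und N)
    (he : und₂ e.hom = eqToHom h) : ∃ h' : M = N, e = eqToIso h' := by
  obtain ⟨⟨f, hf⟩, ei, e1, e2⟩ := e
  obtain ⟨F, a, _, _, _, _, _⟩ := M
  obtain ⟨G, b, _, _, _, _, _⟩ := N
  dsimp only [und, und₂] at h he hf
  subst h
  subst he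
  have hab : a = b := by simpa using hf
  subst hab
  exact ⟨rfl, by ext; exact TanHom.ext' rfl⟩

instance [Strict K] : Strict (Tangentad K) :=
  have h1 {X Y : Tangentad K} (f : X ⟶ Y) : ∃ h : 𝟙 X ≫ f = f, λ_ f = eqToIso h :=
    eq_of_iso _ (Strict.id_comp _) (congrArg Iso.hom (Strict.leftUnitor_eqToIso (und f)))
  have h2 {X Y : Tangentad K} (f : X ⟶ Y) : ∃ h : f ≫ 𝟙 Y = f, ρ_ f = eqToIso h :=
    eq_of_iso _ (Strict.comp_id _) (congrArg Iso.hom (Strict.rightUnitor_eqToIso (und f)))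
  have h3 {W X Y Z : Tangentad K} (f : W ⟶ X) (g : X ⟶ Y) (k : Y ⟶ Z) :
      ∃ h : (f ≫ g) ≫ k = f ≫ g ≫ k, α_ f g k = eqToIso h :=
    eq_of_iso _ (Strict.assoc _ _ _)
      (congrArg Iso.hom (Strict.associator_eqToIso (und f) (und g) (und k)))
  { id_comp := fun f => (h1 f).1
    comp_id := fun f => (h2 f).1
    assoc := fun f g k => (h3 f g k).1
    leftUnitor_eqToIso := fun f => (h1 f).2
    rightUnitor_eqToIso := fun f => (h2 f).2
    associator_eqToIso := fun f g k => (h3 f g k).2 }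

/-- A lax tangent morphism is strict when its distributive law is an identity. -/
def IsStrict {X Y : Tangentad K} (M : X ⟶ Y) : Prop :=
  ∃ h : X.T ≫ und M = und M ≫ Y.T, LaxMor.law M = eqToHom h

/-- The tangent bundle 1-morphism `(T, c)`, as a lax tangent endomorphism. -/
def tan (X : Tangentad K) : X ⟶ X where
  F := X.T
  law := X.c
  law_p := X.c_p
  z_law := X.z_c
  s_law := X.s_c
  l_law := by
    have h : X.T ◁ X.l ≫ (α_ _ _ _).inv ≫ X.c ▷ X.T ≫ (α_ _ _ _).hom ≫ X.T ◁ X.c =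
      X.c ≫ X.l ▷ X.T ≫ (α_ _ _ _).hom := X.l_c_c
    have h1 := congrArg (fun t => t ▷ X.T) X.c_c
    have h2 := congrArg (fun t => X.T ◁ t) X.c_c
    simp only [comp_whiskerRight, whiskerLeft_comp, id_whiskerRight, whiskerLeft_id] at h1 h2
    calc _ = X.c ≫ (X.c ≫ X.l ▷ X.T ≫ (α_ _ _ _).hom) ≫ X.T ◁ X.c ≫ (α_ _ _ _).inv ≫
            X.c ▷ X.T ≫ (α_ _ _ _).hom := by
            rw [Category.assoc, ← Category.assoc X.c X.c, X.c_c]; simp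
      _ = X.c ≫ X.T ◁ X.l ≫ (α_ _ _ _).inv ≫ X.c ▷ X.T ≫ (α_ _ _ _).hom ≫
            (X.T ◁ X.c ≫ X.T ◁ X.c) ≫ (α_ _ _ _).inv ≫ X.c ▷ X.T ≫ (α_ _ _ _).hom := by
            rw [← h]; simp only [Category.assoc]
      _ = X.c ≫ X.T ◁ X.l ≫ (α_ _ _ _).inv ≫ (X.c ▷ X.T ≫ X.c ▷ X.T) ≫ (α_ _ _ _).hom := by
            rw [h2]; simp
      _ = _ := by rw [h1]; simp
  c_law := X.c_braid

/-- The projection, as a tangent 2-morphism. -/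
def pHom (X : Tangentad K) : tan X ⟶ 𝟙 X where
  hom := X.p
  comm := by
    change X.c ≫ X.p ▷ X.T = X.T ◁ X.p ≫ (ρ_ X.T).hom ≫ (λ_ X.T).inv
    have h := X.c_p
    have h' : X.c ≫ X.p ▷ X.T ≫ (λ_ X.T).hom = X.T ◁ X.p ≫ (ρ_ X.T).hom := by
      rw [← h, ← Category.assoc, X.c_c, Category.id_comp]
    rw [← Category.assoc (X.T ◁ X.p), ← h']
    simp

/-- The zero morphism, as a tangent 2-morphism. -/
def zHom (X : Tangentad K) : 𝟙 X ⟶ tan X where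
  hom := X.z
  comm := by
    change ((ρ_ X.T).hom ≫ (λ_ X.T).inv) ≫ X.z ▷ X.T = X.T ◁ X.z ≫ X.c
    have h : X.T ◁ X.z = (ρ_ X.T).hom ≫ (λ_ X.T).inv ≫ X.z ▷ X.T ≫ X.c := by
      rw [X.z_c]; simp
    rw [h]
    simp only [Category.assoc, X.c_c, Category.comp_id]

/-- The distributive law of `(F, α)`, as a tangent 2-morphism. -/
def lawHom {X Y : Tangentad K} (M : X ⟶ Y) : tan X ≫ M ⟶ M ≫ tan Y where
  hom := LaxMor.law M
  comm := by
    change ((α_ _ _ _).inv ≫ X.c ▷ und M ≫ (α_ _ _ _).hom ≫ X.T ◁ LaxMor.law M ≫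
      (α_ _ _ _).inv) ≫ LaxMor.law M ▷ Y.T = X.T ◁ LaxMor.law M ≫
      (α_ _ _ _).inv ≫ LaxMor.law M ▷ Y.T ≫ (α_ _ _ _).hom ≫ und M ◁ Y.c ≫ (α_ _ _ _).inv
    have h := LaxMor.c_law M
    rw [← cancel_mono (α_ _ _ _).hom, ← cancel_epi (α_ _ _ _).hom]
    simpa using h

end

section
variable {B : Type u} [Bicategory.{w, v} B] {x y y' : B}

theorem induced_section (H : x ⟶ y) (G : y ⟶ y') {t : y' ⟶ y'} (u : G ⟶ G ≫ t) (p : t ⟶ 𝟙 y')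
    (h : u ≫ G ◁ p ≫ (ρ_ G).hom = 𝟙 G) :
    (H ◁ u ≫ (α_ _ _ _).inv) ≫ (H ≫ G) ◁ p ≫ (ρ_ (H ≫ G)).hom = 𝟙 (H ≫ G) := by
  have h := congrArg (fun t => H ◁ t) h
  simp only [whiskerLeft_comp, whiskerLeft_id] at h
  rw [← h]; simp

theorem induced_natural {H H' : x ⟶ y} (ψ : H ⟶ H') (G : y ⟶ y') {t : y' ⟶ y'}
    (u : G ⟶ G ≫ t) :
    (H ◁ u ≫ (α_ _ _ _).inv) ≫ (ψ ▷ G) ▷ t = ψ ▷ G ≫ H' ◁ u ≫ (α_ _ _ _).inv := by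
  rw [← whisker_exchange_assoc]; simp

theorem postcomp_section {G : x ⟶ y} {t : y ⟶ y} {t' : y' ⟶ y'} (M : y ⟶ y')
    (u : G ⟶ G ≫ t) (p : t ⟶ 𝟙 y) (p' : t' ⟶ 𝟙 y') (a : t ≫ M ⟶ M ≫ t')
    (h : u ≫ G ◁ p ≫ (ρ_ G).hom = 𝟙 G) (ha : a ≫ M ◁ p' ≫ (ρ_ M).hom = p ▷ M ≫ (λ_ M).hom) :
    (u ▷ M ≫ (α_ _ _ _).hom ≫ G ◁ a ≫ (α_ _ _ _).inv) ≫ (G ≫ M) ◁ p' ≫ (ρ_ (G ≫ M)).hom =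
      𝟙 (G ≫ M) := by
  replace h := congrArg (fun t => t ▷ M) h
  have h3 := congrArg (fun t => G ◁ t) ha
  simp only [whiskerLeft_comp, comp_whiskerRight, id_whiskerRight] at h h3
  calc _ = 𝟙 _ ⊗≫ u ▷ M ⊗≫ (G ◁ a ≫ G ◁ M ◁ p' ≫ G ◁ (ρ_ M).hom) := by bicategory
    _ = 𝟙 _ ⊗≫ (u ▷ M ≫ (G ◁ p) ▷ M ≫ (ρ_ G).hom ▷ M) := by rw [h3]; bicategory
    _ = _ := by rw [h]; bicategory

theorem postcomp_natural {G H : x ⟶ y} {t : y ⟶ y} {t' : y' ⟶ y'} (M : y ⟶ y')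
    (u : G ⟶ G ≫ t) (u' : H ⟶ H ≫ t) (a : t ≫ M ⟶ M ≫ t') (f : G ⟶ H)
    (h : u ≫ f ▷ t = f ≫ u') :
    (u ▷ M ≫ (α_ _ _ _).hom ≫ G ◁ a ≫ (α_ _ _ _).inv) ≫ (f ▷ M) ▷ t' =
      f ▷ M ≫ u' ▷ M ≫ (α_ _ _ _).hom ≫ H ◁ a ≫ (α_ _ _ _).inv := by
  replace h := congrArg (fun t => t ▷ M) h
  simp only [comp_whiskerRight] at h
  calc _ = 𝟙 _ ⊗≫ u ▷ M ⊗≫ (G ◁ a ≫ f ▷ (M ≫ t')) ⊗≫ 𝟙 _ := by bicategory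
    _ = 𝟙 _ ⊗≫ (u ▷ M ≫ f ▷ t ▷ M) ⊗≫ H ◁ a ⊗≫ 𝟙 _ := by rw [whisker_exchange]; bicategory
    _ = _ := by rw [h]; bicategory

theorem postcomp₂_natural {G : x ⟶ y} {t : y ⟶ y} {t' : y' ⟶ y'} {M N : y ⟶ y'} (φ : M ⟶ N)
    (u : G ⟶ G ≫ t) (a : t ≫ M ⟶ M ≫ t') (b : t ≫ N ⟶ N ≫ t')
    (h : a ≫ φ ▷ t' = t ◁ φ ≫ b) :
    (u ▷ M ≫ (α_ _ _ _).hom ≫ G ◁ a ≫ (α_ _ _ _).inv) ≫ (G ◁ φ) ▷ t' =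
      G ◁ φ ≫ u ▷ N ≫ (α_ _ _ _).hom ≫ G ◁ b ≫ (α_ _ _ _).inv := by
  replace h := congrArg (fun t => G ◁ t) h
  simp only [whiskerLeft_comp] at h
  calc _ = 𝟙 _ ⊗≫ u ▷ M ⊗≫ (G ◁ a ≫ G ◁ φ ▷ t') ⊗≫ 𝟙 _ := by bicategory
    _ = 𝟙 _ ⊗≫ (u ▷ M ≫ (G ≫ t) ◁ φ) ⊗≫ G ◁ b ⊗≫ 𝟙 _ := by rw [h]; bicategory
    _ = _ := by rw [← whisker_exchange]; bicategory

theorem zero_section {t : x ⟶ x} (z : 𝟙 x ⟶ t) (p : t ⟶ 𝟙 x) (h : z ≫ p = 𝟙 (𝟙 x)) :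
    (z ≫ (λ_ t).inv) ≫ 𝟙 x ◁ p ≫ (ρ_ (𝟙 x)).hom = 𝟙 (𝟙 x) := by
  rw [← h, ← unitors_equal]; simp

end

section
variable {K : Type u} [Bicategory.{w, v} K]

/-- A vector field on `G` in the Hom-tangent category of lax tangent morphisms from `X'` to `X`,
whose tangent bundle functor is `G ↦ (T, c) ∘ G` and whose projection at `G` is `p_G`. -/
@[ext]
structure VecOn {X' X : Tangentad K} (G : X' ⟶ X) where
  field : G ⟶ G ≫ tan X
  field_p : field ≫ G ◁ pHom X ≫ (ρ_ G).hom = 𝟙 G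

/-- An object of the category of vector fields of a Hom-tangent category. -/
structure VecField (X' X : Tangentad K) where
  base : X' ⟶ X
  vec : VecOn base

/-- A morphism of vector fields in a Hom-tangent category. -/
@[ext]
structure VecHom {X' X : Tangentad K} (V W : VecField X' X) where
  hom : V.base ⟶ W.base
  comm : V.vec.field ≫ hom ▷ tan X = hom ≫ W.vec.field

instance (X' X : Tangentad K) : Category (VecField X' X) where
  Hom V W := VecHom V W
  id V := ⟨𝟙 _, by rw [id_whiskerRight, Category.comp_id, Category.id_comp]⟩
  comp f g := ⟨f.hom ≫ g.hom, by
    rw [comp_whiskerRight, ← Category.assoc, f.comm, Category.assoc, g.comm, Category.assoc]⟩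
  id_comp f := VecHom.ext (Category.id_comp _)
  comp_id f := VecHom.ext (Category.comp_id _)
  assoc f g h := VecHom.ext (Category.assoc _ _ _)

/-- The functor induced by a vector field `(G, u)` in the Hom-tangent category from `X` to `Y`:
it sends a lax tangent morphism `H` to the vector field `u_H` on `G ∘ H`. -/
def induced {X Y : Tangentad K} (V : VecField X Y) (X' : Tangentad K) :
    (X' ⟶ X) ⥤ VecField X' Y where
  obj H :=
    { base := H ≫ V.base
      vec :=
        { field := H ◁ V.vec.field ≫ (α_ _ _ _).inv
          field_p := induced_section H V.base V.vec.field (pHom Y) V.vec.field_p } }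
  map ψ := ⟨ψ ▷ V.base, induced_natural ψ V.base V.vec.field⟩
  map_id _ := VecHom.ext (id_whiskerRight _ _)
  map_comp _ _ := VecHom.ext (comp_whiskerRight _ _ _)

/-- The action on vector fields of postcomposition with a lax tangent morphism `(F, α)`: the vector
field `v` on `G` is sent to `α_G ∘ F v` on `F ∘ G`. -/
def postcomp {X Y : Tangentad K} (X' : Tangentad K) (M : X ⟶ Y) :
    VecField X' X ⥤ VecField X' Y where
  obj V :=
    { base := V.base ≫ M
      vec :=
        { field := V.vec.field ▷ M ≫ (α_ _ _ _).hom ≫ V.base ◁ lawHom M ≫ (α_ _ _ _).inv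
          field_p := postcomp_section M V.vec.field (pHom X) (pHom Y) (lawHom M) V.vec.field_p
            (TanHom.ext (LaxMor.law_p M)) } }
  map f := ⟨f.hom ▷ M, postcomp_natural M _ _ (lawHom M) f.hom f.comm⟩
  map_id _ := VecHom.ext (id_whiskerRight _ _)
  map_comp _ _ := VecHom.ext (comp_whiskerRight _ _ _)

/-- The action on vector fields of postcomposition with a tangent 2-morphism. -/
def postcomp₂ {X Y : Tangentad K} (X' : Tangentad K) {M N : X ⟶ Y} (φ : M ⟶ N) :
    postcomp X' M ⟶ postcomp X' N where
  app V := ⟨V.base ◁ φ, postcomp₂_natural φ V.vec.field (lawHom M) (lawHom N)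
    (TanHom.ext (TanHom.comm φ))⟩
  naturality _ _ f := VecHom.ext ((whisker_exchange f.hom φ).symm)

/-- The zero vector field on the identity of `X`. -/
def zeroField (X : Tangentad K) : VecField X X where
  base := 𝟙 X
  vec :=
    { field := zHom X ≫ (λ_ (tan X)).inv
      field_p := zero_section (zHom X) (pHom X) (TanHom.ext X.z_p) }

/-- The underlying 2-morphism `F ⟶ T ∘ F` of a vector field. -/
def VecOn.fld {X' X : Tangentad K} {G : X' ⟶ X} (u : VecOn G) : und G ⟶ und G ≫ X.T :=
  TanHom.hom u.field

theorem VecOn.fld_p {X' X : Tangentad K} {G : X' ⟶ X} (u : VecOn G) :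
    u.fld ≫ und G ◁ X.p ≫ (ρ_ (und G)).hom = 𝟙 (und G) :=
  congrArg TanHom.hom u.field_p

theorem VecOn.fld_comm {X' X : Tangentad K} {G : X' ⟶ X} (u : VecOn G) :
    LaxMor.law G ≫ u.fld ▷ X.T = X'.T ◁ u.fld ≫
      (α_ _ _ _).inv ≫ LaxMor.law G ▷ X.T ≫ (α_ _ _ _).hom ≫ und G ◁ X.c ≫ (α_ _ _ _).inv :=
  TanHom.comm u.field

theorem Tangentad.isPullback₀ (X : Tangentad K) {Y : K} (F : Y ⟶ X.obj) :
    IsPullback (F ◁ X.π₁) (F ◁ X.π₂) (F ◁ X.p) (F ◁ X.p) :=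
  IsPullback.of_iso (X.isPullback 0 F) (whiskerLeftIso F (ρ_ _)) (whiskerLeftIso F (ρ_ _))
    (whiskerLeftIso F (ρ_ _)) (whiskerLeftIso F (ρ_ _))
    (by simp [iter]) (by simp [iter]) (by simp [iter]) (by simp [iter])

/-- The 2-morphism `⟨u, u'⟩ : F ⟶ T₂ ∘ F` of `K` induced by a pair of vector fields. -/
noncomputable def VecOn.pair {X' X : Tangentad K} {G : X' ⟶ X} (u u' : VecOn G) :
    und G ⟶ und G ≫ X.T₂ :=
  (X.isPullback₀ (und G)).lift u.fld u'.fld (by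
    rw [← cancel_mono (ρ_ (und G)).hom, Category.assoc, Category.assoc, u.fld_p, u'.fld_p])

/-- The sum `s ∘ ⟨u, u'⟩` of two vector fields on the same base. -/
noncomputable def VecOn.add {X' X : Tangentad K} {G : X' ⟶ X} (u u' : VecOn G) : VecOn G where
  field :=
    { hom := u.pair u' ≫ und G ◁ X.s
      comm := by
        obtain ⟨c₂, k1, k2, k3⟩ := X.s_c
        have hs : X.s ▷ X.T = c₂ ≫ X.T ◁ X.s ≫ X.c := by
          rw [← Category.assoc, ← k3, Category.assoc, X.c_c, Category.comp_id]
        have key : ∀ (w : VecOn G) (x : X.T₂ ⟶ X.T), u.pair u' ≫ und G ◁ x = w.fld →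
            c₂ ≫ X.T ◁ x = x ▷ X.T ≫ X.c →
            (LaxMor.law G ≫ u.pair u' ▷ X.T ≫ (α_ _ _ _).hom ≫ und G ◁ c₂ ≫
              (α_ _ _ _).inv) ≫ (und G ≫ X.T) ◁ x =
            (X'.T ◁ u.pair u' ≫ (α_ _ _ _).inv ≫ LaxMor.law G ▷ X.T₂) ≫
              (und G ≫ X.T) ◁ x := by
          intro w x h1 h2
          have hc := w.fld_comm
          have hcc : und G ◁ X.c ≫ und G ◁ X.c = 𝟙 _ := by
            rw [← whiskerLeft_comp, X.c_c, whiskerLeft_id]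
          have h3 := congrArg (fun t => und G ◁ t) h2
          have h4 := congrArg (fun t => t ▷ X.T) h1
          have h5 := congrArg (fun t => X'.T ◁ t) h1
          simp only [whiskerLeft_comp, comp_whiskerRight] at h3 h4 h5
          calc _ = 𝟙 _ ⊗≫ LaxMor.law G ⊗≫ u.pair u' ▷ X.T ⊗≫
                  (und G ◁ c₂ ≫ und G ◁ X.T ◁ x) ⊗≫ 𝟙 _ := by bicategory
            _ = 𝟙 _ ⊗≫ LaxMor.law G ⊗≫ (u.pair u' ▷ X.T ≫ (und G ◁ x) ▷ X.T) ⊗≫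
                  und G ◁ X.c ⊗≫ 𝟙 _ := by rw [h3]; bicategory
            _ = 𝟙 _ ⊗≫ (LaxMor.law G ≫ w.fld ▷ X.T) ⊗≫ und G ◁ X.c ⊗≫ 𝟙 _ := by
                  rw [h4]; bicategory
            _ = 𝟙 _ ⊗≫ X'.T ◁ w.fld ⊗≫ LaxMor.law G ▷ X.T ⊗≫
                  (und G ◁ X.c ≫ und G ◁ X.c) ⊗≫ 𝟙 _ := by rw [hc]; bicategory
            _ = 𝟙 _ ⊗≫ (X'.T ◁ u.pair u' ≫ X'.T ◁ und G ◁ x) ⊗≫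
                  LaxMor.law G ▷ X.T ⊗≫ 𝟙 _ := by rw [hcc, h5]; bicategory
            _ = 𝟙 _ ⊗≫ X'.T ◁ u.pair u' ⊗≫ ((X'.T ≫ und G) ◁ x ≫ LaxMor.law G ▷ X.T) ⊗≫
                  𝟙 _ := by bicategory
            _ = _ := by rw [whisker_exchange]; bicategory
        have main : LaxMor.law G ≫ u.pair u' ▷ X.T ≫ (α_ _ _ _).hom ≫ und G ◁ c₂ ≫
              (α_ _ _ _).inv =
            X'.T ◁ u.pair u' ≫ (α_ _ _ _).inv ≫ LaxMor.law G ▷ X.T₂ :=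
          (X.isPullback₀ (und G ≫ X.T)).hom_ext
            (key u X.π₁ ((X.isPullback₀ (und G)).lift_fst _ _ _) k1)
            (key u' X.π₂ ((X.isPullback₀ (und G)).lift_snd _ _ _) k2)
        have hs2 := congrArg (fun t => und G ◁ t) hs
        simp only [whiskerLeft_comp] at hs2
        change LaxMor.law G ≫ (u.pair u' ≫ und G ◁ X.s) ▷ X.T =
          X'.T ◁ (u.pair u' ≫ und G ◁ X.s) ≫ (α_ _ _ _).inv ≫ LaxMor.law G ▷ X.T ≫
            (α_ _ _ _).hom ≫ und G ◁ X.c ≫ (α_ _ _ _).inv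
        calc _ = 𝟙 _ ⊗≫ LaxMor.law G ⊗≫ u.pair u' ▷ X.T ⊗≫ und G ◁ X.s ▷ X.T ⊗≫ 𝟙 _ := by
                bicategory
          _ = 𝟙 _ ⊗≫ (LaxMor.law G ≫ u.pair u' ▷ X.T ≫ (α_ _ _ _).hom ≫ und G ◁ c₂ ≫
                (α_ _ _ _).inv) ⊗≫ und G ◁ X.T ◁ X.s ⊗≫ und G ◁ X.c ⊗≫ 𝟙 _ := by
                rw [hs2]; bicategory
          _ = 𝟙 _ ⊗≫ X'.T ◁ u.pair u' ⊗≫ (LaxMor.law G ▷ X.T₂ ≫ (und G ≫ X.T) ◁ X.s) ⊗≫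
                und G ◁ X.c ⊗≫ 𝟙 _ := by rw [main]; bicategory
          _ = _ := by rw [← whisker_exchange]; bicategory }
  field_p := TanHom.ext' (by
    have h1 := u.fld_p
    have h2 : u.pair u' ≫ und G ◁ X.π₁ = u.fld :=
      (X.isPullback₀ (und G)).lift_fst _ _ _
    change (u.pair u' ≫ und G ◁ X.s) ≫ und G ◁ X.p ≫ (ρ_ (und G)).hom = 𝟙 _
    have h3 : und G ◁ X.s ≫ und G ◁ X.p = und G ◁ X.π₁ ≫ und G ◁ X.p := by
      rw [← whiskerLeft_comp, X.s_p, whiskerLeft_comp]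
    rw [Category.assoc, reassoc_of% h3, ← Category.assoc, h2, h1])


/-- Transport of a vector field along an equality of base 1-morphisms. -/
def VecOn.cast {X' X : Tangentad K} {G G' : X' ⟶ X} (h : G = G') (u : VecOn G) : VecOn G' :=
  h ▸ u

/-- Two vector fields on the same base commute: `T v ∘ u = c ∘ T u ∘ v`. -/
def VecOn.Commute {X' X : Tangentad K} {G : X' ⟶ X} (u v : VecOn G) : Prop :=
  u.fld ≫ v.fld ▷ X.T ≫ (α_ _ _ _).hom =
    v.fld ≫ u.fld ▷ X.T ≫ (α_ _ _ _).hom ≫ und G ◁ X.c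

/-- A tangentad of vector fields of `X`: a tangentad `VF`, a strict tangent morphism `U` to `X` and
a universal vector field `v` on `U`, i.e. such that for every tangentad `X'` the induced functor
(a strict tangent morphism, since `U` is strict) from `[X' ‖ VF]` to the vector fields of
`[X' ‖ X]` is invertible. -/
structure VFConstruction (X : Tangentad K) where
  VF : Tangentad K
  U : VF ⟶ X
  U_strict : IsStrict U
  v : VecOn U
  universal : ∀ X' : Tangentad K, ∃ Λ : VecField X' X ⥤ (X' ⟶ VF),
    induced ⟨U, v⟩ X' ⋙ Λ = 𝟭 (X' ⟶ VF) ∧ Λ ⋙ induced ⟨U, v⟩ X' = 𝟭 (VecField X' X)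

namespace VFConstruction

variable {X : Tangentad K}

/-- The universal vector field. -/
def univ (V : VFConstruction X) : VecField V.VF X := ⟨V.U, V.v⟩

/-- The inverse of the functor induced by the universal vector field. -/
noncomputable def inverse (V : VFConstruction X) (X' : Tangentad K) :
    VecField X' X ⥤ (X' ⟶ V.VF) :=
  (V.universal X').choose

theorem induced_inverse (V : VFConstruction X) {X' : Tangentad K} (w : VecField X' X) :
    (induced V.univ X').obj ((V.inverse X').obj w) = w :=
  Functor.congr_obj (V.universal X').choose_spec.2 w

theorem inverse_comp_U (V : VFConstruction X) {X' : Tangentad K} (w : VecField X' X) :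
    (V.inverse X').obj w ≫ V.U = w.base :=
  congrArg VecField.base (V.induced_inverse w)

/-- The 1-morphism `0 : X ⟶ VF X` corresponding to the zero vector field on the identity. -/
noncomputable def zero (V : VFConstruction X) : X ⟶ V.VF :=
  (V.inverse X).obj (zeroField X)

end VFConstruction

/-- The assignment `VF` on tangentads, lax tangent 1-morphisms and tangent 2-morphisms: `VF (F, α)`
and `VF φ` correspond to the images of the universal vector field under postcomposition. -/
noncomputable def VFmap (V : ∀ X : Tangentad K, VFConstruction X) :
    PrelaxFunctorStruct (Tangentad K) (Tangentad K) where
  obj X := (V X).VF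
  map {X Y} M := ((V Y).inverse (V X).VF).obj ((postcomp (V X).VF M).obj (V X).univ)
  map₂ {X Y _ _} φ := ((V Y).inverse (V X).VF).map ((postcomp₂ (V X).VF φ).app (V X).univ)

end

section
variable {B : Type u} [Bicategory.{w, v} B]

/-- The 2-pullback of `f` and `g` in a 2-category: the square commutes strictly, and for every `Y`
the category of 1-morphisms `Y ⟶ P` is isomorphic to the pullback of those into `A` and `A'`. -/
structure Is2Pullback {P A A' C : B} (π₁ : P ⟶ A) (π₂ : P ⟶ A') (f : A ⟶ C) (g : A' ⟶ C) :
    Prop where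
  comm : π₁ ≫ f = π₂ ≫ g
  lift₁ : ∀ {Y : B} (a : Y ⟶ A) (b : Y ⟶ A'), a ≫ f = b ≫ g →
    ∃! t : Y ⟶ P, t ≫ π₁ = a ∧ t ≫ π₂ = b
  lift₂ : ∀ {Y : B} (t t' : Y ⟶ P) (φ : t ≫ π₁ ⟶ t' ≫ π₁) (ψ : t ≫ π₂ ⟶ t' ≫ π₂),
    φ ▷ f ≫ (α_ t' π₁ f).hom ≫ t' ◁ eqToHom comm =
      (α_ t π₁ f).hom ≫ t ◁ eqToHom comm ≫ (α_ t π₂ g).inv ≫ ψ ▷ g ≫ (α_ t' π₂ g).hom →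
    ∃! τ : t ⟶ t', τ ▷ π₁ = φ ∧ τ ▷ π₂ = ψ

/-- The pairing `⟨a, b⟩` into a 2-pullback. -/
noncomputable def Is2Pullback.pair {P A A' C : B} {π₁ : P ⟶ A} {π₂ : P ⟶ A'} {f : A ⟶ C}
    {g : A' ⟶ C} (h : Is2Pullback π₁ π₂ f g) {Y : B} (a : Y ⟶ A) (b : Y ⟶ A')
    (hab : a ≫ f = b ≫ g) : Y ⟶ P :=
  (h.lift₁ a b hab).choose

/-- `S` is a 2-functor (strictly functorial), `η` and `μ` are 2-natural transformations, and
`(S, η, μ)` satisfies the strict unit and associativity laws of a 2-monad on `B`. -/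
structure Is2Monad (S : PrelaxFunctorStruct B B) (η : ∀ X, X ⟶ S.obj X)
    (μ : ∀ X, S.obj (S.obj X) ⟶ S.obj X) : Prop where
  isTwoFunctor : ∃ Φ : StrictPseudofunctor B B, Φ.toPrelaxFunctorStruct = S
  η_naturality : ∀ {X Y : B} (f : X ⟶ Y), f ≫ η Y = η X ≫ S.map f
  η_naturality₂ : ∀ {X Y : B} {f g : X ⟶ Y} (φ : f ⟶ g),
    φ ▷ η Y ≫ eqToHom (η_naturality g) = eqToHom (η_naturality f) ≫ η X ◁ S.map₂ φ
  μ_naturality : ∀ {X Y : B} (f : X ⟶ Y), S.map (S.map f) ≫ μ Y = μ X ≫ S.map f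
  μ_naturality₂ : ∀ {X Y : B} {f g : X ⟶ Y} (φ : f ⟶ g),
    S.map₂ (S.map₂ φ) ▷ μ Y ≫ eqToHom (μ_naturality g) =
      eqToHom (μ_naturality f) ≫ μ X ◁ S.map₂ φ
  left_unit : ∀ X, η (S.obj X) ≫ μ X = 𝟙 (S.obj X)
  right_unit : ∀ X, S.map (η X) ≫ μ X = 𝟙 (S.obj X)
  assoc : ∀ X, S.map (μ X) ≫ μ X = μ (S.obj X) ≫ μ X

end

section
variable {K : Type u} [Bicategory.{w, v} K]

/-- The tangentad `VF₂` of pairs of vector fields on the same base: the 2-pullback of `U` along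
itself, in the 2-category of tangentads and in `K`, with strict projections. -/
structure VFPairs {X : Tangentad K} (V : VFConstruction X) where
  VF₂ : Tangentad K
  π₁ : VF₂ ⟶ V.VF
  π₂ : VF₂ ⟶ V.VF
  π₁_strict : IsStrict π₁
  π₂_strict : IsStrict π₂
  is2Pullback : Is2Pullback π₁ π₂ V.U V.U
  is2Pullback_und : Is2Pullback (und π₁) (und π₂) (und V.U) (und V.U)

/-- The 1-morphism `+ : VF₂ X ⟶ VF X` corresponding to the sum of the vector fields `v₁` and `v₂`
that correspond to the two projections. -/
noncomputable def VFPairs.add {X : Tangentad K} {V : VFConstruction X} (D : VFPairs V) :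
    D.VF₂ ⟶ V.VF :=
  (V.inverse D.VF₂).obj
    ⟨D.π₁ ≫ V.U, VecOn.add ((induced V.univ D.VF₂).obj D.π₁).vec
      (VecOn.cast D.is2Pullback.comm.symm ((induced V.univ D.VF₂).obj D.π₂).vec)⟩

variable (V : ∀ X : Tangentad K, VFConstruction X)

theorem U_comp_U (X : Tangentad K) :
    (V (V X).VF).U ≫ (V X).U = (VFmap V).map (V X).U ≫ (V X).U :=
  ((V X).inverse_comp_U ((postcomp (V (V X).VF).VF (V X).U).obj (V (V X).VF).univ)).symm

/-- The multiplication `μ = + ∘ ⟨U_VF, VF U⟩`. -/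
noncomputable def mult (D : ∀ X, VFPairs (V X)) (X : Tangentad K) :
    (VFmap V).obj ((VFmap V).obj X) ⟶ (VFmap V).obj X :=
  (D X).is2Pullback.pair (V (V X).VF).U ((VFmap V).map (V X).U) (U_comp_U V X) ≫ (D X).add

/-- The first of the two vector fields that make up a 1-morphism into `VF² X`. -/
noncomputable def fstField {X X' : Tangentad K} (H : X' ⟶ (VFmap V).obj ((VFmap V).obj X)) :
    VecOn ((H ≫ (V (V X).VF).U) ≫ (V X).U) :=
  ((induced (V X).univ X').obj (H ≫ (V (V X).VF).U)).vec

/-- The second of the two vector fields that make up a 1-morphism into `VF² X`. -/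
noncomputable def sndField [Strict K] {X X' : Tangentad K}
    (H : X' ⟶ (VFmap V).obj ((VFmap V).obj X)) : VecOn ((H ≫ (V (V X).VF).U) ≫ (V X).U) :=
  VecOn.cast
    (by
      have h1 := Strict.assoc H ((VFmap V).map (V X).U) (V X).U
      have h2 := Strict.assoc H (V (V X).VF).U (V X).U
      exact h1.trans ((congrArg (fun t => H ≫ t) (U_comp_U V X).symm).trans h2.symm))
    ((induced (V X).univ X').obj (H ≫ (VFmap V).map (V X).U)).vec

end

end TangentadTheory

open TangentadTheory

namespace TangentadTheory

/-! ### Trivial tangentads and the universal property of `VF` inside `K` -/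

section
variable {C : Type*} [Category C]

/-! On the trivial tangentad `triv Y` the zero is an identity, so compatibility with zeros forces
the law. Lax tangent morphisms and tangent 2-morphisms out of `triv Y` are therefore just
1-morphisms and 2-morphisms of `K` out of `Y`. Testing the universal field on trivial tangentads
shows that the object underlying `VF X` classifies, already in `K`, the sections of `p` on
1-morphisms into `X`. A 2-pullback `P` of `U` along itself then classifies pairs of sections on one
base.

The tangent structure on `P` comes from this alone. An endo-1-morphism `A` of `X` with an invertible
law `A ≫ T ≅ T ≫ A` over `p` turns fields into fields, hence lifts to `P`
(`VFConstruction.exists_lift`, `Is2Pullback.exists_lift`). A 2-morphism that respects the laws lifts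
as well (`LiftEndo.exists_over`), and only once, since whiskering with `P ⟶ X` is faithful. The flip
`c` supplies laws for `T` and its fibre powers, and the axioms say that `p`, `z`, `s`, `l`, `c`
respect them. Equations then lift by `Over.eq` and limits by `LiftEndo.exists_factor`. The lift of
`T` commutes on the nose with both projections, which makes them strict. A law into `P` is a
compatible pair of laws into `VF X`, so `P` is also the 2-pullback of tangentads
(`Is2Pullback.of_und`).

For the monad, 1-morphisms into `VF X` are replaced by the vector fields that they classify. Fields
on a fixed base form a commutative monoid, and precomposition and postcomposition with lax tangent
morphisms preserve sums and zeros. A 1-morphism into `VF² X` encodes two fields and `μ` adds them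
(`VFPairs.induced_comp_mul`), so the unit laws become `v + 0 = v = 0 + v` and associativity becomes
that of a sum of three fields. Equations between 2-morphisms are checked after whiskering with `U`.
The two fields commute because the universal field is a tangent 2-morphism, and its compatibility
with the laws involves `c`. -/

theorem isFibrePower_of_isIso {n : ℕ} (hn : 0 < n) {E B P : C} (q : E ⟶ B) [IsIso q]
    (f : P ⟶ E) [IsIso f] : IsFibrePower q (fun _ : Fin n => f) := by
  refine ⟨fun _ _ => rfl, fun Z g hg => ⟨g ⟨0, hn⟩ ≫ inv f, fun i => ?_, fun k hk => ?_⟩⟩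
  · rw [Category.assoc, IsIso.inv_hom_id, Category.comp_id, ← cancel_mono q]
    exact hg _ _
  · rw [← hk ⟨0, hn⟩]; simp

end

section
variable {K : Type u} [Bicategory.{w, v} K]

/-- The trivial tangentad on an object of `K`, with the identity as tangent bundle 1-morphism. -/
def triv (Y : K) : Tangentad K where
  obj := Y
  T := 𝟙 Y
  p := 𝟙 _
  z := 𝟙 _
  T₂ := 𝟙 Y
  π₁ := 𝟙 _
  π₂ := 𝟙 _
  s := 𝟙 _
  l := (λ_ _).inv
  c := 𝟙 _
  isPullback m Z F := IsPullback.of_vert_isIso ⟨rfl⟩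
  exists_power n hn := ⟨𝟙 Y, fun _ => 𝟙 _, fun m Z F => isFibrePower_of_isIso hn _ _⟩
  z_p := by simp
  s_p := by simp
  s_assoc a b a' b' h1 h2 h3 h4 h5 := by simpa using h2.trans h4.symm |>.trans (by simp)
  s_unit e h1 h2 := by simpa using h2
  s_comm τ h1 h2 := by simpa using h1
  l_p := by simp
  z_l := by simp
  s_l := ⟨(λ_ _).inv, by simp, by simp, by simp⟩
  c_p := by simp [unitors_equal]
  z_c := by simp
  s_c := ⟨𝟙 _, by simp, by simp, by simp⟩
  l_coassoc := by simp [unitors_inv_equal]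
  l_c := by simp
  l_c_c := by simp [unitors_inv_equal]
  c_c := by simp
  c_braid := by simp
  lift_universal := ⟨(λ_ _).inv, by simp, by simp [unitors_inv_equal], fun F => by
    have h : IsIso ((λ_ (𝟙 Y)).inv ≫ 𝟙 (𝟙 Y) ▷ 𝟙 Y) := inferInstance
    exact IsPullback.of_vert_isIso ⟨by simp⟩⟩

/-- The zero of `triv Y` is an identity, so the axiom `z_law` leaves no freedom. This identifies lax
tangent morphisms out of `triv Y` with 1-morphisms of `K`. -/
theorem law_of_triv {Y : K} {X : Tangentad K} (M : LaxMor (triv Y) X) :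
    M.law = (λ_ M.F).hom ≫ (ρ_ M.F).inv ≫ M.F ◁ X.z := by
  rw [← M.z_law]
  simp only [triv, id_whiskerRight]
  exact (Category.id_comp _).symm

theorem triv_law_p {x y : K} (F : x ⟶ y) {t : y ⟶ y} (z : 𝟙 y ⟶ t) (p : t ⟶ 𝟙 y)
    (h : z ≫ p = 𝟙 _) :
    ((λ_ F).hom ≫ (ρ_ F).inv ≫ F ◁ z) ≫ F ◁ p ≫ (ρ_ F).hom = 𝟙 (𝟙 x) ▷ F ≫ (λ_ F).hom := by
  have h := congrArg (fun t => F ◁ t) h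
  simp only [whiskerLeft_comp, whiskerLeft_id] at h
  simp only [Category.assoc, reassoc_of% h]
  simp

theorem triv_l_law {x y : K} (F : x ⟶ y) {t : y ⟶ y} (z : 𝟙 y ⟶ t) (l : t ⟶ t ≫ t)
    (h : z ≫ l = z ≫ (λ_ t).inv ≫ z ▷ t) :
    (λ_ (𝟙 x)).inv ▷ F ≫ (α_ _ _ _).hom ≫ 𝟙 x ◁ ((λ_ F).hom ≫ (ρ_ F).inv ≫ F ◁ z) ≫
      (α_ _ _ _).inv ≫ ((λ_ F).hom ≫ (ρ_ F).inv ≫ F ◁ z) ▷ t ≫ (α_ _ _ _).hom =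
    ((λ_ F).hom ≫ (ρ_ F).inv ≫ F ◁ z) ≫ F ◁ l := by
  have h := congrArg (fun t => F ◁ t) h
  simp only [whiskerLeft_comp] at h
  simp only [Category.assoc, h]
  bicategory

theorem triv_c_law {x y : K} (F : x ⟶ y) {t : y ⟶ y} (z : 𝟙 y ⟶ t) (c : t ≫ t ⟶ t ≫ t)
    (h : z ▷ t ≫ c = (λ_ t).hom ≫ (ρ_ t).inv ≫ t ◁ z) :
    𝟙 (𝟙 x ≫ 𝟙 x) ▷ F ≫ (α_ _ _ _).hom ≫ 𝟙 x ◁ ((λ_ F).hom ≫ (ρ_ F).inv ≫ F ◁ z) ≫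
      (α_ _ _ _).inv ≫ ((λ_ F).hom ≫ (ρ_ F).inv ≫ F ◁ z) ▷ t ≫ (α_ _ _ _).hom =
    (α_ _ _ _).hom ≫ 𝟙 x ◁ ((λ_ F).hom ≫ (ρ_ F).inv ≫ F ◁ z) ≫
      (α_ _ _ _).inv ≫ ((λ_ F).hom ≫ (ρ_ F).inv ≫ F ◁ z) ▷ t ≫ (α_ _ _ _).hom ≫ F ◁ c := by
  have h := congrArg (fun t => F ◁ t) h
  simp only [whiskerLeft_comp] at h
  symm
  calc _ = 𝟙 _ ⊗≫ F ◁ z ⊗≫ (F ◁ z ▷ t ≫ F ◁ c) := by bicategory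
    _ = 𝟙 _ ⊗≫ F ◁ (z ▷ 𝟙 y ≫ t ◁ z) := by rw [h]; bicategory
    _ = _ := by rw [← whisker_exchange]; bicategory

theorem triv_natural {x y : K} {F G : x ⟶ y} (f : F ⟶ G) {t : y ⟶ y} (z : 𝟙 y ⟶ t) :
    ((λ_ F).hom ≫ (ρ_ F).inv ≫ F ◁ z) ≫ f ▷ t = 𝟙 x ◁ f ≫ (λ_ G).hom ≫ (ρ_ G).inv ≫ G ◁ z := by
  simp only [Category.assoc]
  rw [whisker_exchange]
  simp

theorem Tangentad.exists_lift (X : Tangentad K) {Y : K} {F : Y ⟶ X.obj} {Z : Y ⟶ X.obj}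
    (a b : Z ⟶ F ≫ X.T) (h : a ≫ F ◁ X.p = b ≫ F ◁ X.p) :
    ∃ e : Z ⟶ F ≫ X.T₂, e ≫ F ◁ X.π₁ = a ∧ e ≫ F ◁ X.π₂ = b :=
  ⟨_, (X.isPullback₀ F).lift_fst a b h, (X.isPullback₀ F).lift_snd a b h⟩

theorem Tangentad.exists_endo_lift (X : Tangentad K) {Z : X.obj ⟶ X.obj} (a b : Z ⟶ X.T)
    (h : a ≫ X.p = b ≫ X.p) : ∃ e : Z ⟶ X.T₂, e ≫ X.π₁ = a ∧ e ≫ X.π₂ = b := by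
  obtain ⟨e, h1, h2⟩ := X.exists_lift (F := 𝟙 _) (a ≫ (λ_ _).inv) (b ≫ (λ_ _).inv) (by
    simp [h])
  refine ⟨e ≫ (λ_ _).hom, ?_, ?_⟩
  · rw [Category.assoc, ← leftUnitor_naturality, reassoc_of% h1]; simp
  · rw [Category.assoc, ← leftUnitor_naturality, reassoc_of% h2]; simp

theorem Tangentad.lift_ext (X : Tangentad K) {Y : K} {F : Y ⟶ X.obj} {Z : Y ⟶ X.obj}
    {a b : Z ⟶ F ≫ X.T₂} (h₁ : a ≫ F ◁ X.π₁ = b ≫ F ◁ X.π₁)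
    (h₂ : a ≫ F ◁ X.π₂ = b ≫ F ◁ X.π₂) : a = b :=
  (X.isPullback₀ F).hom_ext h₁ h₂

/-- The axiom concerns a single 2-morphism `T ⟶ T₂`. It passes to generalized elements `Z ⟶ F ≫ T`
because `T₂` is a pointwise pullback: the pair at hand is the image of that universal one. -/
theorem Tangentad.s_unit_at (X : Tangentad K) {Y : K} {F : Y ⟶ X.obj} {Z : Y ⟶ X.obj}
    (t : Z ⟶ F ≫ X.T) (e : Z ⟶ F ≫ X.T₂) (h₁ : e ≫ F ◁ X.π₁ = t ≫ F ◁ (X.p ≫ X.z))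
    (h₂ : e ≫ F ◁ X.π₂ = t) : e ≫ F ◁ X.s = t := by
  obtain ⟨e', h3, h4⟩ := X.exists_endo_lift (X.p ≫ X.z) (𝟙 _) (by simp [X.z_p])
  have h5 : e = t ≫ F ◁ e' := by
    apply X.lift_ext
    · rw [h₁, Category.assoc, ← whiskerLeft_comp, h3]
    · rw [h₂, Category.assoc, ← whiskerLeft_comp, h4]; simp
  rw [h5, Category.assoc, ← whiskerLeft_comp, X.s_unit e' h3 h4]; simp

theorem Tangentad.s_comm_at (X : Tangentad K) {Y : K} {F : Y ⟶ X.obj} {Z : Y ⟶ X.obj}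
    (e e' : Z ⟶ F ≫ X.T₂) (h₁ : e ≫ F ◁ X.π₁ = e' ≫ F ◁ X.π₂)
    (h₂ : e ≫ F ◁ X.π₂ = e' ≫ F ◁ X.π₁) : e ≫ F ◁ X.s = e' ≫ F ◁ X.s := by
  have hp : X.π₁ ≫ X.p = X.π₂ ≫ X.p := by
    have := (X.isPullback₀ (𝟙 _)).w
    rw [← whiskerLeft_comp, ← whiskerLeft_comp] at this
    simpa using this
  obtain ⟨τ, h3, h4⟩ := X.exists_endo_lift X.π₂ X.π₁ hp.symm
  have h5 : e = e' ≫ F ◁ τ := by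
    apply X.lift_ext
    · rw [h₁, Category.assoc, ← whiskerLeft_comp, h3]
    · rw [h₂, Category.assoc, ← whiskerLeft_comp, h4]
  rw [h5, Category.assoc, ← whiskerLeft_comp, X.s_comm τ h3 h4]

theorem Tangentad.π_p (X : Tangentad K) : X.π₁ ≫ X.p = X.π₂ ≫ X.p := by
  have := (X.isPullback₀ (𝟙 _)).w
  rw [← whiskerLeft_comp, ← whiskerLeft_comp] at this
  simpa using this

theorem IsFibrePower.of_iso {C : Type*} [Category C] {n : ℕ} {E B P E' B' P' : C} {q : E ⟶ B}
    {π : Fin n → (P ⟶ E)} (h : IsFibrePower q π) {q' : E' ⟶ B'} {π' : Fin n → (P' ⟶ E')}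
    (eP : P ≅ P') (eE : E ≅ E') (eB : B ≅ B') (hq : q ≫ eB.hom = eE.hom ≫ q')
    (hπ : ∀ i, π i ≫ eE.hom = eP.hom ≫ π' i) : IsFibrePower q' π' := by
  have hπ' : ∀ i, π' i = eP.inv ≫ π i ≫ eE.hom := fun i => by rw [hπ]; simp
  have hq' : q' = eE.inv ≫ q ≫ eB.hom := by rw [hq]; simp
  refine ⟨fun i j => ?_, fun Z f hf => ?_⟩
  · simp [hπ', hq', reassoc_of% (h.1 i j)]
  · obtain ⟨k, hk, hk'⟩ := h.2 Z (fun i => f i ≫ eE.inv) (fun i j => by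
      have := hf i j
      rw [hq'] at this
      rw [← cancel_mono eB.hom]
      simpa using this)
    refine ⟨k ≫ eP.hom, fun i => ?_, fun m hm => ?_⟩
    · rw [Category.assoc, ← hπ, reassoc_of% (hk i)]; simp
    · rw [← hk' (m ≫ eP.inv) (fun i => by simp [← hm, hπ'])]; simp

theorem Tangentad.exists_power₀ (X : Tangentad K) {n : ℕ} (hn : 0 < n) :
    ∃ (Tn : X.obj ⟶ X.obj) (π : Fin n → (Tn ⟶ X.T)),
      ∀ {Y : K} (F : Y ⟶ X.obj), IsFibrePower (F ◁ X.p) (fun i => F ◁ π i) := by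
  obtain ⟨Tn, π, h⟩ := X.exists_power n hn
  exact ⟨Tn, π, fun F => (h 0 F).of_iso (whiskerLeftIso F (ρ_ _)) (whiskerLeftIso F (ρ_ _))
    (whiskerLeftIso F (ρ_ _)) (by simp [iter]) (by simp [iter])⟩

/-- The axiom `s_assoc` only covers endo-1-morphisms of the base. It is applied to the universal
triple, carried by the three-fold fibre power, and then restricted along the 2-morphism that
classifies the given triple. -/
theorem Tangentad.s_assoc_at (X : Tangentad K) {Y : K} {F : Y ⟶ X.obj} {Z : Y ⟶ X.obj}
    (a b a' b' : Z ⟶ F ≫ X.T₂) (h : a ≫ F ◁ X.π₂ = b ≫ F ◁ X.π₁)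
    (h₁ : a' ≫ F ◁ X.π₁ = a ≫ F ◁ X.s) (h₂ : a' ≫ F ◁ X.π₂ = b ≫ F ◁ X.π₂)
    (h₃ : b' ≫ F ◁ X.π₁ = a ≫ F ◁ X.π₁) (h₄ : b' ≫ F ◁ X.π₂ = b ≫ F ◁ X.s) :
    a' ≫ F ◁ X.s = b' ≫ F ◁ X.s := by
  obtain ⟨T₃, π, hπ⟩ := X.exists_power₀ (n := 3) (by norm_num)
  have hp : ∀ i j, π i ≫ X.p = π j ≫ X.p := fun i j => by
    have := (hπ (𝟙 _)).1 i j
    rw [← whiskerLeft_comp, ← whiskerLeft_comp] at this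
    simpa using this
  obtain ⟨A, hA₁, hA₂⟩ := X.exists_endo_lift (π 0) (π 1) (hp _ _)
  obtain ⟨B, hB₁, hB₂⟩ := X.exists_endo_lift (π 1) (π 2) (hp _ _)
  obtain ⟨A', hA'₁, hA'₂⟩ := X.exists_endo_lift (A ≫ X.s) (π 2) (by
    rw [Category.assoc, X.s_p, reassoc_of% hA₁]; exact hp _ _)
  obtain ⟨B', hB'₁, hB'₂⟩ := X.exists_endo_lift (π 0) (B ≫ X.s) (by
    rw [Category.assoc, X.s_p, reassoc_of% hB₁]; exact hp _ _)
  have key := X.s_assoc A B A' B' (hA₂.trans hB₁.symm) hA'₁ (hA'₂.trans hB₂.symm)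
    (hB'₁.trans hA₁.symm) hB'₂
  have hab : a ≫ F ◁ X.π₁ ≫ F ◁ X.p = b ≫ F ◁ X.π₁ ≫ F ◁ X.p := by
    rw [(X.isPullback₀ F).w, reassoc_of% h, (X.isPullback₀ F).w]
  have hb := (X.isPullback₀ F).w
  -- The summands of `a` and `b` form one triple, since they share the middle summand by `h`.
  obtain ⟨k, hk, -⟩ := (hπ F).2 Z ![a ≫ F ◁ X.π₁, a ≫ F ◁ X.π₂, b ≫ F ◁ X.π₂] (by
    intro i j
    fin_cases i <;> fin_cases j <;> simp [hab, ← hb])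
  have k0 : k ≫ F ◁ π 0 = a ≫ F ◁ X.π₁ := hk 0
  have k1 : k ≫ F ◁ π 1 = a ≫ F ◁ X.π₂ := hk 1
  have k2 : k ≫ F ◁ π 2 = b ≫ F ◁ X.π₂ := hk 2
  have ha : a = k ≫ F ◁ A := X.lift_ext
    (by rw [Category.assoc, ← whiskerLeft_comp, hA₁, k0])
    (by rw [Category.assoc, ← whiskerLeft_comp, hA₂, k1])
  have hb : b = k ≫ F ◁ B := X.lift_ext
    (by rw [Category.assoc, ← whiskerLeft_comp, hB₁, k1, h])
    (by rw [Category.assoc, ← whiskerLeft_comp, hB₂, k2])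
  have ha' : a' = k ≫ F ◁ A' := X.lift_ext
    (by rw [Category.assoc, ← whiskerLeft_comp, hA'₁, h₁, ha]; simp)
    (by rw [Category.assoc, ← whiskerLeft_comp, hA'₂, h₂, k2])
  have hb' : b' = k ≫ F ◁ B' := X.lift_ext
    (by rw [Category.assoc, ← whiskerLeft_comp, hB'₁, h₃, k0])
    (by rw [Category.assoc, ← whiskerLeft_comp, hB'₂, h₄, hb]; simp)
  rw [ha', hb', Category.assoc, Category.assoc, ← whiskerLeft_comp, ← whiskerLeft_comp, key]

/-- This is `0 + 0 = 0`: the pair of two zeros has sum zero by the unit law. -/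
theorem triv_s_law {x : K} (X : Tangentad K) (F : x ⟶ X.obj) :
    ∃ law₂ : 𝟙 x ≫ F ⟶ F ≫ X.T₂,
      law₂ ≫ F ◁ X.π₁ = 𝟙 (𝟙 x) ▷ F ≫ (λ_ F).hom ≫ (ρ_ F).inv ≫ F ◁ X.z ∧
      law₂ ≫ F ◁ X.π₂ = 𝟙 (𝟙 x) ▷ F ≫ (λ_ F).hom ≫ (ρ_ F).inv ≫ F ◁ X.z ∧
      𝟙 (𝟙 x) ▷ F ≫ (λ_ F).hom ≫ (ρ_ F).inv ≫ F ◁ X.z = law₂ ≫ F ◁ X.s := by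
  simp only [id_whiskerRight, Category.id_comp]
  obtain ⟨e, h1, h2⟩ := X.exists_lift (F := F) ((λ_ F).hom ≫ (ρ_ F).inv ≫ F ◁ X.z)
    ((λ_ F).hom ≫ (ρ_ F).inv ≫ F ◁ X.z) rfl
  refine ⟨e, h1, h2, (X.s_unit_at _ e ?_ h2).symm⟩
  rw [h1, Category.assoc, Category.assoc, ← whiskerLeft_comp, reassoc_of% X.z_p]

/-- A 1-morphism of `K`, as a lax tangent morphism on the trivial tangentad. -/
def LaxMor.ofTriv {Y : K} (X : Tangentad K) (F : Y ⟶ X.obj) : LaxMor (triv Y) X where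
  F := F
  law := (λ_ F).hom ≫ (ρ_ F).inv ≫ F ◁ X.z
  law_p := triv_law_p F X.z X.p X.z_p
  z_law := (congrArg (· ≫ _) (id_whiskerRight _ _)).trans (Category.id_comp _)
  s_law := triv_s_law X F
  l_law := triv_l_law F X.z X.l X.z_l
  c_law := triv_c_law F X.z X.c X.z_c

theorem LaxMor.comm_of_triv {Y : K} {X : Tangentad K} (M N : LaxMor (triv Y) X)
    (f : M.F ⟶ N.F) : M.law ≫ f ▷ X.T = (triv Y).T ◁ f ≫ N.law := by
  rw [law_of_triv M, law_of_triv N]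
  exact triv_natural f X.z

/-- A 2-morphism of `K`, as a tangent 2-morphism on the trivial tangentad. -/
def TanHom.ofTriv {Y : K} {X : Tangentad K} {M N : triv Y ⟶ X} (f : und M ⟶ und N) : M ⟶ N :=
  TanHom.mk f (LaxMor.comm_of_triv M N f)

theorem VecField.exists_fld_eq {X' X : Tangentad K} {A B : VecField X' X} (h : A = B) :
    ∃ h : und A.base = und B.base,
      A.vec.fld ≫ eqToHom h ▷ X.T = eqToHom h ≫ B.vec.fld := by
  subst h
  exact ⟨rfl, by simp⟩

namespace VFConstruction
variable {X : Tangentad K} (V : VFConstruction X)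

theorem bijective_map (X' : Tangentad K) (M N : X' ⟶ V.VF) :
    Function.Bijective ((induced V.univ X').map : (M ⟶ N) → _) := by
  obtain ⟨Λ, h1, h2⟩ := V.universal X'
  have : (induced V.univ X').IsEquivalence :=
    Functor.IsEquivalence.mk' Λ (eqToIso h1.symm) (eqToIso h2)
  exact ⟨(induced V.univ X').map_injective, (induced V.univ X').map_surjective⟩

/-- Fullness of the classifying functor at `triv Y`: the hypothesis says that `φ` is a morphism of
vector fields, and being a tangent 2-morphism is automatic there. The next two results are
faithfulness and surjectivity on objects at `triv Y`. -/
theorem exists_whisker {Y : K} (Z Z' : Y ⟶ V.VF.obj) (φ : Z ≫ und V.U ⟶ Z' ≫ und V.U)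
    (h : Z ◁ V.v.fld ≫ (α_ _ _ _).inv ≫ φ ▷ X.T = φ ≫ Z' ◁ V.v.fld ≫ (α_ _ _ _).inv) :
    ∃ τ : Z ⟶ Z', τ ▷ und V.U = φ := by
  let M : triv Y ⟶ V.VF := LaxMor.ofTriv V.VF Z
  let N : triv Y ⟶ V.VF := LaxMor.ofTriv V.VF Z'
  let f : (induced V.univ (triv Y)).obj M ⟶ (induced V.univ (triv Y)).obj N :=
    ⟨TanHom.ofTriv φ, TanHom.ext' ((Category.assoc _ _ _).trans h)⟩
  obtain ⟨τ, hτ⟩ := (V.bijective_map (triv Y) M N).2 f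
  exact ⟨und₂ τ, congrArg (fun t => und₂ (VecHom.hom t)) hτ⟩

theorem whisker_injective {Y : K} {Z Z' : Y ⟶ V.VF.obj} {τ τ' : Z ⟶ Z'}
    (h : τ ▷ und V.U = τ' ▷ und V.U) : τ = τ' := by
  let M : triv Y ⟶ V.VF := LaxMor.ofTriv V.VF Z
  let N : triv Y ⟶ V.VF := LaxMor.ofTriv V.VF Z'
  let f : M ⟶ N := TanHom.ofTriv τ
  let f' : M ⟶ N := TanHom.ofTriv τ'
  have : f = f' := (V.bijective_map (triv Y) M N).1 (VecHom.ext (TanHom.ext' h))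
  exact congrArg und₂ this

theorem exists_classifying {Y : K} (F : Y ⟶ X.obj) (u : F ⟶ F ≫ X.T)
    (hu : u ≫ F ◁ X.p ≫ (ρ_ F).hom = 𝟙 F) :
    ∃ (Z : Y ⟶ V.VF.obj) (h : Z ≫ und V.U = F),
      Z ◁ V.v.fld ≫ (α_ _ _ _).inv ≫ eqToHom h ▷ X.T = eqToHom h ≫ u := by
  let w : VecField (triv Y) X :=
    ⟨LaxMor.ofTriv X F, ⟨TanHom.ofTriv u, TanHom.ext' hu⟩⟩
  obtain ⟨h, h'⟩ := VecField.exists_fld_eq (V.induced_inverse w)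
  exact ⟨und ((V.inverse (triv Y)).obj w), h, (Category.assoc _ _ _).symm.trans h'⟩

end VFConstruction

end

/-! ### Squares up to isomorphism and the 2-morphisms lying over others -/

section
variable {B : Type u} [Bicategory.{w, v} B]

section
variable {a b c a' b' c' : B} {V : a ⟶ a'} {W : b ⟶ b'} {W' : c ⟶ c'}

/-- The horizontal pasting of two squares that commute up to isomorphism. -/
def pasteIso {u : a ⟶ b} {d : a' ⟶ b'} {u' : b ⟶ c} {d' : b' ⟶ c'}
    (θ : u ≫ W ≅ V ≫ d) (θ' : u' ≫ W' ≅ W ≫ d') : (u ≫ u') ≫ W' ≅ V ≫ d ≫ d' :=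
  α_ _ _ _ ≪≫ whiskerLeftIso u θ' ≪≫ (α_ _ _ _).symm ≪≫ whiskerRightIso θ d' ≪≫ α_ _ _ _

/-- The identity square on `W`. -/
def unitIso (W : b ⟶ b') : 𝟙 b ≫ W ≅ W ≫ 𝟙 b' := λ_ W ≪≫ (ρ_ W).symm

theorem pasteIso_hom {u : a ⟶ b} {d : a' ⟶ b'} {u' : b ⟶ c} {d' : b' ⟶ c'}
    (θ : u ≫ W ≅ V ≫ d) (θ' : u' ≫ W' ≅ W ≫ d') : (pasteIso θ θ').hom =
      (α_ _ _ _).hom ≫ u ◁ θ'.hom ≫ (α_ _ _ _).inv ≫ θ.hom ▷ d' ≫ (α_ _ _ _).hom := rfl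

theorem unitIso_hom (W : b ⟶ b') : (unitIso W).hom = (λ_ W).hom ≫ (ρ_ W).inv := rfl

/-- The 2-morphism `τ` lies over the 2-morphism `φ`, relative to the two squares. -/
def Over {u₁ u₂ : a ⟶ b} {d₁ d₂ : a' ⟶ b'} (θ₁ : u₁ ≫ W ≅ V ≫ d₁) (θ₂ : u₂ ≫ W ≅ V ≫ d₂)
    (τ : u₁ ⟶ u₂) (φ : d₁ ⟶ d₂) : Prop :=
  τ ▷ W ≫ θ₂.hom = θ₁.hom ≫ V ◁ φ

namespace Over
variable {u₁ u₂ u₃ : a ⟶ b} {d₁ d₂ d₃ : a' ⟶ b'} {θ₁ : u₁ ≫ W ≅ V ≫ d₁} {θ₂ : u₂ ≫ W ≅ V ≫ d₂}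
  {θ₃ : u₃ ≫ W ≅ V ≫ d₃}

theorem id (θ₁ : u₁ ≫ W ≅ V ≫ d₁) : Over θ₁ θ₁ (𝟙 _) (𝟙 _) := by simp [Over]

theorem comp {τ : u₁ ⟶ u₂} {φ : d₁ ⟶ d₂} {τ' : u₂ ⟶ u₃} {φ' : d₂ ⟶ d₃}
    (h : Over θ₁ θ₂ τ φ) (h' : Over θ₂ θ₃ τ' φ') : Over θ₁ θ₃ (τ ≫ τ') (φ ≫ φ') := by
  unfold Over at *
  rw [comp_whiskerRight, Category.assoc, h', reassoc_of% h, whiskerLeft_comp]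

/-- As `θ₂` is invertible, `φ` determines `τ ▷ W`, and `W` is faithful on 2-morphisms. Every
equational axiom about lifted 2-morphisms is inherited from the base in this way. -/
theorem eq (hW : ∀ {τ τ' : u₁ ⟶ u₂}, τ ▷ W = τ' ▷ W → τ = τ') {τ τ' : u₁ ⟶ u₂} {φ φ' : d₁ ⟶ d₂}
    (h : Over θ₁ θ₂ τ φ) (h' : Over θ₁ θ₂ τ' φ') (e : φ = φ') : τ = τ' := by
  subst e
  unfold Over at *
  exact hW ((cancel_mono θ₂.hom).1 (h.trans h'.symm))

theorem inv {τ : u₁ ≅ u₂} {φ : d₁ ≅ d₂} (h : Over θ₁ θ₂ τ.hom φ.hom) :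
    Over θ₂ θ₁ τ.inv φ.inv := by
  unfold Over at *
  rw [← cancel_epi (τ.hom ▷ W), hom_inv_whiskerRight_assoc, reassoc_of% h]
  simp

end Over

theorem Over.whiskerLeft {u : a ⟶ b} {d : a' ⟶ b'} {u₁ u₂ : b ⟶ c} {d₁ d₂ : b' ⟶ c'}
    (θ : u ≫ W ≅ V ≫ d) {θ₁ : u₁ ≫ W' ≅ W ≫ d₁} {θ₂ : u₂ ≫ W' ≅ W ≫ d₂}
    {τ : u₁ ⟶ u₂} {φ : d₁ ⟶ d₂} (h : Over θ₁ θ₂ τ φ) :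
    Over (pasteIso θ θ₁) (pasteIso θ θ₂) (u ◁ τ) (d ◁ φ) := by
  have h := congrArg (fun t => u ◁ t) h
  simp only [whiskerLeft_comp] at h
  simp only [Over, pasteIso_hom]
  calc _ = 𝟙 _ ⊗≫ (u ◁ τ ▷ W' ≫ u ◁ θ₂.hom) ⊗≫ θ.hom ▷ d₂ ⊗≫ 𝟙 _ := by bicategory
    _ = 𝟙 _ ⊗≫ u ◁ θ₁.hom ⊗≫ ((u ≫ W) ◁ φ ≫ θ.hom ▷ d₂) ⊗≫ 𝟙 _ := by rw [h]; bicategory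
    _ = _ := by rw [whisker_exchange]; bicategory

theorem Over.whiskerRight {u₁ u₂ : a ⟶ b} {d₁ d₂ : a' ⟶ b'} {u : b ⟶ c} {d : b' ⟶ c'}
    {θ₁ : u₁ ≫ W ≅ V ≫ d₁} {θ₂ : u₂ ≫ W ≅ V ≫ d₂} {τ : u₁ ⟶ u₂} {φ : d₁ ⟶ d₂}
    (h : Over θ₁ θ₂ τ φ) (θ : u ≫ W' ≅ W ≫ d) :
    Over (pasteIso θ₁ θ) (pasteIso θ₂ θ) (τ ▷ u) (φ ▷ d) := by
  have h := congrArg (fun t => t ▷ d) h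
  simp only [comp_whiskerRight] at h
  simp only [Over, pasteIso_hom]
  calc _ = 𝟙 _ ⊗≫ (τ ▷ (u ≫ W') ≫ u₂ ◁ θ.hom) ⊗≫ θ₂.hom ▷ d ⊗≫ 𝟙 _ := by bicategory
    _ = 𝟙 _ ⊗≫ u₁ ◁ θ.hom ⊗≫ (τ ▷ W ▷ d ≫ θ₂.hom ▷ d) ⊗≫ 𝟙 _ := by
      rw [← whisker_exchange]; bicategory
    _ = _ := by rw [h]; bicategory

theorem Over.associator {e e' : B} {W'' : e ⟶ e'} {u : a ⟶ b} {d : a' ⟶ b'} {u' : b ⟶ c}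
    {d' : b' ⟶ c'} {u'' : c ⟶ e} {d'' : c' ⟶ e'} (θ : u ≫ W ≅ V ≫ d) (θ' : u' ≫ W' ≅ W ≫ d')
    (θ'' : u'' ≫ W'' ≅ W' ≫ d'') :
    Over (pasteIso (pasteIso θ θ') θ'') (pasteIso θ (pasteIso θ' θ'')) (α_ u u' u'').hom
      (α_ d d' d'').hom := by
  simp only [Over, pasteIso_hom]
  calc _ = 𝟙 _ ⊗≫ u ◁ u' ◁ θ''.hom ⊗≫ u ◁ θ'.hom ▷ d'' ⊗≫ θ.hom ▷ d' ▷ d'' ⊗≫ 𝟙 _ := by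
        bicategory
    _ = _ := by bicategory

theorem Over.leftUnitor {u : a ⟶ b} {d : a' ⟶ b'} (θ : u ≫ W ≅ V ≫ d) :
    Over (pasteIso (unitIso V) θ) θ (λ_ u).hom (λ_ d).hom := by
  simp only [Over, pasteIso_hom, unitIso_hom]
  bicategory

theorem Over.rightUnitor {u : a ⟶ b} {d : a' ⟶ b'} (θ : u ≫ W ≅ V ≫ d) :
    Over (pasteIso θ (unitIso W)) θ (ρ_ u).hom (ρ_ d).hom := by
  simp only [Over, pasteIso_hom, unitIso_hom]
  bicategory

end
end

/-! ### Lifting endo-1-morphisms and 2-morphisms to a classifying object -/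

section
variable {K : Type u} [Bicategory.{w, v} K]

/-- A distributive law of the endo-1-morphism `A` over the tangent bundle 1-morphism, compatible
with the projection. -/
structure LawfulEndo (X : Tangentad K) (A : X.obj ⟶ X.obj) where
  law : A ≫ X.T ≅ X.T ≫ A
  law_p : law.hom ≫ X.p ▷ A ≫ (λ_ A).hom = A ◁ X.p ≫ (ρ_ A).hom

namespace LawfulEndo
variable {X : Tangentad K}

/-- The identity with its canonical law. -/
def id (X : Tangentad K) : LawfulEndo X (𝟙 X.obj) where
  law := unitIso X.T
  law_p := by simp [unitIso, unitors_equal]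

/-- The tangent bundle 1-morphism with the canonical flip. -/
def tan (X : Tangentad K) : LawfulEndo X X.T where
  law := ⟨X.c, X.c, X.c_c, X.c_c⟩
  law_p := by
    have := X.c_p
    rw [← this, ← Category.assoc]
    simp [X.c_c]

/-- Composition of lawful endo-1-morphisms. -/
def comp {A A' : X.obj ⟶ X.obj} (L : LawfulEndo X A) (L' : LawfulEndo X A') :
    LawfulEndo X (A ≫ A') where
  law := pasteIso L.law L'.law
  law_p := by
    have h := congrArg (fun t => t ▷ A') L.law_p
    have h' := congrArg (fun t => A ◁ t) L'.law_p
    simp only [comp_whiskerRight, whiskerLeft_comp] at h h'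
    simp only [pasteIso_hom]
    calc _ = 𝟙 _ ⊗≫ A ◁ L'.law.hom ⊗≫ (L.law.hom ▷ A' ≫ X.p ▷ A ▷ A' ≫ (λ_ A).hom ▷ A') := by
          bicategory
      _ = 𝟙 _ ⊗≫ (A ◁ L'.law.hom ≫ A ◁ X.p ▷ A' ≫ A ◁ (λ_ A').hom) := by rw [h]; bicategory
      _ = _ := by rw [h']; bicategory

/-- The iterates of the tangent bundle 1-morphism. -/
def iter (X : Tangentad K) : ∀ m : ℕ, LawfulEndo X (TangentadTheory.iter X.T m)
  | 0 => id X
  | m + 1 => (iter X m).comp (tan X)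

end LawfulEndo

/-- An object that carries a family `v` of sections of the tangent bundle projection on a
1-morphism `W`, has the 2-dimensional universal property of classifying such families, and to
which lawful endo-1-morphisms lift. -/
structure FieldObj (X : Tangentad K) (I : Type) where
  P : K
  W : P ⟶ X.obj
  v : I → (W ⟶ W ≫ X.T)
  injective : ∀ {Y : K} {Z Z' : Y ⟶ P} {τ τ' : Z ⟶ Z'}, τ ▷ W = τ' ▷ W → τ = τ'
  exists_whisker : ∀ {Y : K} (Z Z' : Y ⟶ P) (φ : Z ≫ W ⟶ Z' ≫ W),
    (∀ i, Z ◁ v i ≫ (α_ _ _ _).inv ≫ φ ▷ X.T = φ ≫ Z' ◁ v i ≫ (α_ _ _ _).inv) →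
      ∃ τ : Z ⟶ Z', τ ▷ W = φ

variable {X : Tangentad K} {I : Type}

/-- A lift of a lawful endo-1-morphism, compatible with the sections. -/
structure LiftEndo (O : FieldObj X I) {A : X.obj ⟶ X.obj} (L : LawfulEndo X A)
    (u : O.P ⟶ O.P) where
  θ : u ≫ O.W ≅ O.W ≫ A
  compat : ∀ i, u ◁ O.v i ≫ (α_ _ _ _).inv ≫ θ.hom ▷ X.T ≫ (α_ _ _ _).hom ≫ O.W ◁ L.law.hom =
    θ.hom ≫ O.v i ▷ A ≫ (α_ _ _ _).hom

namespace LiftEndo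
variable {O : FieldObj X I}

/-- The identity lifts the identity. -/
def id (O : FieldObj X I) : LiftEndo O (LawfulEndo.id X) (𝟙 O.P) where
  θ := unitIso O.W
  compat i := by
    simp only [LawfulEndo.id, unitIso_hom]
    bicategory

/-- Composition of lifts. -/
def comp {A A' : X.obj ⟶ X.obj} {L : LawfulEndo X A} {L' : LawfulEndo X A'} {u u' : O.P ⟶ O.P}
    (S : LiftEndo O L u) (S' : LiftEndo O L' u') : LiftEndo O (L.comp L') (u ≫ u') where
  θ := pasteIso S.θ S'.θ
  compat i := by
    have h := congrArg (fun t => t ▷ A') (S.compat i)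
    have h' := congrArg (fun t => u ◁ t) (S'.compat i)
    simp only [comp_whiskerRight, whiskerLeft_comp] at h h'
    simp only [LawfulEndo.comp, pasteIso_hom]
    calc _ = 𝟙 _ ⊗≫ u ◁ u' ◁ O.v i ⊗≫ u ◁ S'.θ.hom ▷ X.T ⊗≫
            (S.θ.hom ▷ (A' ≫ X.T) ≫ (O.W ≫ A) ◁ L'.law.hom) ⊗≫ O.W ◁ L.law.hom ▷ A' ⊗≫ 𝟙 _ := by
          bicategory
      _ = 𝟙 _ ⊗≫ (u ◁ u' ◁ O.v i ≫ u ◁ (α_ _ _ _).inv ≫ u ◁ S'.θ.hom ▷ X.T ≫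
            u ◁ (α_ _ _ _).hom ≫ u ◁ O.W ◁ L'.law.hom) ⊗≫ S.θ.hom ▷ X.T ▷ A' ⊗≫
            O.W ◁ L.law.hom ▷ A' ⊗≫ 𝟙 _ := by
          rw [← whisker_exchange]; bicategory
      _ = 𝟙 _ ⊗≫ u ◁ S'.θ.hom ⊗≫ ((u ◁ O.v i) ▷ A' ≫ (α_ _ _ _).inv ▷ A' ≫ S.θ.hom ▷ X.T ▷ A' ≫
            (α_ _ _ _).hom ▷ A' ≫ (O.W ◁ L.law.hom) ▷ A') ⊗≫ 𝟙 _ := by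
          rw [h']; bicategory
      _ = _ := by rw [h]; bicategory

/-- The iterates of a lift of the tangent bundle 1-morphism. -/
def iter {t : O.P ⟶ O.P} (S : LiftEndo O (LawfulEndo.tan X) t) :
    ∀ m : ℕ, LiftEndo O (LawfulEndo.iter X m) (TangentadTheory.iter t m)
  | 0 => id O
  | m + 1 => (iter S m).comp S

/-- The conjugate of `φ` by the two squares is a morphism of sections: `φ` slides past `v i` by
interchange, and past the laws because it respects them. It is then whiskered from a 2-morphism of
lifts. -/
theorem exists_over {A A' : X.obj ⟶ X.obj} {L : LawfulEndo X A} {L' : LawfulEndo X A'}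
    {u u' : O.P ⟶ O.P} (S : LiftEndo O L u) (S' : LiftEndo O L' u') {φ : A ⟶ A'}
    (hφ : Over L.law L'.law φ φ) : ∃ τ : u ⟶ u', Over S.θ S'.θ τ φ := by
  obtain ⟨τ, hτ⟩ := O.exists_whisker u u' (S.θ.hom ≫ O.W ◁ φ ≫ S'.θ.inv) (by
    intro i
    have h := S.compat i
    have h' := S'.compat i
    have hφ := congrArg (fun t => O.W ◁ t) hφ
    simp only [whiskerLeft_comp] at hφ
    -- Both sides are compared in `O.W ≫ T ≫ A'`, where the compatibility of the lift `S'` can be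
    -- read off.
    rw [← cancel_mono ((α_ _ _ _).hom : (u' ≫ O.W) ≫ X.T ⟶ _),
      ← cancel_mono ((α_ _ _ _).inv ≫ S'.θ.hom ▷ X.T ≫ (α_ _ _ _).hom ≫ O.W ◁ L'.law.hom)]
    calc _ = u ◁ O.v i ≫ (α_ _ _ _).inv ≫ S.θ.hom ▷ X.T ⊗≫
            (O.W ◁ φ ▷ X.T ≫ O.W ◁ L'.law.hom) := by
          simp only [comp_whiskerRight, Category.assoc, Iso.hom_inv_id_assoc,
            inv_hom_whiskerRight_assoc]
          bicategory
      _ = (u ◁ O.v i ≫ (α_ _ _ _).inv ≫ S.θ.hom ▷ X.T ≫ (α_ _ _ _).hom ≫ O.W ◁ L.law.hom) ≫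
            O.W ◁ X.T ◁ φ := by
          rw [hφ]; bicategory
      _ = S.θ.hom ≫ (O.v i ▷ A ≫ (O.W ≫ X.T) ◁ φ) ≫ (α_ _ _ _).hom := by rw [h]; bicategory
      _ = S.θ.hom ≫ O.W ◁ φ ≫ S'.θ.inv ≫ (S'.θ.hom ≫ O.v i ▷ A' ≫ (α_ _ _ _).hom) := by
          rw [← whisker_exchange]; simp
      _ = _ := by rw [← h']; simp)
  exact ⟨τ, by rw [Over, hτ]; simp⟩

end LiftEndo

end

/-! ### Fibre powers and pullbacks in a category -/

section
variable {C : Type*} [Category C]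

theorem IsFibrePower.of_isPullback {E B P : C} {q : E ⟶ B} {π : Fin 2 → (P ⟶ E)}
    (h : IsPullback (π 0) (π 1) q q) : IsFibrePower q π := by
  refine ⟨fun i j => ?_, fun Z f hf => ⟨h.lift (f 0) (f 1) (hf _ _), fun i => ?_, fun k hk => ?_⟩⟩
  · fin_cases i <;> fin_cases j <;> simp [h.w]
  · fin_cases i <;> simp
  · apply h.hom_ext <;> simp [hk]

theorem isPullback_of_existsUnique {E E' B P : C} {f : P ⟶ E} {g : P ⟶ E'} {q : E ⟶ B}
    {q' : E' ⟶ B} (w : f ≫ q = g ≫ q')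
    (h : ∀ (Z : C) (a : Z ⟶ E) (b : Z ⟶ E'), a ≫ q = b ≫ q' →
      ∃ k : Z ⟶ P, k ≫ f = a ∧ k ≫ g = b)
    (h' : ∀ (Z : C) (k k' : Z ⟶ P), k ≫ f = k' ≫ f → k ≫ g = k' ≫ g → k = k') :
    IsPullback f g q q' :=
  ⟨⟨w⟩, ⟨Limits.PullbackCone.IsLimit.mk w
    (fun s => (h s.pt s.fst s.snd s.condition).choose)
    (fun s => (h s.pt s.fst s.snd s.condition).choose_spec.1)
    (fun s => (h s.pt s.fst s.snd s.condition).choose_spec.2)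
    (fun s _ h₁ h₂ => h' _ _ _
      (h₁.trans (h s.pt s.fst s.snd s.condition).choose_spec.1.symm)
      (h₂.trans (h s.pt s.fst s.snd s.condition).choose_spec.2.symm))⟩⟩

theorem IsFibrePower.isPullback {E B P : C} {q : E ⟶ B} {π : Fin 2 → (P ⟶ E)}
    (h : IsFibrePower q π) : IsPullback (π 0) (π 1) q q := by
  refine isPullback_of_existsUnique (h.1 0 1) (fun Z a b hab => ?_) (fun Z k k' h₁ h₂ => ?_)
  · obtain ⟨k, hk, -⟩ := h.2 Z ![a, b] (by
      intro i j
      fin_cases i <;> fin_cases j <;> simp [hab])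
    exact ⟨k, hk 0, hk 1⟩
  · obtain ⟨l, -, hl⟩ := h.2 Z (fun i => k ≫ π i) (fun i j => by
      simp only [Category.assoc, h.1 i j])
    rw [hl k (fun _ => rfl), hl k' (fun i => by fin_cases i; exacts [h₁.symm, h₂.symm])]

theorem IsFibrePower.hom_ext {n : ℕ} {E B P : C} {q : E ⟶ B} {π : Fin n → (P ⟶ E)}
    (h : IsFibrePower q π) {Z : C} {k k' : Z ⟶ P} (hk : ∀ i, k ≫ π i = k' ≫ π i) : k = k' := by
  obtain ⟨l, -, hl⟩ := h.2 Z (fun i => k ≫ π i) (fun i j => by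
    simp only [Category.assoc, h.1 i j])
  rw [hl k (fun _ => rfl), hl k' (fun i => (hk i).symm)]

theorem IsFibrePower.exists_iso {n : ℕ} {E B P E' B' P' : C} {q : E ⟶ B} {π : Fin n → (P ⟶ E)}
    {q' : E' ⟶ B'} {π' : Fin n → (P' ⟶ E')} (h : IsFibrePower q π) (h' : IsFibrePower q' π')
    (eE : E ≅ E') (eB : B ≅ B') (hq : q ≫ eB.hom = eE.hom ≫ q') :
    ∃ e : P ≅ P', ∀ i, π i ≫ eE.hom = e.hom ≫ π' i := by
  have hq' : q' = eE.inv ≫ q ≫ eB.hom := by rw [hq]; simp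
  have hq'' : eE.inv ≫ q = q' ≫ eB.inv := by rw [hq']; simp
  obtain ⟨f, hf, -⟩ := h'.2 P (fun i => π i ≫ eE.hom) (fun i j => by
    simp [hq', reassoc_of% (h.1 i j)])
  obtain ⟨g, hg, -⟩ := h.2 P' (fun i => π' i ≫ eE.inv) (fun i j => by
    simp [hq'', reassoc_of% (h'.1 i j)])
  exact ⟨⟨f, g, h.hom_ext fun i => by simp [hg, reassoc_of% hf],
    h'.hom_ext fun i => by simp [hf, reassoc_of% hg]⟩, fun i => (hf i).symm⟩

end

/-! ### Laws on fibre powers, joint monicity and lifting of limits -/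

section
variable {K : Type u} [Bicategory.{w, v} K] {X : Tangentad K}

/-- The 2-morphisms `d j` are jointly monic, pointwise. -/
def JointlyMono {x y : K} {J : Type} {A : x ⟶ y} {E : J → (x ⟶ y)} (d : ∀ j, A ⟶ E j) : Prop :=
  ∀ {Y : K} (F : Y ⟶ x) {Z : Y ⟶ y} (a b : Z ⟶ F ≫ A),
    (∀ j, a ≫ F ◁ d j = b ≫ F ◁ d j) → a = b

theorem JointlyMono.whiskerLeft {x y z : K} {J : Type} {A : x ⟶ y} {E : J → (x ⟶ y)}
    {d : ∀ j, A ⟶ E j} (h : JointlyMono d) (G : z ⟶ x) : JointlyMono (fun j => G ◁ d j) := by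
  intro Y F Z a b hab
  rw [← cancel_mono (α_ F G A).inv]
  refine h (F ≫ G) _ _ (fun j => ?_)
  have := hab j
  simp only [comp_whiskerLeft, Category.assoc, Iso.inv_hom_id_assoc]
  rw [reassoc_of% this]

theorem JointlyMono.hom_ext {x y : K} {J : Type} {A : x ⟶ y} {E : J → (x ⟶ y)} {d : ∀ j, A ⟶ E j}
    (h : JointlyMono d) {Z : x ⟶ y} {a b : Z ⟶ A} (hab : ∀ j, a ≫ d j = b ≫ d j) : a = b := by
  rw [← cancel_mono (λ_ A).inv]
  refine h (𝟙 x) _ _ (fun j => ?_)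
  simp only [Category.assoc, leftUnitor_inv_naturality]
  simp [reassoc_of% (hab j)]

theorem Tangentad.isFibrePower (X : Tangentad K) (m : ℕ) {Y : K} (F : Y ⟶ X.obj) :
    IsFibrePower (F ◁ (X.p ▷ iter X.T m)) (fun i : Fin 2 => F ◁ (![X.π₁, X.π₂] i ▷ iter X.T m)) :=
  IsFibrePower.of_isPullback (X.isPullback m F)

theorem isFibrePower_one {n : ℕ} {Tn : X.obj ⟶ X.obj} {π : Fin n → (Tn ⟶ X.T)}
    (h : ∀ (m : ℕ) {Y : K} (F : Y ⟶ X.obj),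
      IsFibrePower (F ◁ (X.p ▷ iter X.T m)) (fun i => F ◁ (π i ▷ iter X.T m)))
    {Y : K} (F : Y ⟶ X.obj) : IsFibrePower (F ◁ X.p ▷ X.T) (fun i => F ◁ π i ▷ X.T) := by
  refine (h 1 F).of_iso (whiskerLeftIso F (whiskerLeftIso _ (λ_ X.T)))
    (whiskerLeftIso F (whiskerLeftIso _ (λ_ X.T))) (whiskerLeftIso F (whiskerLeftIso _ (λ_ X.T)))
    ?_ (fun i => ?_) <;>
  · simp only [whiskerLeftIso_hom, iter, ← whiskerLeft_comp]
    rw [whisker_exchange]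

theorem isFibrePower_zero {n : ℕ} {Tn : X.obj ⟶ X.obj} {π : Fin n → (Tn ⟶ X.T)}
    (h : ∀ (m : ℕ) {Y : K} (F : Y ⟶ X.obj),
      IsFibrePower (F ◁ (X.p ▷ iter X.T m)) (fun i => F ◁ (π i ▷ iter X.T m)))
    {Y : K} (F : Y ⟶ X.obj) : IsFibrePower (F ◁ X.p) (fun i => F ◁ π i) :=
  (h 0 F).of_iso (whiskerLeftIso F (ρ_ _)) (whiskerLeftIso F (ρ_ _))
    (whiskerLeftIso F (ρ_ _)) (by simp [iter]) (by simp [iter])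

theorem IsFibrePower.of_id_whiskerLeft {x y : K} {n : ℕ} {A E B : x ⟶ y} {q : E ⟶ B}
    {π : Fin n → (A ⟶ E)} (h : IsFibrePower (𝟙 x ◁ q) (fun i => 𝟙 x ◁ π i)) :
    IsFibrePower q π :=
  h.of_iso (λ_ _) (λ_ _) (λ_ _) (by simp) (by simp)

/-- `Tn ≫ T` is a fibre power of `p ▷ T`, as `T` preserves it, and `T ≫ Tn` is one of `T ◁ p`, as it
is pointwise. The flip identifies these two projections, so it induces an isomorphism of their fibre
powers. -/
theorem exists_lawfulEndo {n : ℕ} {Tn : X.obj ⟶ X.obj} {π : Fin n → (Tn ⟶ X.T)}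
    (h : ∀ (m : ℕ) {Y : K} (F : Y ⟶ X.obj),
      IsFibrePower (F ◁ (X.p ▷ iter X.T m)) (fun i => F ◁ (π i ▷ iter X.T m))) :
    ∃ L : LawfulEndo X Tn, ∀ i, Over L.law (LawfulEndo.tan X).law (π i) (π i) := by
  have h₁ := IsFibrePower.of_id_whiskerLeft (isFibrePower_one h (𝟙 X.obj))
  have h₂ := isFibrePower_zero h X.T
  have hc : X.p ▷ X.T ≫ (λ_ X.T).hom = X.c ≫ X.T ◁ X.p ≫ (ρ_ X.T).hom := X.c_p.symm
  obtain ⟨e, he⟩ := h₁.exists_iso h₂ ⟨X.c, X.c, X.c_c, X.c_c⟩ (λ_ _ ≪≫ (ρ_ _).symm) (by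
    simp only [Iso.trans_hom, Iso.symm_hom, reassoc_of% hc, Iso.hom_inv_id, Category.comp_id])
  refine ⟨⟨e, ?_⟩, he⟩
  have h₀ := IsFibrePower.of_id_whiskerLeft (isFibrePower_zero h (𝟙 X.obj))
  refine h₀.hom_ext (fun i => ?_)
  have h₃ : X.c ≫ X.p ▷ X.T ≫ (λ_ X.T).hom = X.T ◁ X.p ≫ (ρ_ X.T).hom :=
    (LawfulEndo.tan X).law_p
  have h₄ : π i ▷ X.T ≫ X.c = e.hom ≫ X.T ◁ π i := he i
  simp only [Category.assoc]
  rw [← leftUnitor_naturality, ← whisker_exchange_assoc, ← reassoc_of% h₄, h₃,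
    ← rightUnitor_naturality, whisker_exchange_assoc]

/-- The family `d` stays jointly monic after whiskering with `X.T`, so compatibility with the laws
may be tested on its legs. -/
theorem Over.of_jointlyMono {J : Type} {A D : X.obj ⟶ X.obj} {E : J → (X.obj ⟶ X.obj)}
    {L : LawfulEndo X A} {LD : LawfulEndo X D} {LE : ∀ j, LawfulEndo X (E j)} {d : ∀ j, D ⟶ E j}
    (hd : ∀ j, Over LD.law (LE j).law (d j) (d j)) (hm : JointlyMono d) {φ : A ⟶ D}
    (hφ : ∀ j, Over L.law (LE j).law (φ ≫ d j) (φ ≫ d j)) : Over L.law LD.law φ φ := by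
  refine hm X.T _ _ (fun j => ?_)
  have h₁ : d j ▷ X.T ≫ (LE j).law.hom = LD.law.hom ≫ X.T ◁ d j := hd j
  have h₂ : (φ ≫ d j) ▷ X.T ≫ (LE j).law.hom = L.law.hom ≫ X.T ◁ (φ ≫ d j) := hφ j
  rw [comp_whiskerRight, Category.assoc, h₁, whiskerLeft_comp] at h₂
  simpa using h₂

namespace LiftEndo
variable {I : Type} {O : FieldObj X I}

section
variable {A A' : X.obj ⟶ X.obj} {L : LawfulEndo X A} {L' : LawfulEndo X A'} {u u' : O.P ⟶ O.P}
  (S : LiftEndo O L u) (S' : LiftEndo O L' u')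

/-- The 2-morphism that underlies a 2-morphism into `u_F`. -/
def push {Y : K} {F Z : Y ⟶ O.P} (f : Z ⟶ F ≫ u) : Z ≫ O.W ⟶ (F ≫ O.W) ≫ A :=
  f ▷ O.W ≫ (α_ _ _ _).hom ≫ F ◁ S.θ.hom ≫ (α_ _ _ _).inv

theorem push_comp {φ : A ⟶ A'} {τ : u ⟶ u'} (h : Over S.θ S'.θ τ φ) {Y : K} {F Z : Y ⟶ O.P}
    (f : Z ⟶ F ≫ u) : S'.push (f ≫ F ◁ τ) = S.push f ≫ (F ≫ O.W) ◁ φ := by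
  have h := congrArg (fun t => F ◁ t) h
  simp only [whiskerLeft_comp] at h
  simp [push, reassoc_of% h]

/-- The 2-morphism that underlies a 2-morphism into `u`. -/
def pushEndo {Z : O.P ⟶ O.P} (f : Z ⟶ u) : Z ≫ O.W ⟶ O.W ≫ A := f ▷ O.W ≫ S.θ.hom

theorem pushEndo_comp {φ : A ⟶ A'} {τ : u ⟶ u'} (h : Over S.θ S'.θ τ φ) {Z : O.P ⟶ O.P}
    (f : Z ⟶ u) : S'.pushEndo (f ≫ τ) = S.pushEndo f ≫ O.W ◁ φ := by
  have h : τ ▷ O.W ≫ S'.θ.hom = S.θ.hom ≫ O.W ◁ φ := h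
  simp [pushEndo, h]

theorem pushEndo_injective {Z : O.P ⟶ O.P} {f f' : Z ⟶ u} (h : S.pushEndo f = S.pushEndo f') :
    f = f' :=
  O.injective ((cancel_mono S.θ.hom).1 h)

end

variable {J : Type} {D : X.obj ⟶ X.obj} {E : J → (X.obj ⟶ X.obj)}
  {LD : LawfulEndo X D} {LE : ∀ j, LawfulEndo X (E j)} {d : ∀ j, D ⟶ E j}
  {uD : O.P ⟶ O.P} {uE : J → (O.P ⟶ O.P)} {SD : LiftEndo O LD uD}
  {SE : ∀ j, LiftEndo O (LE j) (uE j)} {τ : ∀ j, uD ⟶ uE j}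

theorem jointlyMono_whiskerRight (hm : JointlyMono d) (hτ : ∀ j, Over SD.θ (SE j).θ (τ j) (d j)) :
    JointlyMono (fun j => τ j ▷ O.W) := by
  intro Y F Z a b hab
  rw [← cancel_mono (F ◁ SD.θ.hom)]
  refine JointlyMono.whiskerLeft hm O.W F _ _ (fun j => ?_)
  have h : τ j ▷ O.W ≫ (SE j).θ.hom = SD.θ.hom ≫ O.W ◁ d j := hτ j
  rw [Category.assoc, Category.assoc, ← whiskerLeft_comp, ← h, whiskerLeft_comp,
    reassoc_of% hab j]

/-- Faithfulness of `O.W` and invertibility of the squares reduce uniqueness of factorizations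
upstairs to uniqueness in the base. -/
theorem jointlyMono (hm : JointlyMono d) (hτ : ∀ j, Over SD.θ (SE j).θ (τ j) (d j)) :
    JointlyMono τ := by
  intro Y F Z a b hab
  apply O.injective
  rw [← cancel_mono (α_ _ _ _).hom]
  refine jointlyMono_whiskerRight hm hτ F _ _ (fun j => ?_)
  have := congrArg (fun t => t ▷ O.W ≫ (α_ _ _ _).hom) (hab j)
  simpa using this

/-- The laws exchange `d j ▷ T` for `T ◁ d j`, and joint monicity is stable under whiskering on the
left. No preservation by `T` has to be assumed of the family. -/
theorem jointlyMono_whiskerRight₂ (hd : ∀ j, Over LD.law (LE j).law (d j) (d j))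
    (hm : JointlyMono d) (hτ : ∀ j, Over SD.θ (SE j).θ (τ j) (d j)) :
    JointlyMono (fun j => τ j ▷ O.W ▷ X.T) := by
  intro Y F Z a b hab
  rw [← cancel_mono (F ◁ SD.θ.hom ▷ X.T), ← cancel_mono (F ◁ (α_ _ _ _).hom),
    ← cancel_mono (F ◁ O.W ◁ LD.law.hom)]
  refine (JointlyMono.whiskerLeft (JointlyMono.whiskerLeft hm X.T) O.W) F _ _ (fun j => ?_)
  have h : τ j ▷ O.W ≫ (SE j).θ.hom = SD.θ.hom ≫ O.W ◁ d j := hτ j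
  have h' : d j ▷ X.T ≫ (LE j).law.hom = LD.law.hom ≫ X.T ◁ d j := hd j
  have key : SD.θ.hom ▷ X.T ≫ (α_ _ _ _).hom ≫ O.W ◁ (LD.law.hom ≫ X.T ◁ d j) =
      τ j ▷ O.W ▷ X.T ≫ (SE j).θ.hom ▷ X.T ≫ (α_ _ _ _).hom ≫ O.W ◁ (LE j).law.hom := by
    rw [← h', whiskerLeft_comp, ← associator_naturality_middle_assoc,
      ← comp_whiskerRight_assoc, ← h, comp_whiskerRight_assoc]
  simp only [Category.assoc, ← whiskerLeft_comp]
  rw [key, whiskerLeft_comp, reassoc_of% hab j]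

/-- This is how limits lift. A factorization `h` in the base comes from a 2-morphism upstairs once
it respects the sections. That is checked against the jointly monic family, where `h` becomes the `f
j`, which respect the sections by interchange. -/
theorem exists_factor (hd : ∀ j, Over LD.law (LE j).law (d j) (d j))
    (hm : JointlyMono d) (hτ : ∀ j, Over SD.θ (SE j).θ (τ j) (d j)) {Y : K} (F Z : Y ⟶ O.P)
    (f : ∀ j, Z ⟶ F ≫ uE j) (h : Z ≫ O.W ⟶ (F ≫ O.W) ≫ D)
    (hf : ∀ j, h ≫ (F ≫ O.W) ◁ d j = (SE j).push (f j)) :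
    ∃ k : Z ⟶ F ≫ uD, ∀ j, k ≫ F ◁ τ j = f j := by
  let φ : Z ≫ O.W ⟶ (F ≫ uD) ≫ O.W := h ≫ (α_ _ _ _).hom ≫ F ◁ SD.θ.inv ≫ (α_ _ _ _).inv
  have hφ : ∀ j, φ ≫ (F ◁ τ j) ▷ O.W = f j ▷ O.W := by
    intro j
    have h₁ : τ j ▷ O.W ≫ (SE j).θ.hom = SD.θ.hom ≫ O.W ◁ d j := hτ j
    have h₂ : SD.θ.inv ≫ τ j ▷ O.W = O.W ◁ d j ≫ (SE j).θ.inv := by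
      rw [Iso.inv_comp_eq, ← Category.assoc, Iso.eq_comp_inv, h₁]
    have h₃ := congrArg (fun t => F ◁ t) h₂
    simp only [whiskerLeft_comp] at h₃
    calc _ = h ≫ (α_ _ _ _).hom ≫ (F ◁ SD.θ.inv ≫ F ◁ τ j ▷ O.W) ≫ (α_ _ _ _).inv := by
          simp [φ]
      _ = (h ≫ (F ≫ O.W) ◁ d j) ≫ (α_ _ _ _).hom ≫ F ◁ (SE j).θ.inv ≫ (α_ _ _ _).inv := by
          rw [h₃]; simp
      _ = _ := by rw [hf]; simp [push]
  obtain ⟨k, hk⟩ := O.exists_whisker Z (F ≫ uD) φ (by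
    intro i
    rw [← cancel_mono ((α_ _ _ _).hom ▷ X.T), ← cancel_mono (α_ _ _ _).hom]
    -- The condition takes values in a composite ending with `X.T`, so joint monicity is needed
    -- after `T`.
    refine jointlyMono_whiskerRight₂ hd hm hτ F _ _ (fun j => ?_)
    have e₁ : (α_ F uD O.W).hom ▷ X.T ≫ (α_ _ _ _).hom ≫ F ◁ τ j ▷ O.W ▷ X.T =
        (F ◁ τ j) ▷ O.W ▷ X.T ≫ (α_ F (uE j) O.W).hom ▷ X.T ≫ (α_ _ _ _).hom := by bicategory
    simp only [Category.assoc]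
    rw [e₁]
    have e₂ : φ ▷ X.T ≫ (F ◁ τ j) ▷ O.W ▷ X.T = f j ▷ O.W ▷ X.T := by
      rw [← comp_whiskerRight, hφ]
    have e₃ : (F ≫ uD) ◁ O.v i ≫ (α_ _ _ _).inv ≫ (F ◁ τ j) ▷ O.W ▷ X.T =
        (F ◁ τ j) ▷ O.W ≫ (F ≫ uE j) ◁ O.v i ≫ (α_ _ _ _).inv := by
      rw [← whisker_exchange_assoc]; simp
    have e₄ : Z ◁ O.v i ≫ (α_ _ _ _).inv ≫ f j ▷ O.W ▷ X.T =
        f j ▷ O.W ≫ (F ≫ uE j) ◁ O.v i ≫ (α_ _ _ _).inv := by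
      rw [← whisker_exchange_assoc]; simp
    rw [reassoc_of% e₂, reassoc_of% e₃, reassoc_of% hφ j, reassoc_of% e₄])
  refine ⟨k, fun j => O.injective ?_⟩
  rw [comp_whiskerRight, hk, hφ]

end LiftEndo

end

/-! ### The tangent structure on a classifying object -/

section
variable {K : Type u} [Bicategory.{w, v} K] {X : Tangentad K}

namespace LawfulEndo

/-- The axioms relating `c` to `p`, `z`, `l` and to itself say precisely that these 2-morphisms
respect the laws given by `c`. This and the three results below make them liftable. -/
theorem over_p (X : Tangentad K) : Over (tan X).law (id X).law X.p X.p := by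
  have := (tan X).law_p
  simp only [Over, id, unitIso_hom]
  change X.p ▷ X.T ≫ (λ_ X.T).hom ≫ (ρ_ X.T).inv = X.c ≫ X.T ◁ X.p
  rw [← cancel_mono (ρ_ X.T).hom]
  simpa using X.c_p.symm

theorem over_z (X : Tangentad K) : Over (id X).law (tan X).law X.z X.z := by
  simp only [Over, id, unitIso_hom]
  exact X.z_c.trans (Category.assoc _ _ _).symm

theorem over_l (X : Tangentad K) :
    Over (tan X).law ((tan X).comp (tan X)).law X.l X.l := by
  simp only [Over, comp, pasteIso_hom]
  exact LaxMor.l_law (TangentadTheory.tan X)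

theorem over_c (X : Tangentad K) :
    Over ((tan X).comp (tan X)).law ((tan X).comp (tan X)).law X.c X.c := by
  simp only [Over, comp, pasteIso_hom, Category.assoc]
  exact X.c_braid

end LawfulEndo

/-- The two projections of `T₂`. -/
def Tangentad.π (X : Tangentad K) : Fin 2 → (X.T₂ ⟶ X.T) := ![X.π₁, X.π₂]

theorem Tangentad.jointlyMono_π (X : Tangentad K) : JointlyMono X.π := fun _ _ _ _ h =>
  X.lift_ext (h 0) (h 1)

theorem Tangentad.jointlyMono_π_T (X : Tangentad K) :
    JointlyMono (fun i => X.π i ▷ X.T) := fun F _ _ _ h =>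
  (isFibrePower_one X.isFibrePower F).hom_ext h

variable {I : Type}

/-- Lifts of the tangent bundle 1-morphism, of its fibre powers and of the structural
2-morphisms. -/
structure TangentLift {O : FieldObj X I} {T : O.P ⟶ O.P}
    (S : LiftEndo O (LawfulEndo.tan X) T) where
  exists_lift : ∀ {A : X.obj ⟶ X.obj} (L : LawfulEndo X A), ∃ u, Nonempty (LiftEndo O L u)
  law₂ : LawfulEndo X X.T₂
  over_π : ∀ i, Over law₂.law (LawfulEndo.tan X).law (X.π i) (X.π i)
  T₂ : O.P ⟶ O.P
  liftT₂ : LiftEndo O law₂ T₂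
  π : Fin 2 → (T₂ ⟶ T)
  lift_π : ∀ i, Over liftT₂.θ S.θ (π i) (X.π i)
  p : T ⟶ 𝟙 O.P
  lift_p : Over S.θ (LiftEndo.id O).θ p X.p
  z : 𝟙 O.P ⟶ T
  lift_z : Over (LiftEndo.id O).θ S.θ z X.z
  s : T₂ ⟶ T
  lift_s : Over liftT₂.θ S.θ s X.s
  l : T ⟶ T ≫ T
  lift_l : Over S.θ (S.comp S).θ l X.l
  c : T ≫ T ⟶ T ≫ T
  lift_c : Over (S.comp S).θ (S.comp S).θ c X.c

/-- The law on `T₂` is determined by its two components, so it must be the 2-morphism `c₂` of the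
axiom `s_c`, for which additivity of the flip is known. -/
theorem LawfulEndo.over_s {L : LawfulEndo X X.T₂}
    (h : ∀ i, Over L.law (tan X).law (X.π i) (X.π i)) : Over L.law (tan X).law X.s X.s := by
  obtain ⟨c₂, h₁, h₂, h₃⟩ := X.s_c
  have hc : c₂ = L.law.hom := by
    refine JointlyMono.hom_ext (JointlyMono.whiskerLeft X.jointlyMono_π X.T) (fun i => ?_)
    have := h i
    rw [Over] at this
    rw [← this]
    fin_cases i
    exacts [h₁, h₂]
  rw [Over, ← hc]
  exact h₃

theorem TangentLift.nonempty (O : FieldObj X I)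
    (h : ∀ {A : X.obj ⟶ X.obj} (L : LawfulEndo X A), ∃ u, Nonempty (LiftEndo O L u))
    {T : O.P ⟶ O.P} (S : LiftEndo O (LawfulEndo.tan X) T) : Nonempty (TangentLift S) := by
  obtain ⟨L₂, hL⟩ := exists_lawfulEndo X.isFibrePower
  obtain ⟨T₂, ⟨S₂⟩⟩ := h L₂
  choose π hπ using fun i => S₂.exists_over S (hL i)
  obtain ⟨p, hp⟩ := S.exists_over (.id O) (LawfulEndo.over_p X)
  obtain ⟨z, hz⟩ := LiftEndo.exists_over (.id O) S (LawfulEndo.over_z X)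
  obtain ⟨s, hs⟩ := S₂.exists_over S (LawfulEndo.over_s hL)
  obtain ⟨l, hl⟩ := S.exists_over (S.comp S) (LawfulEndo.over_l X)
  obtain ⟨c, hc⟩ := LiftEndo.exists_over (S.comp S) (S.comp S) (LawfulEndo.over_c X)
  exact ⟨⟨h, L₂, hL, T₂, S₂, π, hπ, p, hp, z, hz, s, hs, l, hl, c, hc⟩⟩

namespace TangentLift
variable {O : FieldObj X I} {T : O.P ⟶ O.P} {S : LiftEndo O (LawfulEndo.tan X) T}
  (D : TangentLift S)

/-- Whiskering with the iterates keeps all 2-morphisms over those of `X`, so the fibre power of `X`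
at `m` provides both joint monicity and the factorization to be lifted. -/
theorem isFibrePower {n : ℕ} {Tn : X.obj ⟶ X.obj} {π : Fin n → (Tn ⟶ X.T)}
    (h : ∀ (m : ℕ) {Y : K} (F : Y ⟶ X.obj),
      IsFibrePower (F ◁ (X.p ▷ iter X.T m)) (fun i => F ◁ (π i ▷ iter X.T m)))
    {Ln : LawfulEndo X Tn} (hL : ∀ i, Over Ln.law (LawfulEndo.tan X).law (π i) (π i))
    {u : O.P ⟶ O.P} {Sn : LiftEndo O Ln u} {π' : Fin n → (u ⟶ T)}
    (hπ : ∀ i, Over Sn.θ S.θ (π' i) (π i)) (m : ℕ) {Y : K} (F : Y ⟶ O.P) :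
    IsFibrePower (F ◁ (D.p ▷ iter T m)) (fun i => F ◁ (π' i ▷ iter T m)) := by
  let SD := Sn.comp (S.iter m)
  let SE := S.comp (S.iter m)
  let SB := (LiftEndo.id O).comp (S.iter m)
  have hm : JointlyMono (fun i => π i ▷ iter X.T m) := fun F _ _ _ h' => (h m F).hom_ext h'
  have hd : ∀ i, Over (Ln.comp (LawfulEndo.iter X m)).law
      ((LawfulEndo.tan X).comp (LawfulEndo.iter X m)).law (π i ▷ iter X.T m) (π i ▷ iter X.T m) :=
    fun i => (hL i).whiskerRight _
  have hτ : ∀ i, Over SD.θ SE.θ (π' i ▷ iter T m) (π i ▷ iter X.T m) :=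
    fun i => (hπ i).whiskerRight _
  have hp : Over SE.θ SB.θ (D.p ▷ iter T m) (X.p ▷ iter X.T m) := D.lift_p.whiskerRight _
  have hm' : JointlyMono (fun i => π' i ▷ iter T m) :=
    LiftEndo.jointlyMono (SD := SD) (SE := fun _ => SE) hm hτ
  refine ⟨fun i j => ?_, fun Z f hf => ?_⟩
  · rw [← whiskerLeft_comp, ← whiskerLeft_comp]
    congr 1
    refine Over.eq O.injective ((hτ i).comp hp) ((hτ j).comp hp) ?_
    rw [← whiskerLeft_iff, whiskerLeft_comp, whiskerLeft_comp, (h m (𝟙 _)).1 i j]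
  · obtain ⟨k, hk, -⟩ := (h m (F ≫ O.W)).2 (Z ≫ O.W) (fun i => SE.push (f i)) (fun i j => by
      rw [← SE.push_comp SB hp, ← SE.push_comp SB hp, hf i j])
    obtain ⟨k', hk'⟩ := LiftEndo.exists_factor (SD := SD) (SE := fun _ => SE) hd hm hτ F Z f k hk
    exact ⟨k', hk', fun y hy => hm' F _ _ fun i => (hy i).trans (hk' i).symm⟩

theorem exists_power (n : ℕ) (hn : 0 < n) : ∃ (Tn : O.P ⟶ O.P) (π : Fin n → (Tn ⟶ T)),
    ∀ (m : ℕ) {Y : K} (F : Y ⟶ O.P),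
      IsFibrePower (F ◁ (D.p ▷ iter T m)) (fun i => F ◁ (π i ▷ iter T m)) := by
  obtain ⟨Tn, π, h⟩ := X.exists_power n hn
  obtain ⟨L, hL⟩ := exists_lawfulEndo h
  obtain ⟨u, ⟨Sn⟩⟩ := D.exists_lift L
  choose π' hπ' using fun i => Sn.exists_over S (hL i)
  exact ⟨u, π', D.isFibrePower h hL hπ'⟩

theorem isPullback (m : ℕ) {Y : K} (F : Y ⟶ O.P) :
    IsPullback (F ◁ (D.π 0 ▷ iter T m)) (F ◁ (D.π 1 ▷ iter T m))
      (F ◁ (D.p ▷ iter T m)) (F ◁ (D.p ▷ iter T m)) :=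
  (D.isFibrePower X.isFibrePower D.over_π D.lift_π m F).isPullback

theorem over_l₂ {L : LawfulEndo X X.T₂}
    (h : ∀ i, Over L.law (LawfulEndo.tan X).law (X.π i) (X.π i)) {φ : X.T₂ ⟶ X.T₂ ≫ X.T}
    (hφ : ∀ i, Over L.law ((LawfulEndo.tan X).comp (LawfulEndo.tan X)).law (φ ≫ X.π i ▷ X.T)
      (φ ≫ X.π i ▷ X.T)) :
    Over L.law (L.comp (LawfulEndo.tan X)).law φ φ :=
  Over.of_jointlyMono (LE := fun _ => (LawfulEndo.tan X).comp (LawfulEndo.tan X))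
    (fun i => (h i).whiskerRight _) X.jointlyMono_π_T hφ

/-- The 2-morphism that witnesses additivity of the lift in `X` respects the laws because its
components do. Hence it lifts, and its equations lift with it. -/
theorem exists_l₂ : ∃ l₂ : D.T₂ ⟶ D.T₂ ≫ T, l₂ ≫ D.π 0 ▷ T = D.π 0 ≫ D.l ∧
    l₂ ≫ D.π 1 ▷ T = D.π 1 ≫ D.l ∧ D.s ≫ D.l = l₂ ≫ D.s ▷ T := by
  obtain ⟨φ, h₁, h₂, h₃⟩ := X.s_l
  have h : ∀ i, φ ≫ X.π i ▷ X.T = X.π i ≫ X.l := by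
    intro i
    fin_cases i
    exacts [h₁, h₂]
  obtain ⟨τ, hτ⟩ := D.liftT₂.exists_over (D.liftT₂.comp S) (over_l₂ D.over_π (fun i => by
    rw [h i]
    exact (D.over_π i).comp (LawfulEndo.over_l X)))
  have key : ∀ i, τ ≫ D.π i ▷ T = D.π i ≫ D.l := fun i =>
    Over.eq O.injective (hτ.comp ((D.lift_π i).whiskerRight S.θ))
      ((D.lift_π i).comp D.lift_l) (h i)
  exact ⟨τ, key 0, key 1, Over.eq O.injective (D.lift_s.comp D.lift_l)
    (hτ.comp (D.lift_s.whiskerRight S.θ)) h₃⟩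

theorem exists_c₂ : ∃ c₂ : D.T₂ ≫ T ⟶ T ≫ D.T₂, c₂ ≫ T ◁ D.π 0 = D.π 0 ▷ T ≫ D.c ∧
    c₂ ≫ T ◁ D.π 1 = D.π 1 ▷ T ≫ D.c ∧ D.s ▷ T ≫ D.c = c₂ ≫ T ◁ D.s := by
  obtain ⟨φ, h₁, h₂, h₃⟩ := X.s_c
  have h : ∀ i, φ ≫ X.T ◁ X.π i = X.π i ▷ X.T ≫ X.c := by
    intro i
    fin_cases i
    exacts [h₁, h₂]
  have hφ : Over (D.law₂.comp (LawfulEndo.tan X)).law ((LawfulEndo.tan X).comp D.law₂).law φ φ :=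
    Over.of_jointlyMono (LE := fun _ => (LawfulEndo.tan X).comp (LawfulEndo.tan X))
      (fun i => (D.over_π i).whiskerLeft _) (JointlyMono.whiskerLeft X.jointlyMono_π X.T)
      (fun i => by
        rw [h i]
        exact ((D.over_π i).whiskerRight _).comp (LawfulEndo.over_c X))
  obtain ⟨τ, hτ⟩ := LiftEndo.exists_over (D.liftT₂.comp S) (S.comp D.liftT₂) hφ
  have key : ∀ i, τ ≫ T ◁ D.π i = D.π i ▷ T ≫ D.c := fun i =>
    Over.eq O.injective (hτ.comp ((D.lift_π i).whiskerLeft S.θ))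
      (((D.lift_π i).whiskerRight S.θ).comp D.lift_c) (h i)
  exact ⟨τ, key 0, key 1, Over.eq O.injective ((D.lift_s.whiskerRight S.θ).comp D.lift_c)
    (hτ.comp (D.lift_s.whiskerLeft S.θ)) h₃⟩

/-- Universality of the lift is a limit property of `T₂` with one leg into `T ≫ T` and one into the
identity. Both legs respect the laws, so the method used for fibre powers applies. -/
theorem exists_universal : ∃ ν : D.T₂ ⟶ D.T₂ ≫ T,
    ν ≫ D.π 0 ▷ T = D.π 0 ≫ D.l ∧ ν ≫ D.π 1 ▷ T = D.π 1 ≫ (ρ_ T).inv ≫ T ◁ D.z ∧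
    ∀ {Y : K} (F : Y ⟶ O.P), IsPullback (F ◁ (ν ≫ D.s ▷ T)) (F ◁ (D.π 0 ≫ D.p))
      (F ◁ (D.p ▷ T ≫ (λ_ T).hom)) (F ◁ D.z) := by
  obtain ⟨φ, h₁, h₂, h₃⟩ := X.lift_universal
  have c₂ : Over (LawfulEndo.tan X).law ((LawfulEndo.tan X).comp (LawfulEndo.tan X)).law
      ((ρ_ X.T).inv ≫ X.T ◁ X.z) ((ρ_ X.T).inv ≫ X.T ◁ X.z) :=
    (Over.inv (τ := ρ_ _) (φ := ρ_ _) (Over.rightUnitor _)).comp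
      ((LawfulEndo.over_z X).whiskerLeft _)
  have l₂ : Over S.θ (S.comp S).θ ((ρ_ T).inv ≫ T ◁ D.z)
      ((ρ_ X.T).inv ≫ X.T ◁ X.z) :=
    (Over.inv (τ := ρ_ _) (φ := ρ_ _) (Over.rightUnitor _)).comp
      (D.lift_z.whiskerLeft _)
  have hφ : Over D.law₂.law (D.law₂.comp (LawfulEndo.tan X)).law φ φ := over_l₂ D.over_π (by
    rw [Fin.forall_fin_two]
    constructor
    · have := (D.over_π 0).comp (LawfulEndo.over_l X)
      rwa [show X.π 0 ≫ X.l = φ ≫ X.π 0 ▷ X.T from h₁.symm] at this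
    · have := (D.over_π 1).comp c₂
      rwa [show X.π 1 ≫ (ρ_ X.T).inv ≫ X.T ◁ X.z = φ ≫ X.π 1 ▷ X.T from h₂.symm] at this)
  obtain ⟨τ, hτ⟩ := D.liftT₂.exists_over (D.liftT₂.comp S) hφ
  refine ⟨τ, Over.eq O.injective (hτ.comp ((D.lift_π 0).whiskerRight S.θ))
      ((D.lift_π 0).comp D.lift_l) h₁,
    Over.eq O.injective (hτ.comp ((D.lift_π 1).whiskerRight S.θ))
      ((D.lift_π 1).comp l₂) h₂, fun {Y} F => ?_⟩
  -- The two legs are bundled into a family: `true` is the leg into `T ≫ T`, `false` the leg into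
  -- the identity.
  let E : Bool → (X.obj ⟶ X.obj) := fun b => bif b then X.T ≫ X.T else 𝟙 _
  let LE : ∀ b, LawfulEndo X (E b) :=
    Bool.rec (LawfulEndo.id X) ((LawfulEndo.tan X).comp (LawfulEndo.tan X))
  let d : ∀ b, X.T₂ ⟶ E b := Bool.rec (X.π₁ ≫ X.p) (φ ≫ X.s ▷ X.T)
  let uE : Bool → (O.P ⟶ O.P) := fun b => bif b then T ≫ T else 𝟙 _
  let SE : ∀ b, LiftEndo O (LE b) (uE b) := Bool.rec (LiftEndo.id O) (S.comp S)
  let δ : ∀ b, D.T₂ ⟶ uE b := Bool.rec (D.π 0 ≫ D.p) (τ ≫ D.s ▷ T)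
  have hm : JointlyMono d := fun F _ _ _ h => (h₃ F).hom_ext (h true) (h false)
  have hd : ∀ b, Over D.law₂.law (LE b).law (d b) (d b) :=
    Bool.rec ((D.over_π 0).comp (LawfulEndo.over_p X))
      (hφ.comp ((LawfulEndo.over_s D.over_π).whiskerRight _))
  have hδ : ∀ b, Over D.liftT₂.θ (SE b).θ (δ b) (d b) :=
    Bool.rec ((D.lift_π 0).comp D.lift_p) (hτ.comp (D.lift_s.whiskerRight _))
  have hm' : JointlyMono δ := LiftEndo.jointlyMono hm hδ
  have hp : Over (S.comp S).θ S.θ (D.p ▷ T ≫ (λ_ T).hom)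
      (X.p ▷ X.T ≫ (λ_ X.T).hom) := (D.lift_p.whiskerRight _).comp (Over.leftUnitor _)
  refine isPullback_of_existsUnique ?_ (fun Z a b hab => ?_) (fun Z k k' e₁ e₂ =>
    hm' F k k' (Bool.rec e₂ e₁))
  · rw [← whiskerLeft_comp, ← whiskerLeft_comp]
    congr 1
    refine Over.eq O.injective ((hδ true).comp hp) ((hδ false).comp D.lift_z) ?_
    rw [← whiskerLeft_iff]
    exact (whiskerLeft_comp _ _ _).trans ((h₃ (𝟙 _)).w.trans (whiskerLeft_comp _ _ _).symm)
  · obtain ⟨k, hk₁, hk₂⟩ : ∃ k, k ≫ (F ≫ O.W) ◁ d true = (SE true).push a ∧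
        k ≫ (F ≫ O.W) ◁ d false = (SE false).push b :=
      ⟨_, (h₃ (F ≫ O.W)).lift_fst _ _ (by
          have e₁ := (SE true).push_comp S hp a
          have e₂ := (SE false).push_comp S D.lift_z b
          exact e₁.symm.trans ((congrArg S.push hab).trans e₂)),
        (h₃ (F ≫ O.W)).lift_snd _ _ _⟩
    obtain ⟨k', hk'⟩ := LiftEndo.exists_factor hd hm hδ F Z (Bool.rec b a) k (Bool.rec hk₂ hk₁)
    exact ⟨k', hk' true, hk' false⟩

/-- The tangentad structure on an object that classifies families of vector fields. -/
def tangentad : Tangentad K where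
  obj := O.P
  T := T
  p := D.p
  z := D.z
  T₂ := D.T₂
  π₁ := D.π 0
  π₂ := D.π 1
  s := D.s
  l := D.l
  c := D.c
  isPullback := D.isPullback
  exists_power := D.exists_power
  z_p := Over.eq O.injective (D.lift_z.comp D.lift_p) (Over.id _) X.z_p
  s_p := Over.eq O.injective (D.lift_s.comp D.lift_p) ((D.lift_π 0).comp D.lift_p) X.s_p
  s_assoc {Z} a b a' b' h h₁ h₂ h₃ h₄ := by
    -- The 1-morphism `Z` is arbitrary and need not lift anything, so `Over.eq` does not apply. The
    -- elements are pushed to the base, where associativity holds for generalized elements.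
    have hπ := fun (i) (f : Z ⟶ D.T₂) => D.liftT₂.pushEndo_comp S (D.lift_π i) f
    have hs := fun (f : Z ⟶ D.T₂) => D.liftT₂.pushEndo_comp S D.lift_s f
    refine S.pushEndo_injective ?_
    rw [hs, hs]
    refine X.s_assoc_at (D.liftT₂.pushEndo a) (D.liftT₂.pushEndo b) _ _ ?_ ?_ ?_ ?_ ?_
    · exact (hπ 1 a).symm.trans ((congrArg _ h).trans (hπ 0 b))
    · exact (hπ 0 a').symm.trans ((congrArg _ h₁).trans (hs a))
    · exact (hπ 1 a').symm.trans ((congrArg _ h₂).trans (hπ 1 b))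
    · exact (hπ 0 b').symm.trans ((congrArg _ h₃).trans (hπ 0 a))
    · exact (hπ 1 b').symm.trans ((congrArg _ h₄).trans (hs b))
  s_unit e h₁ h₂ := by
    refine S.pushEndo_injective ?_
    rw [D.liftT₂.pushEndo_comp S D.lift_s]
    refine X.s_unit_at _ _ ?_ ?_
    · refine (D.liftT₂.pushEndo_comp S (D.lift_π 0) e).symm.trans ?_
      rw [h₁, ← S.pushEndo_comp S (D.lift_p.comp D.lift_z), Category.id_comp]
    · exact (D.liftT₂.pushEndo_comp S (D.lift_π 1) e).symm.trans (congrArg _ h₂)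
  s_comm τ h₁ h₂ := by
    refine S.pushEndo_injective ?_
    -- The bare `s` is read as the sum of the identity element of `T₂`.
    rw [D.liftT₂.pushEndo_comp S D.lift_s, ← Category.id_comp D.s,
      D.liftT₂.pushEndo_comp S D.lift_s]
    refine X.s_comm_at _ _ ?_ ?_
    · refine (D.liftT₂.pushEndo_comp S (D.lift_π 0) τ).symm.trans ?_
      rw [h₁, ← Category.id_comp (D.π 1)]
      exact D.liftT₂.pushEndo_comp S (D.lift_π 1) _
    · refine (D.liftT₂.pushEndo_comp S (D.lift_π 1) τ).symm.trans ?_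
      rw [h₂, ← Category.id_comp (D.π 0)]
      exact D.liftT₂.pushEndo_comp S (D.lift_π 0) _
  l_p := Over.eq O.injective
    (D.lift_l.comp ((D.lift_p.whiskerRight S.θ).comp (Over.leftUnitor _)))
    (D.lift_p.comp D.lift_z) X.l_p
  z_l := Over.eq O.injective (D.lift_z.comp D.lift_l)
    (D.lift_z.comp ((Over.inv (τ := λ_ _) (φ := λ_ _) (Over.leftUnitor _)).comp
      (D.lift_z.whiskerRight S.θ))) X.z_l
  s_l := D.exists_l₂
  c_p := Over.eq O.injective
    (D.lift_c.comp ((D.lift_p.whiskerLeft S.θ).comp (Over.rightUnitor _)))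
    ((D.lift_p.whiskerRight S.θ).comp (Over.leftUnitor _)) X.c_p
  z_c := Over.eq O.injective ((D.lift_z.whiskerRight S.θ).comp D.lift_c)
    ((Over.leftUnitor _).comp ((Over.inv (τ := ρ_ _) (φ := ρ_ _) (Over.rightUnitor _)).comp
      (D.lift_z.whiskerLeft S.θ))) X.z_c
  s_c := D.exists_c₂
  l_coassoc := Over.eq O.injective
    (D.lift_l.comp ((D.lift_l.whiskerRight S.θ).comp (Over.associator _ _ _)))
    (D.lift_l.comp (D.lift_l.whiskerLeft S.θ)) X.l_coassoc
  l_c := Over.eq O.injective (D.lift_l.comp D.lift_c) D.lift_l X.l_c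
  l_c_c := by
    have ha := Over.associator S.θ S.θ S.θ
    have ha' := Over.inv (τ := α_ _ _ _) (φ := α_ _ _ _) ha
    exact Over.eq O.injective
      ((D.lift_l.whiskerLeft S.θ).comp (ha'.comp
        ((D.lift_c.whiskerRight S.θ).comp (ha.comp (D.lift_c.whiskerLeft S.θ)))))
      (D.lift_c.comp ((D.lift_l.whiskerRight S.θ).comp ha)) X.l_c_c
  c_c := Over.eq O.injective (D.lift_c.comp D.lift_c) (Over.id _) X.c_c
  c_braid := by
    have ha := Over.associator S.θ S.θ S.θ
    have ha' := Over.inv (τ := α_ _ _ _) (φ := α_ _ _ _) ha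
    have hl := D.lift_c.whiskerLeft S.θ
    have hr := D.lift_c.whiskerRight S.θ
    exact Over.eq O.injective
      (hr.comp (ha.comp (hl.comp (ha'.comp (hr.comp ha)))))
      (ha.comp (hl.comp (ha'.comp (hr.comp (ha.comp hl))))) X.c_braid
  lift_universal := D.exists_universal

/-- The classified 1-morphism, as a lax tangent morphism. -/
def toBase : LaxMor D.tangentad X where
  F := O.W
  law := S.θ.hom
  law_p := by
    have h : D.p ▷ O.W ≫ (λ_ O.W).hom ≫ (ρ_ O.W).inv = S.θ.hom ≫ O.W ◁ X.p := D.lift_p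
    change S.θ.hom ≫ O.W ◁ X.p ≫ (ρ_ O.W).hom = D.p ▷ O.W ≫ (λ_ O.W).hom
    rw [← reassoc_of% h]; simp
  z_law := D.lift_z.trans (Category.assoc _ _ _)
  s_law := ⟨D.liftT₂.θ.hom, (D.lift_π 0).symm, (D.lift_π 1).symm, D.lift_s⟩
  l_law := by
    have h := D.lift_l
    simp only [Over, LiftEndo.comp, pasteIso_hom] at h
    exact h
  c_law := by
    have h := D.lift_c
    simp only [Over, LiftEndo.comp, pasteIso_hom, Category.assoc] at h
    exact h

end TangentLift

end

/-! ### Reflecting lax tangent morphisms along a faithful one with invertible law -/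

section
variable {K : Type u} [Bicategory.{w, v} K]

/-- A lax tangent morphism with the underlying data replaced by equal ones. -/
def LaxMor.copy {X Y : Tangentad K} (M : LaxMor X Y) {F : X.obj ⟶ Y.obj}
    (law : X.T ≫ F ⟶ F ≫ Y.T) (hF : M.F = F)
    (hlaw : M.law ≫ eqToHom hF ▷ Y.T = X.T ◁ eqToHom hF ≫ law) : LaxMor X Y where
  F := F
  law := law
  law_p := by subst hF; simp at hlaw; subst hlaw; exact M.law_p
  z_law := by subst hF; simp at hlaw; subst hlaw; exact M.z_law
  s_law := by subst hF; simp at hlaw; subst hlaw; exact M.s_law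
  l_law := by subst hF; simp at hlaw; subst hlaw; exact M.l_law
  c_law := by subst hF; simp at hlaw; subst hlaw; exact M.c_law

/-- A 1-morphism with a law is a lax tangent morphism when its composite with a faithful strong
tangent morphism is. -/
def LaxMor.reflect {P Q X : Tangentad K} (W : LaxMor Q X) [IsIso W.law]
    (hW : ∀ {Y : K} {Z Z' : Y ⟶ Q.obj} {τ τ' : Z ⟶ Z'}, τ ▷ W.F = τ' ▷ W.F → τ = τ')
    {F : P.obj ⟶ Q.obj} (law : P.T ≫ F ⟶ F ≫ Q.T) (N : LaxMor P X) (hN : N.F = F ≫ W.F)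
    (h : N.law = P.T ◁ eqToHom hN ≫ ((α_ _ _ _).inv ≫ law ▷ W.F ≫ (α_ _ _ _).hom ≫ F ◁ W.law ≫
      (α_ _ _ _).inv) ≫ eqToHom hN.symm ▷ X.T) : LaxMor P Q :=
  have hcopy : N.law ≫ eqToHom hN ▷ X.T = P.T ◁ eqToHom hN ≫ ((α_ _ _ _).inv ≫ law ▷ W.F ≫
    (α_ _ _ _).hom ≫ F ◁ W.law ≫ (α_ _ _ _).inv) := by
    rw [h]
    simp
  -- The morphism `N` with `F ≫ W.F` as its literal underlying 1-morphism, so that its axioms can be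
  -- used without transports.
  let N' := N.copy _ hN hcopy
  -- Every axiom is tested after whiskering with `W.F`, where it follows from that of the composite
  -- and that of `W`. The one for `p` comes first, since the pairing in `s_law` depends on it.
  have hp : law ≫ F ◁ Q.p ≫ (ρ_ F).hom = P.p ▷ F ≫ (λ_ F).hom := by
    apply hW
    have h₁ : ((α_ _ _ _).inv ≫ law ▷ W.F ≫ (α_ _ _ _).hom ≫ F ◁ W.law ≫ (α_ _ _ _).inv) ≫
      (F ≫ W.F) ◁ X.p ≫ (ρ_ (F ≫ W.F)).hom = P.p ▷ (F ≫ W.F) ≫ (λ_ _).hom := N'.law_p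
    have h₂ := congrArg (fun t => F ◁ t) W.law_p
    simp only [whiskerLeft_comp] at h₂
    calc _ = 𝟙 _ ⊗≫ law ▷ W.F ⊗≫ (F ◁ Q.p ▷ W.F ≫ F ◁ (λ_ W.F).hom) ⊗≫ 𝟙 _ := by bicategory
      _ = 𝟙 _ ⊗≫ (((α_ _ _ _).inv ≫ law ▷ W.F ≫ (α_ _ _ _).hom ≫ F ◁ W.law ≫
            (α_ _ _ _).inv) ≫ (F ≫ W.F) ◁ X.p ≫ (ρ_ (F ≫ W.F)).hom) ⊗≫ 𝟙 _ := by
          rw [← h₂]; bicategory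
      _ = _ := by rw [h₁]; bicategory
  { F := F
    law := law
    law_p := hp
    z_law := by
      apply hW
      have h₁ : P.z ▷ (F ≫ W.F) ≫ ((α_ _ _ _).inv ≫ law ▷ W.F ≫ (α_ _ _ _).hom ≫ F ◁ W.law ≫
        (α_ _ _ _).inv) = (λ_ _).hom ≫ (ρ_ _).inv ≫ (F ≫ W.F) ◁ X.z := N'.z_law
      have h₂ := congrArg (fun t => F ◁ t) W.z_law
      simp only [whiskerLeft_comp] at h₂
      -- Appending the invertible law of `W` turns the left side into the law of the composite.
      rw [← cancel_mono (α_ _ _ _).hom, ← cancel_mono (F ◁ W.law)]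
      calc _ = 𝟙 _ ⊗≫ (P.z ▷ (F ≫ W.F) ≫ ((α_ _ _ _).inv ≫ law ▷ W.F ≫ (α_ _ _ _).hom ≫
              F ◁ W.law ≫ (α_ _ _ _).inv)) ⊗≫ 𝟙 _ := by bicategory
        _ = 𝟙 _ ⊗≫ (F ◁ (λ_ W.F).hom ≫ F ◁ (ρ_ W.F).inv ≫ F ◁ W.F ◁ X.z) := by
            rw [h₁]; bicategory
        _ = _ := by rw [← h₂]; bicategory
    s_law := by
      obtain ⟨n, n₁, n₂, n₃⟩ := N'.s_law
      obtain ⟨w, w₁, w₂, w₃⟩ := W.s_law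
      change P.T₂ ≫ F ≫ W.F ⟶ (F ≫ W.F) ≫ X.T₂ at n
      change n ≫ (F ≫ W.F) ◁ X.π₁ = P.π₁ ▷ (F ≫ W.F) ≫ ((α_ _ _ _).inv ≫ law ▷ W.F ≫
        (α_ _ _ _).hom ≫ F ◁ W.law ≫ (α_ _ _ _).inv) at n₁
      change n ≫ (F ≫ W.F) ◁ X.π₂ = P.π₂ ▷ (F ≫ W.F) ≫ ((α_ _ _ _).inv ≫ law ▷ W.F ≫
        (α_ _ _ _).hom ≫ F ◁ W.law ≫ (α_ _ _ _).inv) at n₂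
      change P.s ▷ (F ≫ W.F) ≫ ((α_ _ _ _).inv ≫ law ▷ W.F ≫ (α_ _ _ _).hom ≫ F ◁ W.law ≫
        (α_ _ _ _).inv) = n ≫ (F ≫ W.F) ◁ X.s at n₃
      have hp : law ≫ F ◁ Q.p = P.p ▷ F ≫ (λ_ F).hom ≫ (ρ_ F).inv := by
        rw [← reassoc_of% hp]; simp
      obtain ⟨m, m₁, m₂⟩ := Q.exists_lift (P.π₁ ▷ F ≫ law) (P.π₂ ▷ F ≫ law) (by
        rw [Category.assoc, Category.assoc, hp, ← comp_whiskerRight_assoc,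
          ← comp_whiskerRight_assoc, P.π_p])
      refine ⟨m, m₁, m₂, hW ?_⟩
      have key : ∀ (x : P.T₂ ⟶ P.T) (y : Q.T₂ ⟶ Q.T) (t : X.T₂ ⟶ X.T),
          w ≫ W.F ◁ t = y ▷ W.F ≫ W.law → m ≫ F ◁ y = x ▷ F ≫ law →
          (𝟙 _ ⊗≫ m ▷ W.F ⊗≫ F ◁ w ⊗≫ 𝟙 _ : P.T₂ ≫ F ≫ W.F ⟶ (F ≫ W.F) ≫ X.T₂) ≫
            (F ≫ W.F) ◁ t =
          x ▷ (F ≫ W.F) ≫ ((α_ _ _ _).inv ≫ law ▷ W.F ≫ (α_ _ _ _).hom ≫ F ◁ W.law ≫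
            (α_ _ _ _).inv) := by
        intro x y t e₁ e₂
        have e₁ := congrArg (fun t => F ◁ t) e₁
        have e₂ := congrArg (fun t => t ▷ W.F) e₂
        simp only [whiskerLeft_comp, comp_whiskerRight] at e₁ e₂
        calc _ = 𝟙 _ ⊗≫ m ▷ W.F ⊗≫ (F ◁ w ≫ F ◁ W.F ◁ t) ⊗≫ 𝟙 _ := by bicategory
          _ = 𝟙 _ ⊗≫ (m ▷ W.F ≫ (F ◁ y) ▷ W.F) ⊗≫ F ◁ W.law ⊗≫ 𝟙 _ := by rw [e₁]; bicategory
          _ = _ := by rw [e₂]; bicategory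
      -- The pairing of the composite is unique, so it is the paste of the pairings of `law` and of
      -- `W`.
      have hn : n = (𝟙 _ ⊗≫ m ▷ W.F ⊗≫ F ◁ w ⊗≫ 𝟙 _ : P.T₂ ≫ F ≫ W.F ⟶ (F ≫ W.F) ≫ X.T₂) :=
        X.lift_ext (n₁.trans (key _ _ _ w₁ m₁).symm) (n₂.trans (key _ _ _ w₂ m₂).symm)
      have h₂ := congrArg (fun t => F ◁ t) w₃
      simp only [whiskerLeft_comp] at h₂
      rw [← cancel_mono (α_ _ _ _).hom, ← cancel_mono (F ◁ W.law)]
      calc _ = 𝟙 _ ⊗≫ (P.s ▷ (F ≫ W.F) ≫ ((α_ _ _ _).inv ≫ law ▷ W.F ≫ (α_ _ _ _).hom ≫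
              F ◁ W.law ≫ (α_ _ _ _).inv)) ⊗≫ 𝟙 _ := by bicategory
        _ = 𝟙 _ ⊗≫ m ▷ W.F ⊗≫ (F ◁ w ≫ F ◁ W.F ◁ X.s) := by
            rw [n₃, hn]; bicategory
        _ = _ := by rw [← h₂]; bicategory
    l_law := by
      apply hW
      have h₁ : P.l ▷ (F ≫ W.F) ≫ (α_ _ _ _).hom ≫ P.T ◁ ((α_ _ _ _).inv ≫ law ▷ W.F ≫
        (α_ _ _ _).hom ≫ F ◁ W.law ≫ (α_ _ _ _).inv) ≫ (α_ _ _ _).inv ≫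
        ((α_ _ _ _).inv ≫ law ▷ W.F ≫ (α_ _ _ _).hom ≫ F ◁ W.law ≫ (α_ _ _ _).inv) ▷ X.T ≫
        (α_ _ _ _).hom = ((α_ _ _ _).inv ≫ law ▷ W.F ≫
        (α_ _ _ _).hom ≫ F ◁ W.law ≫ (α_ _ _ _).inv) ≫ (F ≫ W.F) ◁ X.l := N'.l_law
      have h₂ := congrArg (fun t => F ◁ t) W.l_law
      simp only [whiskerLeft_comp] at h₂
      rw [← cancel_mono ((α_ _ _ _).hom ≫ F ◁ (α_ _ _ _).hom), ← cancel_mono (F ◁ Q.T ◁ W.law),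
        ← cancel_mono (F ◁ (α_ _ _ _).inv), ← cancel_mono (F ◁ W.law ▷ X.T)]
      calc _ = 𝟙 _ ⊗≫ P.l ▷ F ▷ W.F ⊗≫ P.T ◁ law ▷ W.F ⊗≫
              (law ▷ (Q.T ≫ W.F) ≫ (F ≫ Q.T) ◁ W.law) ⊗≫ F ◁ W.law ▷ X.T := by bicategory
        _ = 𝟙 _ ⊗≫ (P.l ▷ (F ≫ W.F) ≫ (α_ _ _ _).hom ≫ P.T ◁ ((α_ _ _ _).inv ≫ law ▷ W.F ≫
              (α_ _ _ _).hom ≫ F ◁ W.law ≫ (α_ _ _ _).inv) ≫ (α_ _ _ _).inv ≫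
              ((α_ _ _ _).inv ≫ law ▷ W.F ≫ (α_ _ _ _).hom ≫ F ◁ W.law ≫
                (α_ _ _ _).inv) ▷ X.T ≫ (α_ _ _ _).hom) ⊗≫ 𝟙 _ := by
            rw [← whisker_exchange]; bicategory
        _ = 𝟙 _ ⊗≫ law ▷ W.F ⊗≫ (F ◁ W.law ≫ F ◁ W.F ◁ X.l) ⊗≫ 𝟙 _ := by
            rw [h₁]; bicategory
        _ = _ := by rw [← h₂]; bicategory
    c_law := by
      apply hW
      have h₁ : P.c ▷ (F ≫ W.F) ≫ (α_ _ _ _).hom ≫ P.T ◁ ((α_ _ _ _).inv ≫ law ▷ W.F ≫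
        (α_ _ _ _).hom ≫ F ◁ W.law ≫ (α_ _ _ _).inv) ≫ (α_ _ _ _).inv ≫
        ((α_ _ _ _).inv ≫ law ▷ W.F ≫ (α_ _ _ _).hom ≫ F ◁ W.law ≫ (α_ _ _ _).inv) ▷ X.T ≫
        (α_ _ _ _).hom = (α_ _ _ _).hom ≫ P.T ◁ ((α_ _ _ _).inv ≫ law ▷ W.F ≫
        (α_ _ _ _).hom ≫ F ◁ W.law ≫ (α_ _ _ _).inv) ≫ (α_ _ _ _).inv ≫
        ((α_ _ _ _).inv ≫ law ▷ W.F ≫ (α_ _ _ _).hom ≫ F ◁ W.law ≫ (α_ _ _ _).inv) ▷ X.T ≫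
        (α_ _ _ _).hom ≫ (F ≫ W.F) ◁ X.c := N'.c_law
      have h₂ := congrArg (fun t => F ◁ t) W.c_law
      simp only [whiskerLeft_comp] at h₂
      rw [← cancel_mono ((α_ _ _ _).hom ≫ F ◁ (α_ _ _ _).hom), ← cancel_mono (F ◁ Q.T ◁ W.law),
        ← cancel_mono (F ◁ (α_ _ _ _).inv), ← cancel_mono (F ◁ W.law ▷ X.T)]
      calc _ = 𝟙 _ ⊗≫ P.c ▷ F ▷ W.F ⊗≫ P.T ◁ law ▷ W.F ⊗≫
              (law ▷ (Q.T ≫ W.F) ≫ (F ≫ Q.T) ◁ W.law) ⊗≫ F ◁ W.law ▷ X.T := by bicategory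
        _ = 𝟙 _ ⊗≫ (P.c ▷ (F ≫ W.F) ≫ (α_ _ _ _).hom ≫ P.T ◁ ((α_ _ _ _).inv ≫ law ▷ W.F ≫
              (α_ _ _ _).hom ≫ F ◁ W.law ≫ (α_ _ _ _).inv) ≫ (α_ _ _ _).inv ≫
              ((α_ _ _ _).inv ≫ law ▷ W.F ≫ (α_ _ _ _).hom ≫ F ◁ W.law ≫
                (α_ _ _ _).inv) ▷ X.T ≫ (α_ _ _ _).hom) ⊗≫ 𝟙 _ := by
            rw [← whisker_exchange]; bicategory
        _ = 𝟙 _ ⊗≫ P.T ◁ law ▷ W.F ⊗≫ ((P.T ≫ F) ◁ W.law ≫ law ▷ (W.F ≫ X.T)) ⊗≫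
              F ◁ W.law ▷ X.T ⊗≫ F ◁ W.F ◁ X.c ⊗≫ 𝟙 _ := by
            rw [h₁]; bicategory
        _ = 𝟙 _ ⊗≫ P.T ◁ law ▷ W.F ⊗≫ law ▷ Q.T ▷ W.F ⊗≫ (F ◁ (α_ _ _ _).hom ≫
              F ◁ Q.T ◁ W.law ≫ F ◁ (α_ _ _ _).inv ≫
              F ◁ W.law ▷ X.T ≫ F ◁ (α_ _ _ _).hom ≫ F ◁ W.F ◁ X.c) ⊗≫ 𝟙 _ := by
            rw [whisker_exchange]; bicategory
        _ = _ := by rw [← h₂]; bicategory }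

end

/-! ### Lifting along `U` and along its 2-pullback -/

section
variable {K : Type u} [Bicategory.{w, v} K] {X : Tangentad K}

/-- Since `U` is strict, the tangent bundle of `VF` lifts that of `X` on the nose. The compatibility
with `c` is the condition that the universal field be a tangent 2-morphism. -/
theorem VFConstruction.exists_liftT (V : VFConstruction X) :
    ∃ h : V.VF.T ≫ und V.U = und V.U ≫ X.T,
      V.VF.T ◁ V.v.fld ≫ (α_ _ _ _).inv ≫ eqToHom h ▷ X.T ≫ (α_ _ _ _).hom ≫ und V.U ◁ X.c =
        eqToHom h ≫ V.v.fld ▷ X.T ≫ (α_ _ _ _).hom := by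
  obtain ⟨h, h'⟩ := V.U_strict
  refine ⟨h, ?_⟩
  have := V.v.fld_comm
  rw [h'] at this
  rw [reassoc_of% this]
  simp

/-- Applying `A` to the universal field and then the inverse law yields a field on `und V.U ≫ A`; it
is a section because the law is compatible with `p`. The lift is the 1-morphism classifying it. -/
theorem VFConstruction.exists_lift (V : VFConstruction X) {A : X.obj ⟶ X.obj}
    (L : LawfulEndo X A) : ∃ (u : V.VF.obj ⟶ V.VF.obj) (h : u ≫ und V.U = und V.U ≫ A),
      u ◁ V.v.fld ≫ (α_ _ _ _).inv ≫ eqToHom h ▷ X.T ≫ (α_ _ _ _).hom ≫ und V.U ◁ L.law.hom =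
        eqToHom h ≫ V.v.fld ▷ A ≫ (α_ _ _ _).hom := by
  obtain ⟨Z, h, hZ⟩ := V.exists_classifying (und V.U ≫ A)
    (V.v.fld ▷ A ≫ (α_ _ _ _).hom ≫ und V.U ◁ L.law.inv ≫ (α_ _ _ _).inv) (by
      have h := congrArg (fun t => t ▷ A) V.v.fld_p
      have h' : A ◁ X.p ≫ (ρ_ A).hom = L.law.hom ≫ X.p ▷ A ≫ (λ_ A).hom := L.law_p.symm
      have h' := congrArg (fun t => und V.U ◁ t) ((Iso.inv_comp_eq _).2 h')
      simp only [comp_whiskerRight, whiskerLeft_comp, id_whiskerRight] at h h'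
      calc _ = 𝟙 _ ⊗≫ V.v.fld ▷ A ⊗≫ (und V.U ◁ L.law.inv ≫ und V.U ◁ A ◁ X.p ≫
              und V.U ◁ (ρ_ A).hom) := by bicategory
        _ = 𝟙 _ ⊗≫ (V.v.fld ▷ A ≫ (und V.U ◁ X.p) ▷ A ≫ (ρ_ (und V.U)).hom ▷ A) := by
            rw [h']; bicategory
        _ = _ := by rw [h]; bicategory)
  refine ⟨Z, h, ?_⟩
  rw [reassoc_of% hZ]
  simp [← whiskerLeft_comp]

section
variable {x y z : K} {U : y ⟶ z} {T A : z ⟶ z} {f : U ⟶ U ≫ T} {a : A ≫ T ⟶ T ≫ A}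

/-- Restricts a compatible lift on `VF` along a projection `q` of the 2-pullback. -/
theorem lift_compat_comp {u : y ⟶ y} {ψ : u ≫ U ⟶ U ≫ A}
    (h : u ◁ f ≫ (α_ _ _ _).inv ≫ ψ ▷ T ≫ (α_ _ _ _).hom ≫ U ◁ a = ψ ≫ f ▷ A ≫ (α_ _ _ _).hom)
    {q : x ⟶ y} {Z : x ⟶ x} {e : Z ≫ q ⟶ q ≫ u} {θ : Z ≫ q ≫ U ⟶ (q ≫ U) ≫ A}
    (hθ : θ = (α_ _ _ _).inv ≫ e ▷ U ≫ (α_ _ _ _).hom ≫ q ◁ ψ ≫ (α_ _ _ _).inv) :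
    Z ◁ (q ◁ f ≫ (α_ _ _ _).inv) ≫ (α_ _ _ _).inv ≫ θ ▷ T ≫ (α_ _ _ _).hom ≫ (q ≫ U) ◁ a =
    θ ≫ (q ◁ f ≫ (α_ _ _ _).inv) ▷ A ≫ (α_ _ _ _).hom := by
  have h := congrArg (fun t => q ◁ t) h
  simp only [whiskerLeft_comp] at h
  rw [hθ]
  calc _ = 𝟙 _ ⊗≫ ((Z ≫ q) ◁ f ≫ e ▷ (U ≫ T)) ⊗≫ q ◁ ψ ▷ T ⊗≫ q ◁ U ◁ a ⊗≫ 𝟙 _ := by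
          bicategory
    _ = 𝟙 _ ⊗≫ e ▷ U ⊗≫ (q ◁ u ◁ f ≫ q ◁ (α_ _ _ _).inv ≫ q ◁ ψ ▷ T ≫
            q ◁ (α_ _ _ _).hom ≫ q ◁ U ◁ a) ⊗≫ 𝟙 _ := by
          rw [whisker_exchange]; bicategory
    _ = _ := by rw [h]; bicategory

/-- Needed for the second projection, whose field lives on `q₂ ≫ U` and has to be moved to the
common base `q₁ ≫ U`. -/
theorem lift_compat_transport {U' : y ⟶ z} (e : U' ≅ U) {Z : y ⟶ y} {θ : Z ≫ U ⟶ U ≫ A}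
    (h : Z ◁ f ≫ (α_ _ _ _).inv ≫ θ ▷ T ≫ (α_ _ _ _).hom ≫ U ◁ a =
      θ ≫ f ▷ A ≫ (α_ _ _ _).hom) {θ' : Z ≫ U' ⟶ U' ≫ A}
    (hθ : θ' = Z ◁ e.hom ≫ θ ≫ e.inv ▷ A) :
    Z ◁ (e.hom ≫ f ≫ e.inv ▷ T) ≫ (α_ _ _ _).inv ≫ θ' ▷ T ≫ (α_ _ _ _).hom ≫ U' ◁ a =
      θ' ≫ (e.hom ≫ f ≫ e.inv ▷ T) ▷ A ≫ (α_ _ _ _).hom := by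
  have i₁ : Z ◁ e.inv ▷ T ≫ Z ◁ e.hom ▷ T = 𝟙 _ := by
    rw [← whiskerLeft_comp, inv_hom_whiskerRight, whiskerLeft_id]
  rw [hθ]
  calc _ = 𝟙 _ ⊗≫ Z ◁ e.hom ⊗≫ Z ◁ f ⊗≫ (Z ◁ e.inv ▷ T ≫ Z ◁ e.hom ▷ T) ⊗≫ θ ▷ T ⊗≫
            (e.inv ▷ (A ≫ T) ≫ U' ◁ a) := by bicategory
    _ = 𝟙 _ ⊗≫ Z ◁ e.hom ≫ (Z ◁ f ≫ (α_ _ _ _).inv ≫ θ ▷ T ≫ (α_ _ _ _).hom ≫ U ◁ a) ⊗≫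
            e.inv ▷ (T ≫ A) := by rw [i₁, ← whisker_exchange]; bicategory
    _ = _ := by rw [h]; simp [bicategoricalComp]

end

section
variable {V : VFConstruction X} {P : K} {q₁ q₂ : P ⟶ V.VF.obj}

/-- An object with the 2-dimensional universal property of a 2-pullback of the forgetful 1-morphism
along itself classifies pairs of vector fields. -/
def FieldObj.ofPair (e : q₁ ≫ und V.U ≅ q₂ ≫ und V.U)
    (h : ∀ {Y : K} (t t' : Y ⟶ P) (φ : t ≫ q₁ ⟶ t' ≫ q₁) (ψ : t ≫ q₂ ⟶ t' ≫ q₂),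
      φ ▷ und V.U ≫ (α_ t' q₁ _).hom ≫ t' ◁ e.hom =
        (α_ t q₁ _).hom ≫ t ◁ e.hom ≫ (α_ t q₂ _).inv ≫ ψ ▷ und V.U ≫ (α_ t' q₂ _).hom →
      ∃! τ : t ⟶ t', τ ▷ q₁ = φ ∧ τ ▷ q₂ = ψ) : FieldObj X Bool where
  P := P
  W := q₁ ≫ und V.U
  -- The index `false` is the first field, `true` the second one conjugated by `e`, so that both sit
  -- on `q₁ ≫ und V.U`.
  v := Bool.rec (q₁ ◁ V.v.fld ≫ (α_ _ _ _).inv)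
    (e.hom ≫ (q₂ ◁ V.v.fld ≫ (α_ _ _ _).inv) ≫ e.inv ▷ X.T)
  injective := by
    intro Y Z Z' τ τ' hτ
    have h₁ : τ ▷ q₁ = τ' ▷ q₁ := V.whisker_injective (by simpa using hτ)
    have h₂ : τ ▷ q₂ = τ' ▷ q₂ := V.whisker_injective (by
      have : τ ▷ (q₂ ≫ und V.U) = τ' ▷ (q₂ ≫ und V.U) := by
        rw [← cancel_epi (Z ◁ e.hom), whisker_exchange, whisker_exchange, hτ]
      simpa using this)
    obtain ⟨σ, -, hσ⟩ := h Z Z' (τ ▷ q₁) (τ ▷ q₂) (by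
      calc _ = (α_ _ _ _).hom ≫ τ ▷ (q₁ ≫ und V.U) ≫ Z' ◁ e.hom := by simp
        _ = _ := by rw [← whisker_exchange]; simp)
    rw [hσ τ ⟨rfl, rfl⟩, hσ τ' ⟨h₁.symm, h₂.symm⟩]
  exists_whisker Z Z' φ hφ := by
    have hφ₁ : Z ◁ (q₁ ◁ V.v.fld ≫ (α_ _ _ _).inv) ≫ (α_ _ _ _).inv ≫ φ ▷ X.T =
        φ ≫ Z' ◁ (q₁ ◁ V.v.fld ≫ (α_ _ _ _).inv) ≫ (α_ _ _ _).inv := hφ false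
    have hφ₂ : Z ◁ (e.hom ≫ (q₂ ◁ V.v.fld ≫ (α_ _ _ _).inv) ≫ e.inv ▷ X.T) ≫ (α_ _ _ _).inv ≫
        φ ▷ X.T = φ ≫ Z' ◁ (e.hom ≫ (q₂ ◁ V.v.fld ≫ (α_ _ _ _).inv) ≫ e.inv ▷ X.T) ≫
          (α_ _ _ _).inv := hφ true
    obtain ⟨τ₁, hτ₁⟩ := V.exists_whisker (Z ≫ q₁) (Z' ≫ q₁)
      ((α_ _ _ _).hom ≫ φ ≫ (α_ _ _ _).inv) (by
        calc _ = 𝟙 _ ⊗≫ (Z ◁ (q₁ ◁ V.v.fld ≫ (α_ _ _ _).inv) ≫ (α_ _ _ _).inv ≫ φ ▷ X.T) ⊗≫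
                𝟙 _ := by bicategory
          _ = _ := by rw [hφ₁]; bicategory)
    have i₁ : Z ◁ e.inv ≫ Z ◁ e.hom = 𝟙 _ := by simp
    have i₂ : Z' ◁ e.inv ▷ X.T ≫ Z' ◁ e.hom ▷ X.T = 𝟙 _ := by
      rw [← whiskerLeft_comp, inv_hom_whiskerRight, whiskerLeft_id]
    -- The component at `q₂` comes from `φ` conjugated by `e`, which is also what makes the two
    -- components agree over the base.
    obtain ⟨τ₂, hτ₂⟩ := V.exists_whisker (Z ≫ q₂) (Z' ≫ q₂)
      ((α_ _ _ _).hom ≫ Z ◁ e.inv ≫ φ ≫ Z' ◁ e.hom ≫ (α_ _ _ _).inv) (by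
        calc _ = 𝟙 _ ⊗≫ (Z ◁ e.inv ≫ Z ◁ e.hom) ⊗≫ Z ◁ q₂ ◁ V.v.fld ⊗≫ Z ◁ e.inv ▷ X.T ⊗≫
                φ ▷ X.T ⊗≫ Z' ◁ e.hom ▷ X.T ⊗≫ 𝟙 _ := by rw [i₁]; bicategory
          _ = 𝟙 _ ⊗≫ Z ◁ e.inv ⊗≫ (Z ◁ (e.hom ≫ (q₂ ◁ V.v.fld ≫ (α_ _ _ _).inv) ≫ e.inv ▷ X.T) ≫
                (α_ _ _ _).inv ≫ φ ▷ X.T) ⊗≫ Z' ◁ e.hom ▷ X.T ⊗≫ 𝟙 _ := by bicategory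
          _ = 𝟙 _ ⊗≫ Z ◁ e.inv ⊗≫ φ ⊗≫ Z' ◁ e.hom ⊗≫ Z' ◁ q₂ ◁ V.v.fld ⊗≫
                (Z' ◁ e.inv ▷ X.T ≫ Z' ◁ e.hom ▷ X.T) ⊗≫ 𝟙 _ := by rw [hφ₂]; bicategory
          _ = _ := by rw [i₂]; bicategory)
    obtain ⟨τ, ⟨h₁, -⟩, -⟩ := h Z Z' τ₁ τ₂ (by
      rw [hτ₁, hτ₂]
      simp)
    refine ⟨τ, ?_⟩
    rw [whiskerRight_comp, h₁, hτ₁]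
    simp

/-- The 2-pullback of the forgetful 1-morphism along itself classifies pairs of vector fields. -/
def Is2Pullback.fieldObj (h : Is2Pullback q₁ q₂ (und V.U) (und V.U)) : FieldObj X Bool :=
  FieldObj.ofPair (eqToIso h.comm) h.lift₂

section
variable [Strict K]

/-- The lift acts on each component, and both results have the same base. Strictness lets `Z`
commute with the projections as an equality; the resulting identity square is what later makes the
projections strict. -/
theorem Is2Pullback.exists_lift (h : Is2Pullback q₁ q₂ (und V.U) (und V.U)) {A : X.obj ⟶ X.obj}
    {L : LawfulEndo X A} {u : V.VF.obj ⟶ V.VF.obj} (hu : u ≫ und V.U = und V.U ≫ A)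
    (hS : u ◁ V.v.fld ≫ (α_ _ _ _).inv ≫ eqToHom hu ▷ X.T ≫ (α_ _ _ _).hom ≫
      und V.U ◁ L.law.hom = eqToHom hu ≫ V.v.fld ▷ A ≫ (α_ _ _ _).hom) :
    ∃ Z : P ⟶ P, Z ≫ q₁ = q₁ ≫ u ∧ Z ≫ q₂ = q₂ ≫ u ∧
      ∃ (hZ : Z ≫ q₁ ≫ und V.U = (q₁ ≫ und V.U) ≫ A) (S' : LiftEndo h.fieldObj L Z),
        S'.θ = eqToIso hZ := by
  have hq : ∀ {q : P ⟶ V.VF.obj}, (q ≫ u) ≫ und V.U = (q ≫ und V.U) ≫ A := fun {q} => by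
    rw [Strict.assoc, hu, Strict.assoc]
  obtain ⟨Z, ⟨h₁, h₂⟩, -⟩ := h.lift₁ (q₁ ≫ u) (q₂ ≫ u) (by rw [hq, hq, h.comm])
  have hZ₁ : Z ≫ q₁ ≫ und V.U = (q₁ ≫ und V.U) ≫ A := by
    rw [← Strict.assoc, h₁, hq]
  have hZ₂ : Z ≫ q₂ ≫ und V.U = (q₂ ≫ und V.U) ≫ A := by
    rw [← Strict.assoc, h₂, hq]
  refine ⟨Z, h₁, h₂, hZ₁, ⟨eqToIso hZ₁, Bool.rec ?_ ?_⟩, rfl⟩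
  · exact lift_compat_comp hS (e := eqToHom h₁) (by simp [Strict.associator_eqToIso]; rfl)
  · exact lift_compat_transport (eqToIso h.comm) (lift_compat_comp hS (e := eqToHom h₂) rfl)
      (by simp [Strict.associator_eqToIso]; rfl)

end
end
end

/-! ### Equality and reflection of laws -/

section
variable {K : Type u} [Bicategory.{w, v} K]

theorem LaxMor.ext_eqToHom {X Y : Tangentad K} {M N : LaxMor X Y} (h : M.F = N.F)
    (h' : M.law ≫ eqToHom h ▷ Y.T = X.T ◁ eqToHom h ≫ N.law) : M = N := by
  obtain ⟨F, a, _, _, _, _, _⟩ := M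
  obtain ⟨G, b, _, _, _, _, _⟩ := N
  dsimp only at h h'
  subst h
  have hab : a = b := by simpa using h'
  subst hab
  rfl

theorem LaxMor.law_heq {X Y : Tangentad K} {M N : LaxMor X Y} (h : M = N) :
    HEq M.law N.law := by
  subst h
  rfl

theorem LaxMor.ext_heq {X Y : Tangentad K} {M N : LaxMor X Y} (h : M.F = N.F)
    (h' : HEq M.law N.law) : M = N := by
  obtain ⟨F, a, _, _, _, _, _⟩ := M
  obtain ⟨G, b, _, _, _, _, _⟩ := N
  dsimp only at h h'
  subst h
  subst h'
  rfl

theorem TanHom.eqToHom_hom {X Y : Tangentad K} {M N : X ⟶ Y} (h : M = N) :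
    und₂ (eqToHom h) = eqToHom (congrArg und h) := by
  subst h
  rfl

/-- Compatibility of a 2-morphism with the laws can be tested after composing with `W`, because
`W.law` can be cancelled. -/
theorem TanHom.reflect {P Q X : Tangentad K} (W : LaxMor Q X) [IsIso W.law] {M N : LaxMor P Q}
    (τ : M.F ⟶ N.F) (h : (M.comp W).law ≫ (τ ▷ W.F) ▷ X.T = P.T ◁ (τ ▷ W.F) ≫ (N.comp W).law) :
    (M.law ≫ τ ▷ Q.T) ▷ W.F = (P.T ◁ τ ≫ N.law) ▷ W.F := by
  dsimp only [LaxMor.comp] at h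
  rw [← cancel_mono (α_ _ _ _).hom, ← cancel_mono (N.F ◁ W.law)]
  calc _ = M.law ▷ W.F ⊗≫ (τ ▷ (Q.T ≫ W.F) ≫ N.F ◁ W.law) := by bicategory
    _ = 𝟙 _ ⊗≫ (((α_ _ _ _).inv ≫ M.law ▷ W.F ≫ (α_ _ _ _).hom ≫ M.F ◁ W.law ≫
          (α_ _ _ _).inv) ≫ (τ ▷ W.F) ▷ X.T) ⊗≫ 𝟙 _ := by rw [← whisker_exchange]; bicategory
    _ = _ := by rw [h]; bicategory

theorem VFConstruction.isIso_law {X : Tangentad K} (V : VFConstruction X) : IsIso (LaxMor.law V.U) := by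
  obtain ⟨h, h'⟩ := V.U_strict
  rw [h']
  infer_instance

end

/-! ### The tangentad of pairs of vector fields as a 2-pullback -/

section
variable {K : Type u} [Bicategory.{w, v} K] [Strict K] {X : Tangentad K} {V : VFConstruction X}
  {P : K} {q₁ q₂ : P ⟶ V.VF.obj} (h : Is2Pullback q₁ q₂ (und V.U) (und V.U))

theorem Is2Pullback.exists_tangentLift : ∃ T : P ⟶ P, T ≫ q₁ = q₁ ≫ V.VF.T ∧
    T ≫ q₂ = q₂ ≫ V.VF.T ∧ ∃ (hT : T ≫ q₁ ≫ und V.U = (q₁ ≫ und V.U) ≫ X.T)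
      (S : LiftEndo h.fieldObj (LawfulEndo.tan X) T), S.θ = eqToIso hT ∧
        Nonempty (TangentLift S) := by
  obtain ⟨hT, hT'⟩ := V.exists_liftT
  obtain ⟨T, h₁, h₂, hZ, S, hS⟩ := h.exists_lift (L := LawfulEndo.tan X) hT hT'
  refine ⟨T, h₁, h₂, hZ, S, hS, TangentLift.nonempty h.fieldObj (fun {A} L => ?_) S⟩
  obtain ⟨u, hu, hu'⟩ := V.exists_lift L
  obtain ⟨Z, -, -, -, S', -⟩ := h.exists_lift hu hu'
  exact ⟨Z, ⟨S'⟩⟩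

variable {T : P ⟶ P} {S : LiftEndo h.fieldObj (LawfulEndo.tan X) T}
  {hT : T ≫ q₁ ≫ und V.U = (q₁ ≫ und V.U) ≫ X.T}

theorem eqToHom_law {x y z : K} {T : x ⟶ x} {q : x ⟶ y} {W : x ⟶ z} {U : y ⟶ z} {T' : y ⟶ y}
    {T'' : z ⟶ z} (hN : W = q ≫ U) (hT : T ≫ W = W ≫ T'') (hq : T ≫ q = q ≫ T')
    (hU : T' ≫ U = U ≫ T'') :
    eqToHom hT = T ◁ eqToHom hN ≫ ((α_ _ _ _).inv ≫ eqToHom hq ▷ U ≫ (α_ _ _ _).hom ≫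
      q ◁ eqToHom hU ≫ (α_ _ _ _).inv) ≫ eqToHom hN.symm ▷ T'' := by
  simp [Strict.associator_eqToIso]

/-- A lift of the first projection or of the second. -/
def TangentLift.proj (D : TangentLift S) (hS : S.θ = eqToIso hT) {q : P ⟶ V.VF.obj}
    (hq : q₁ ≫ und V.U = q ≫ und V.U) (hTq : T ≫ q = q ≫ V.VF.T) : LaxMor D.tangentad V.VF :=
  haveI := V.isIso_law
  LaxMor.reflect V.U V.whisker_injective (P := D.tangentad) (F := q) (eqToHom hTq) D.toBase hq (by
    obtain ⟨hU, hU'⟩ := V.U_strict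
    rw [hU']
    exact (congrArg Iso.hom hS).trans (eqToHom_law hq hT hTq hU))

omit h in
theorem comp_strict_law {Q R : Tangentad K} {Y : Tangentad K} {q : LaxMor Q Y}
    {hq : Q.T ≫ q.F = q.F ≫ Y.T} (hlaw : q.law = eqToHom hq) (M : LaxMor R Q) :
    ((LaxMor.comp M q).law : (R.T ≫ M.F ≫ q.F : R.obj ⟶ Y.obj) ⟶ (M.F ≫ q.F) ≫ Y.T) =
      (α_ _ _ _).inv ≫ M.law ▷ q.F ≫ eqToHom ((Strict.assoc _ _ _).trans
        ((congrArg (M.F ≫ ·) hq).trans (Strict.assoc _ _ _).symm)) := by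
  simp [LaxMor.comp, hlaw, Strict.associator_eqToIso]

-- The 2-dimensional universal property pairs two laws that agree over the base. The agreement is
-- heterogeneous because the two base 1-morphisms are equal without being syntactically the same.
include h in
theorem pairing_law {R : Tangentad K} {t : R.obj ⟶ P}
    (hT₁ : T ≫ q₁ = q₁ ≫ V.VF.T) (hT₂ : T ≫ q₂ = q₂ ≫ V.VF.T)
    (a : R.T ≫ t ≫ q₁ ⟶ (t ≫ q₁) ≫ V.VF.T) (b : R.T ≫ t ≫ q₂ ⟶ (t ≫ q₂) ≫ V.VF.T)
    (hU : V.VF.T ≫ und V.U = und V.U ≫ X.T)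
    (hab : HEq ((α_ _ _ _).inv ≫ a ▷ und V.U ≫ (α_ _ _ _).hom ≫ (t ≫ q₁) ◁ eqToHom hU ≫
        (α_ _ _ _).inv)
      ((α_ _ _ _).inv ≫ b ▷ und V.U ≫ (α_ _ _ _).hom ≫ (t ≫ q₂) ◁ eqToHom hU ≫
        (α_ _ _ _).inv)) :
    ∃! law : R.T ≫ t ⟶ t ≫ T,
      law ▷ q₁ = (α_ _ _ _).hom ≫ a ≫ eqToHom (by rw [Strict.assoc, Strict.assoc, hT₁]) ∧
      law ▷ q₂ = (α_ _ _ _).hom ≫ b ≫ eqToHom (by rw [Strict.assoc, Strict.assoc, hT₂]) := by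
  refine h.lift₂ _ _ _ _ ?_
  simp only [comp_whiskerRight, eqToHom_whiskerRight, whiskerLeft_eqToHom,
    Strict.associator_eqToIso, eqToIso.hom, eqToIso.inv, Category.assoc, eqToHom_trans,
    eqToHom_trans_assoc] at hab ⊢
  simp only [eqToHom_comp_heq_iff, heq_eqToHom_comp_iff, comp_eqToHom_heq_iff,
    heq_comp_eqToHom_iff] at hab
  rw [← heq_iff_eq]
  simpa only [eqToHom_comp_heq_iff, heq_eqToHom_comp_iff, comp_eqToHom_heq_iff,
    heq_comp_eqToHom_iff] using hab

end

section
variable {K : Type u} [Bicategory.{w, v} K] [Strict K] {X : Tangentad K} {V : VFConstruction X}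

theorem eqToHom_law_comm {x y z : K} {T : x ⟶ x} {q q' : x ⟶ y} {U : y ⟶ z} {T' : y ⟶ y}
    {T'' : z ⟶ z} (h : q ≫ U = q' ≫ U) (h₁ : T ≫ q = q ≫ T') (h₂ : T ≫ q' = q' ≫ T')
    (hU : T' ≫ U = U ≫ T'') :
    ((α_ _ _ _).inv ≫ eqToHom h₁ ▷ U ≫ eqToHom (by rw [Strict.assoc, hU, Strict.assoc])) ≫
      eqToHom h ▷ T'' = T ◁ eqToHom h ≫ (α_ _ _ _).inv ≫ eqToHom h₂ ▷ U ≫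
        eqToHom (by rw [Strict.assoc, hU, Strict.assoc]) := by
  simp [Strict.associator_eqToIso]

theorem reflect_law_eq {y x x' z : K} {T : y ⟶ y} {t : y ⟶ x} {Q : x ⟶ x} {q : x ⟶ x'}
    {U : x' ⟶ z} {T' : x' ⟶ x'} {T'' : z ⟶ z} (h₁ : Q ≫ q = q ≫ T') (hU : T' ≫ U = U ≫ T'')
    {a : T ≫ t ≫ q ⟶ (t ≫ q) ≫ T'} {l : T ≫ t ⟶ t ≫ Q}
    (hl : l ▷ q = (α_ _ _ _).hom ≫ a ≫ eqToHom (by rw [Strict.assoc, Strict.assoc, h₁])) :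
    (α_ _ _ _).inv ≫ a ▷ U ≫ (α_ _ _ _).hom ≫ (t ≫ q) ◁ eqToHom hU ≫ (α_ _ _ _).inv =
      T ◁ eqToHom (Strict.assoc _ _ _) ≫ ((α_ _ _ _).inv ≫ l ▷ (q ≫ U) ≫ (α_ _ _ _).hom ≫
        t ◁ ((α_ _ _ _).inv ≫ eqToHom h₁ ▷ U ≫ (α_ _ _ _).hom ≫ q ◁ eqToHom hU ≫
          (α_ _ _ _).inv) ≫ (α_ _ _ _).inv) ≫ eqToHom (Strict.assoc _ _ _).symm ▷ T'' := by
  rw [whiskerRight_comp, hl]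
  simp [Strict.associator_eqToIso]

theorem comp_law_eq_iff {y x x' : K} {T : y ⟶ y} {t : y ⟶ x} {Q : x ⟶ x} {q : x ⟶ x'}
    {T' : x' ⟶ x'} (h₁ : Q ≫ q = q ≫ T')
    {a : T ≫ t ≫ q ⟶ (t ≫ q) ≫ T'} {l : T ≫ t ⟶ t ≫ Q} :
    (α_ _ _ _).inv ≫ l ▷ q ≫ (α_ _ _ _).hom ≫ t ◁ eqToHom h₁ ≫ (α_ _ _ _).inv = a ↔
      l ▷ q = (α_ _ _ _).hom ≫ a ≫ eqToHom (by rw [Strict.assoc, Strict.assoc, h₁]) := by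
  constructor
  · rintro rfl
    simp [Strict.associator_eqToIso]
  · intro hl
    rw [hl]
    simp [Strict.associator_eqToIso]

/-- Underlying 1-morphisms and 2-morphisms are supplied by the 2-pullback in `K`. A law into `Q` is
a pair of laws into `VF`, and the tangent axioms can be checked in `X`, because the composite of
`p₁` and `U` is faithful with invertible law. -/
theorem Is2Pullback.of_und {Q : Tangentad K} {p₁ p₂ : Q ⟶ V.VF} (s₁ : IsStrict p₁)
    (s₂ : IsStrict p₂) (h : Is2Pullback (und p₁) (und p₂) (und V.U) (und V.U)) :
    Is2Pullback p₁ p₂ V.U V.U := by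
  obtain ⟨hU, hU'⟩ := V.U_strict
  obtain ⟨h₁, h₁'⟩ := s₁
  obtain ⟨h₂, h₂'⟩ := s₂
  have i₁ : IsIso (LaxMor.law p₁) := by rw [h₁']; infer_instance
  have i₂ : IsIso (LaxMor.law p₂) := by rw [h₂']; infer_instance
  have iU := V.isIso_law
  have iW : IsIso (LaxMor.comp p₁ V.U).law := by
    dsimp only [LaxMor.comp]
    infer_instance
  have hW : ∀ {Y : K} {Z Z' : Y ⟶ Q.obj} {τ τ' : Z ⟶ Z'},
    τ ▷ (LaxMor.comp p₁ V.U).F = τ' ▷ (LaxMor.comp p₁ V.U).F → τ = τ' := h.fieldObj.injective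
  have hcomm : p₁ ≫ V.U = p₂ ≫ V.U := by
    refine LaxMor.ext_eqToHom h.comm ?_
    change (LaxMor.comp p₁ V.U).law ≫ _ = _ ≫ (LaxMor.comp p₂ V.U).law
    rw [comp_strict_law hU', comp_strict_law hU', h₁', h₂']
    exact (eqToHom_law_comm h.comm h₁ h₂ hU)
  refine ⟨hcomm, ?_, ?_⟩
  · intro Y a b hab
    have hlaw := LaxMor.law_heq hab
    obtain ⟨t, ⟨ht₁, ht₂⟩, htu⟩ := h.lift₁ (und a) (und b) (congrArg und hab)
    obtain ⟨Fa, la, a₁, a₂, a₃, a₄, a₅⟩ := a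
    obtain ⟨Fb, lb, b₁, b₂, b₃, b₄, b₅⟩ := b
    dsimp only [und] at ht₁ ht₂
    subst ht₁ ht₂
    obtain ⟨l, ⟨hl₁, hl₂⟩, hl⟩ := pairing_law h h₁ h₂ la lb hU (by
      rw [← hU']
      exact hlaw)
    let a : LaxMor Y V.VF := ⟨t ≫ und p₁, la, a₁, a₂, a₃, a₄, a₅⟩
    -- The composite of `a` with `U` already is a lax tangent morphism, and the tangent axioms of
    -- `l` are reflected from it.
    let t' : LaxMor Y Q := LaxMor.reflect (LaxMor.comp p₁ V.U) hW l (LaxMor.comp a V.U)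
      (Strict.assoc _ _ _) (by
        dsimp only [LaxMor.comp]
        rw [h₁', hU']
        exact reflect_law_eq h₁ hU hl₁)
    refine ⟨t', ⟨?_, ?_⟩, ?_⟩
    · refine LaxMor.ext_heq rfl (heq_of_eq ?_)
      change (LaxMor.comp t' p₁).law = la
      dsimp only [LaxMor.comp]
      rw [h₁']
      exact (comp_law_eq_iff h₁).2 hl₁
    · refine LaxMor.ext_heq rfl (heq_of_eq ?_)
      change (LaxMor.comp t' p₂).law = lb
      dsimp only [LaxMor.comp]
      rw [h₂']
      exact (comp_law_eq_iff h₂).2 hl₂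
    · rintro ⟨r, lr, r₁, r₂, r₃, r₄, r₅⟩ ⟨hr₁, hr₂⟩
      obtain rfl : r = t := htu r ⟨congrArg LaxMor.F hr₁, congrArg LaxMor.F hr₂⟩
      refine LaxMor.ext_heq rfl (heq_of_eq (hl lr ⟨?_, ?_⟩))
      · have := eq_of_heq (LaxMor.law_heq
          (M := LaxMor.comp ⟨r, lr, r₁, r₂, r₃, r₄, r₅⟩ p₁)
          (N := ⟨r ≫ und p₁, la, a₁, a₂, a₃, a₄, a₅⟩) hr₁)
        refine (comp_law_eq_iff h₁).1 ?_
        rw [← h₁']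
        exact this
      · have := eq_of_heq (LaxMor.law_heq
          (M := LaxMor.comp ⟨r, lr, r₁, r₂, r₃, r₄, r₅⟩ p₂)
          (N := ⟨r ≫ und p₂, lb, b₁, b₂, b₃, b₄, b₅⟩) hr₂)
        refine (comp_law_eq_iff h₂).1 ?_
        rw [← h₂']
        exact this
  · intro Y t t' φ ψ hφψ
    have hφψ' := congrArg und₂ hφψ
    obtain ⟨τ, ⟨hτ₁, hτ₂⟩, hτ⟩ := h.lift₂ (und t) (und t') (und₂ φ) (und₂ ψ) (by
      have e : ∀ r : Y ⟶ Q, und₂ (r ◁ eqToHom hcomm) = und r ◁ eqToHom h.comm := fun r =>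
        congrArg (fun t => und r ◁ t) (TanHom.eqToHom_hom hcomm)
      have e₁ := e t
      have e₂ := e t'
      refine Eq.trans ?_ (hφψ'.trans ?_)
      · exact congrArg (fun s => und₂ φ ▷ und V.U ≫ (α_ _ _ _).hom ≫ s) e₂.symm
      · exact congrArg (fun s => (α_ _ _ _).hom ≫ s ≫ (α_ _ _ _).inv ≫ und₂ ψ ▷ und V.U ≫
          (α_ _ _ _).hom) e₁)
    -- One projection suffices: equality over the base already determines 2-morphisms into the
    -- 2-pullback.
    have hc : LaxMor.law t ≫ τ ▷ Q.T = Y.T ◁ τ ≫ LaxMor.law t' := by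
      have := TanHom.reflect p₁ (M := t) (N := t') τ (by
        rw [hτ₁]
        exact TanHom.comm φ)
      refine hW ?_
      dsimp only [LaxMor.comp]
      rw [whiskerRight_comp, this, whiskerRight_comp]
    refine ⟨TanHom.mk τ hc, ⟨TanHom.ext' hτ₁, TanHom.ext' hτ₂⟩, ?_⟩
    rintro σ ⟨hσ₁, hσ₂⟩
    exact TanHom.ext' (hτ _ ⟨congrArg und₂ hσ₁, congrArg und₂ hσ₂⟩)

theorem VFPairs.nonempty {P : K} {q₁ q₂ : P ⟶ V.VF.obj}
    (h : Is2Pullback q₁ q₂ (und V.U) (und V.U)) : Nonempty (VFPairs V) := by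
  obtain ⟨T, h₁, h₂, hT, S, hS, ⟨D⟩⟩ := h.exists_tangentLift
  have s₁ : IsStrict (D.proj h hS rfl h₁) := ⟨h₁, rfl⟩
  have s₂ : IsStrict (D.proj h hS h.comm h₂) := ⟨h₂, rfl⟩
  exact ⟨⟨D.tangentad, _, _, s₁, s₂, Is2Pullback.of_und s₁ s₂ h, h⟩⟩

end

/-! ### Precomposition and postcomposition of vector fields -/

section
variable {B : Type u} [Bicategory.{w, v} B] {a x y z : B}

theorem whiskerLeft_congr {f g : x ⟶ y} (h : f = g) {k k' : y ⟶ z} (φ : k ⟶ k') :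
    f ◁ φ = eqToHom (congrArg (· ≫ k) h) ≫ g ◁ φ ≫ eqToHom (congrArg (· ≫ k') h).symm := by
  subst h
  simp

theorem whiskerRight_congr {f g : y ⟶ z} (h : f = g) {k k' : x ⟶ y} (φ : k ⟶ k') :
    φ ▷ f = eqToHom (congrArg (k ≫ ·) h) ≫ φ ▷ g ≫ eqToHom (congrArg (k' ≫ ·) h).symm := by
  subst h
  simp

theorem induced_comp_aux (H : a ⟶ x) (H' : x ⟶ y) {G : y ⟶ z} {t : z ⟶ z} (f : G ⟶ G ≫ t) :
    ((H ≫ H') ◁ f ≫ (α_ _ _ _).inv) ≫ (α_ H H' G).hom ▷ t =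
      (α_ H H' G).hom ≫ H ◁ (H' ◁ f ≫ (α_ _ _ _).inv) ≫ (α_ _ _ _).inv := by
  bicategory

theorem induced_id_aux {G : y ⟶ z} {t : z ⟶ z} (f : G ⟶ G ≫ t) :
    (𝟙 y ◁ f ≫ (α_ _ _ _).inv) ≫ (λ_ G).hom ▷ t = (λ_ G).hom ≫ f := by
  bicategory

theorem induced_postcomp_aux (H : a ⟶ x) {G : x ⟶ y} {t : y ⟶ y} {t' : z ⟶ z} (f : G ⟶ G ≫ t)
    (M : y ⟶ z) (m : t ≫ M ⟶ M ≫ t') :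
    (H ◁ (f ▷ M ≫ (α_ _ _ _).hom ≫ G ◁ m ≫ (α_ _ _ _).inv) ≫ (α_ _ _ _).inv) ≫
        (α_ H G M).inv ▷ t' =
      (α_ H G M).inv ≫ (H ◁ f ≫ (α_ _ _ _).inv) ▷ M ≫ (α_ _ _ _).hom ≫ (H ≫ G) ◁ m ≫
        (α_ _ _ _).inv := by
  bicategory

theorem postcomp_comp_aux {G : a ⟶ x} {t : x ⟶ x} {t' : y ⟶ y} {t'' : z ⟶ z} (f : G ⟶ G ≫ t)
    (M : x ⟶ y) (m : t ≫ M ⟶ M ≫ t') (N : y ⟶ z) (n : t' ≫ N ⟶ N ≫ t'') :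
    (f ▷ (M ≫ N) ≫ (α_ _ _ _).hom ≫ G ◁ ((α_ _ _ _).inv ≫ m ▷ N ≫ (α_ _ _ _).hom ≫ M ◁ n ≫
        (α_ _ _ _).inv) ≫ (α_ _ _ _).inv) ≫ (α_ G M N).inv ▷ t'' =
      (α_ G M N).inv ≫ (f ▷ M ≫ (α_ _ _ _).hom ≫ G ◁ m ≫ (α_ _ _ _).inv) ▷ N ≫
        (α_ _ _ _).hom ≫ (G ≫ M) ◁ n ≫ (α_ _ _ _).inv := by
  bicategory

theorem postcomp_id_aux {G : y ⟶ z} {t : z ⟶ z} (f : G ⟶ G ≫ t) :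
    (f ▷ 𝟙 z ≫ (α_ _ _ _).hom ≫ G ◁ ((ρ_ t).hom ≫ (λ_ t).inv) ≫ (α_ _ _ _).inv) ≫
      (ρ_ G).hom ▷ t = (ρ_ G).hom ≫ f := by
  bicategory

end

section
variable {K : Type u} [Bicategory.{w, v} K]

/-- In a strict 2-category the coherence isomorphisms are identities up to transport. Fields whose
bases differ by bracketing or units can thus be compared along such an isomorphism, where coherence
settles the equation. -/
theorem VecField.ext_iso {X' X : Tangentad K} {V W : VecField X' X} (e : V.base ≅ W.base)
    (h : V.base = W.base) (he : e = eqToIso h)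
    (hc : V.vec.field ≫ e.hom ▷ tan X = e.hom ≫ W.vec.field) : V = W := by
  obtain ⟨G, ⟨u, _⟩⟩ := V
  obtain ⟨G', ⟨u', _⟩⟩ := W
  dsimp only at h
  subst h
  subst he
  obtain rfl : u = u' := by simpa using hc
  rfl

variable [Strict K] {X' X Y Z : Tangentad K}

theorem induced_comp (w : VecField Y Z) (H : X' ⟶ X) (H' : X ⟶ Y) :
    (induced w X').obj (H ≫ H') = (induced ((induced w X).obj H') X').obj H :=
  VecField.ext_iso (α_ _ _ _) (Strict.assoc _ _ _) (Strict.associator_eqToIso _ _ _)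
    (induced_comp_aux H H' w.vec.field)

theorem induced_id (w : VecField X Y) : (induced w X).obj (𝟙 X) = w :=
  VecField.ext_iso (λ_ _) (Strict.id_comp _) (Strict.leftUnitor_eqToIso _)
    (induced_id_aux w.vec.field)

theorem induced_postcomp (w : VecField X Y) (H : X' ⟶ X) (M : Y ⟶ Z) :
    (induced ((postcomp X M).obj w) X').obj H = (postcomp X' M).obj ((induced w X').obj H) :=
  VecField.ext_iso (α_ _ _ _).symm (Strict.assoc _ _ _).symm
    (congrArg Iso.symm (Strict.associator_eqToIso _ _ _))
    (induced_postcomp_aux H w.vec.field M (lawHom M))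

theorem postcomp_comp (w : VecField X' X) (M : X ⟶ Y) (N : Y ⟶ Z) :
    (postcomp X' (M ≫ N)).obj w = (postcomp X' N).obj ((postcomp X' M).obj w) :=
  VecField.ext_iso (α_ _ _ _).symm (Strict.assoc _ _ _).symm
    (congrArg Iso.symm (Strict.associator_eqToIso _ _ _))
    (postcomp_comp_aux w.vec.field M (lawHom M) N (lawHom N))

theorem postcomp_id (w : VecField X' X) : (postcomp X' (𝟙 X)).obj w = w :=
  VecField.ext_iso (ρ_ _) (Strict.comp_id _) (Strict.rightUnitor_eqToIso _)
    (postcomp_id_aux w.vec.field)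

end

/-! ### Functoriality of `VF` -/

namespace VFConstruction

section
variable {K : Type u} [Bicategory.{w, v} K] {X X' Y : Tangentad K} (V : VFConstruction X)

/-- Equations between 1-morphisms into `VF` become equations between vector fields. For 2-morphisms,
whiskering with `U` is enough, as the next result records. -/
theorem obj_injective {M N : X' ⟶ V.VF}
    (h : (induced V.univ X').obj M = (induced V.univ X').obj N) : M = N := by
  obtain ⟨Λ, h1, -⟩ := V.universal X'
  have := congrArg Λ.obj h
  exact (Functor.congr_obj h1 M).symm.trans (this.trans (Functor.congr_obj h1 N))

theorem whiskerRight_injective {M N : X' ⟶ V.VF} {φ ψ : M ⟶ N} (h : φ ▷ V.U = ψ ▷ V.U) :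
    φ = ψ :=
  (V.bijective_map X' M N).1 (VecHom.ext h)

theorem inverse_map_comp_U {w w' : VecField X' X} (φ : w ⟶ w') :
    (V.inverse X').map φ ▷ V.U =
      eqToHom (V.inverse_comp_U w) ≫ VecHom.hom φ ≫ eqToHom (V.inverse_comp_U w').symm := by
  have h := Functor.congr_hom (V.universal X').choose_spec.2 φ
  have e : ∀ {a b : VecField X' X} (h : a = b),
      VecHom.hom (eqToHom h) = eqToHom (congrArg VecField.base h) := by
    rintro a _ rfl
    rfl
  have h' := congrArg VecHom.hom h
  refine h'.trans ?_
  change VecHom.hom _ ≫ VecHom.hom _ ≫ VecHom.hom _ = _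
  rw [e, e]
  rfl

/-- The 1-morphism between tangentads of vector fields induced by a lax tangent morphism. -/
noncomputable def map (V : VFConstruction X) (W : VFConstruction Y) (M : X ⟶ Y) : V.VF ⟶ W.VF :=
  (W.inverse V.VF).obj ((postcomp V.VF M).obj V.univ)

/-- The 2-morphism between tangentads of vector fields induced by a tangent 2-morphism. -/
noncomputable def map₂ (V : VFConstruction X) (W : VFConstruction Y) {M N : X ⟶ Y} (φ : M ⟶ N) :
    V.map W M ⟶ V.map W N :=
  (W.inverse V.VF).map ((postcomp₂ V.VF φ).app V.univ)

variable (W : VFConstruction Y)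

theorem induced_map (M : X ⟶ Y) :
    (induced W.univ _).obj (V.map W M) = (postcomp V.VF M).obj V.univ :=
  W.induced_inverse _

theorem map_comp_U (M : X ⟶ Y) : V.map W M ≫ W.U = V.U ≫ M :=
  congrArg VecField.base (V.induced_map W M)

theorem map₂_comp_U {M N : X ⟶ Y} (φ : M ⟶ N) :
    V.map₂ W φ ▷ W.U =
      eqToHom (V.map_comp_U W M) ≫ V.U ◁ φ ≫ eqToHom (V.map_comp_U W N).symm :=
  W.inverse_map_comp_U _

theorem zero_comp_U : V.zero ≫ V.U = 𝟙 X := V.inverse_comp_U _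

theorem map₂_id (M : X ⟶ Y) : V.map₂ W (𝟙 M) = 𝟙 (V.map W M) := by
  apply W.whiskerRight_injective
  rw [map₂_comp_U]
  simp

theorem map₂_comp {L M N : X ⟶ Y} (φ : L ⟶ M) (ψ : M ⟶ N) :
    V.map₂ W (φ ≫ ψ) = V.map₂ W φ ≫ V.map₂ W ψ := by
  apply W.whiskerRight_injective
  rw [map₂_comp_U, comp_whiskerRight, map₂_comp_U, map₂_comp_U]
  simp

end

section
variable {K : Type u} [Bicategory.{w, v} K] [Strict K] {X X' Y Z : Tangentad K}
  (V : VFConstruction X) (W : VFConstruction Y) (W' : VFConstruction Z)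

/-- Naturality of the classification: composing with `VF M` is applying `M` to the classified field.
Functoriality and the monad laws are computed with this rule. -/
theorem induced_comp_map (H : X' ⟶ V.VF) (M : X ⟶ Y) :
    (induced W.univ X').obj (H ≫ V.map W M) =
      (postcomp X' M).obj ((induced V.univ X').obj H) := by
  rw [induced_comp, induced_map, induced_postcomp]

theorem map_id : V.map V (𝟙 X) = 𝟙 V.VF := by
  apply V.obj_injective
  rw [induced_map, postcomp_id, induced_id]

theorem map_comp (M : X ⟶ Y) (N : Y ⟶ Z) : V.map W' (M ≫ N) = V.map W M ≫ W.map W' N := by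
  apply W'.obj_injective
  rw [induced_map, postcomp_comp, induced_comp_map, induced_map]

theorem map₂_whiskerLeft (M : X ⟶ Y) {N N' : Y ⟶ Z} (φ : N ⟶ N') :
    V.map₂ W' (M ◁ φ) = eqToHom (V.map_comp W W' M N) ≫ V.map W M ◁ W.map₂ W' φ ≫
      eqToHom (V.map_comp W W' M N').symm := by
  apply W'.whiskerRight_injective
  rw [map₂_comp_U, comp_whiskerRight, comp_whiskerRight, whisker_assoc, map₂_comp_U,
    whiskerLeft_comp, whiskerLeft_comp, comp_whiskerLeft_symm (V.map W M),
    whiskerLeft_congr (V.map_comp_U W M) φ, comp_whiskerLeft]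
  simp [Strict.associator_eqToIso]

theorem map₂_whiskerRight {M M' : X ⟶ Y} (φ : M ⟶ M') (N : Y ⟶ Z) :
    V.map₂ W' (φ ▷ N) = eqToHom (V.map_comp W W' M N) ≫ V.map₂ W φ ▷ W.map W' N ≫
      eqToHom (V.map_comp W W' M' N).symm := by
  apply W'.whiskerRight_injective
  rw [map₂_comp_U, comp_whiskerRight, comp_whiskerRight, whiskerRight_comp_symm,
    whiskerRight_congr (W.map_comp_U W' N), whiskerRight_comp, map₂_comp_U]
  simp [Strict.associator_eqToIso]

end
end VFConstruction

section
variable {K : Type u} [Bicategory.{w, v} K] [Strict K] {X X' Y Z : Tangentad K}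
  (V : ∀ X : Tangentad K, VFConstruction X)

/-- The 2-functor `VF`. -/
noncomputable def VFcore : StrictPseudofunctorPreCore (Tangentad K) (Tangentad K) where
  obj X := (V X).VF
  map {X Y} M := (V X).map (V Y) M
  map₂ {X Y _ _} φ := (V X).map₂ (V Y) φ
  map_id X := (V X).map_id
  map_comp f g := (V _).map_comp (V _) (V _) f g
  map₂_id f := (V _).map₂_id (V _) f
  map₂_comp f g := (V _).map₂_comp (V _) f g
  map₂_whisker_left f _ _ φ := (V _).map₂_whiskerLeft (V _) (V _) f φ
  map₂_whisker_right φ g := (V _).map₂_whiskerRight (V _) (V _) φ g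

end

/-! ### The additive structure of vector fields -/

section
variable {K : Type u} [Bicategory.{w, v} K] {X' X Y Z : Tangentad K}

theorem VecOn.ext_fld {G : X' ⟶ X} {u u' : VecOn G} (h : u.fld = u'.fld) : u = u' :=
  VecOn.ext (TanHom.ext' h)

theorem VecOn.pair_π₁ {G : X' ⟶ X} (u u' : VecOn G) : u.pair u' ≫ und G ◁ X.π₁ = u.fld :=
  (X.isPullback₀ (und G)).lift_fst _ _ _

theorem VecOn.pair_π₂ {G : X' ⟶ X} (u u' : VecOn G) : u.pair u' ≫ und G ◁ X.π₂ = u'.fld :=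
  (X.isPullback₀ (und G)).lift_snd _ _ _

theorem VecOn.add_fld {G : X' ⟶ X} (u u' : VecOn G) :
    (u.add u').fld = u.pair u' ≫ und G ◁ X.s := rfl

theorem VecOn.add_fld_eq {G : X' ⟶ X} (u u' : VecOn G) (e : und G ⟶ und G ≫ X.T₂)
    (h₁ : e ≫ und G ◁ X.π₁ = u.fld) (h₂ : e ≫ und G ◁ X.π₂ = u'.fld) :
    (u.add u').fld = e ≫ und G ◁ X.s := by
  rw [add_fld, X.lift_ext ((u.pair_π₁ u').trans h₁.symm) ((u.pair_π₂ u').trans h₂.symm)]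

theorem VecOn.add_assoc {G : X' ⟶ X} (a b c : VecOn G) : (a.add b).add c = a.add (b.add c) :=
  VecOn.ext_fld (X.s_assoc_at (a.pair b) (b.pair c) ((a.add b).pair c) (a.pair (b.add c))
    ((a.pair_π₂ b).trans (b.pair_π₁ c).symm) (VecOn.pair_π₁ _ _)
    ((VecOn.pair_π₂ _ _).trans (VecOn.pair_π₂ _ _).symm)
    ((VecOn.pair_π₁ _ _).trans (VecOn.pair_π₁ _ _).symm) (VecOn.pair_π₂ _ _))

theorem VecOn.fld_comp_zero {G : X' ⟶ X} (u : VecOn G) :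
    u.fld ≫ und G ◁ (X.p ≫ X.z) = (ρ_ (und G)).inv ≫ und G ◁ X.z := by
  have h : u.fld ≫ und G ◁ X.p = (ρ_ (und G)).inv := by
    rw [← cancel_mono (ρ_ (und G)).hom, Category.assoc, u.fld_p]
    simp
  rw [whiskerLeft_comp, reassoc_of% h]

theorem VecOn.zero_add {G : X' ⟶ X} (o u : VecOn G)
    (ho : o.fld = (ρ_ (und G)).inv ≫ und G ◁ X.z) : o.add u = u :=
  VecOn.ext_fld (X.s_unit_at u.fld (o.pair u)
    ((VecOn.pair_π₁ _ _).trans (ho.trans u.fld_comp_zero.symm)) (VecOn.pair_π₂ _ _))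

theorem VecOn.add_comm {G : X' ⟶ X} (a b : VecOn G) : a.add b = b.add a :=
  VecOn.ext_fld (X.s_comm_at (a.pair b) (b.pair a)
    ((VecOn.pair_π₁ _ _).trans (VecOn.pair_π₂ _ _).symm)
    ((VecOn.pair_π₂ _ _).trans (VecOn.pair_π₁ _ _).symm))

/-- The sum of two vector fields with the same base. -/
noncomputable def VecField.add (a b : VecField X' X) (h : a.base = b.base) : VecField X' X :=
  ⟨a.base, a.vec.add (VecOn.cast h.symm b.vec)⟩

theorem VecField.add_congr {a b a' b' : VecField X' X} (ha : a = a') (hb : b = b')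
    (h : a.base = b.base) (h' : a'.base = b'.base) : a.add b h = a'.add b' h' := by
  subst ha hb
  rfl

theorem VecField.add_assoc (a b c : VecField X' X) (h : a.base = b.base) (h' : b.base = c.base) :
    (a.add b h).add c (h.trans h') = a.add (b.add c h') h := by
  obtain ⟨G, a⟩ := a
  obtain ⟨G', b⟩ := b
  obtain ⟨G'', c⟩ := c
  dsimp only at h h'
  subst h h'
  exact congrArg (VecField.mk G) (VecOn.add_assoc a b c)

theorem VecField.add_comm (a b : VecField X' X) (h : a.base = b.base) :
    a.add b h = b.add a h.symm := by
  obtain ⟨G, a⟩ := a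
  obtain ⟨G', b⟩ := b
  dsimp only at h
  subst h
  exact congrArg (VecField.mk G) (VecOn.add_comm a b)

theorem induced_add_aux {K : Type u} [Bicategory.{w, v} K] {x y z : K} (H : x ⟶ y) {G : y ⟶ z}
    {t t' : z ⟶ z} (f : G ⟶ G ≫ t) (s : t ⟶ t') :
    (H ◁ f ≫ (α_ _ _ _).inv) ≫ (H ≫ G) ◁ s = H ◁ (f ≫ G ◁ s) ≫ (α_ _ _ _).inv := by
  bicategory

/-- The pullback `T₂` is pointwise, so restricting along `H` carries the pairing to the pairing. -/
theorem induced_add (a b : VecField Y Z) (h : a.base = b.base) (H : X' ⟶ Y) :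
    (induced (a.add b h) X').obj H =
      ((induced a X').obj H).add ((induced b X').obj H) (congrArg (H ≫ ·) h) := by
  obtain ⟨G, a⟩ := a
  obtain ⟨G', b⟩ := b
  dsimp only at h
  subst h
  refine congrArg (VecField.mk (H ≫ G)) (VecOn.ext_fld (Eq.symm ?_))
  refine (VecOn.add_fld_eq _ _ (und H ◁ a.pair b ≫ (α_ _ _ _).inv) ?_ ?_).trans ?_
  · exact (induced_add_aux _ _ _).trans (congrArg (und H ◁ · ≫ (α_ _ _ _).inv) (a.pair_π₁ b))
  · exact (induced_add_aux _ _ _).trans (congrArg (und H ◁ · ≫ (α_ _ _ _).inv) (a.pair_π₂ b))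
  · exact induced_add_aux _ _ _

theorem postcomp_add_aux {K : Type u} [Bicategory.{w, v} K] {x y z : K} {G : x ⟶ y}
    {t t₂ : y ⟶ y} {t' t₂' : z ⟶ z} (f : G ⟶ G ≫ t₂) (M : y ⟶ z) (m : t ≫ M ⟶ M ≫ t')
    (m₂ : t₂ ≫ M ⟶ M ≫ t₂') (s : t₂ ⟶ t) (s' : t₂' ⟶ t') (h : m₂ ≫ M ◁ s' = s ▷ M ≫ m) :
    (f ▷ M ≫ (α_ _ _ _).hom ≫ G ◁ m₂ ≫ (α_ _ _ _).inv) ≫ (G ≫ M) ◁ s' =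
      (f ≫ G ◁ s) ▷ M ≫ (α_ _ _ _).hom ≫ G ◁ m ≫ (α_ _ _ _).inv := by
  calc _ = f ▷ M ⊗≫ G ◁ (m₂ ≫ M ◁ s') ⊗≫ 𝟙 _ := by bicategory
    _ = _ := by rw [h]; bicategory

/-- The axiom `s_law` provides a law over `T₂`. Pasting it onto the pairing of `a` and `b` gives the
pairing of the images, and the law is additive. -/
theorem postcomp_add (a b : VecField X' X) (h : a.base = b.base) (M : X ⟶ Y) :
    (postcomp X' M).obj (a.add b h) =
      ((postcomp X' M).obj a).add ((postcomp X' M).obj b) (congrArg (· ≫ M) h) := by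
  obtain ⟨G, a⟩ := a
  obtain ⟨G', b⟩ := b
  dsimp only at h
  subst h
  obtain ⟨m₂, h₁, h₂, h₃⟩ := LaxMor.s_law M
  refine congrArg (VecField.mk (G ≫ M)) (VecOn.ext_fld (Eq.symm ?_))
  refine (VecOn.add_fld_eq _ _
    (a.pair b ▷ und M ≫ (α_ _ _ _).hom ≫ und G ◁ m₂ ≫ (α_ _ _ _).inv) ?_ ?_).trans ?_
  · exact (postcomp_add_aux _ _ (LaxMor.law M) _ _ _ h₁).trans
      (congrArg (· ▷ und M ≫ (α_ _ _ _).hom ≫ und G ◁ LaxMor.law M ≫ (α_ _ _ _).inv)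
        (a.pair_π₁ b))
  · exact (postcomp_add_aux _ _ (LaxMor.law M) _ _ _ h₂).trans
      (congrArg (· ▷ und M ≫ (α_ _ _ _).hom ≫ und G ◁ LaxMor.law M ≫ (α_ _ _ _).inv)
        (a.pair_π₂ b))
  · exact postcomp_add_aux _ _ (LaxMor.law M) _ _ _ h₃.symm

theorem postcomp_zero_aux {K : Type u} [Bicategory.{w, v} K] {x y : K} {t : x ⟶ x}
    {t' : y ⟶ y} (M : x ⟶ y) (m : t ≫ M ⟶ M ≫ t') (z : 𝟙 x ⟶ t) (z' : 𝟙 y ⟶ t')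
    (h : z ▷ M ≫ m = (λ_ M).hom ≫ (ρ_ M).inv ≫ M ◁ z') :
    ((z ≫ (λ_ _).inv) ▷ M ≫ (α_ _ _ _).hom ≫ 𝟙 x ◁ m ≫ (α_ _ _ _).inv) ≫
      (λ_ M ≪≫ (ρ_ M).symm).hom ▷ t' = (λ_ M ≪≫ (ρ_ M).symm).hom ≫ M ◁ (z' ≫ (λ_ _).inv) ≫
        (α_ _ _ _).inv := by
  dsimp only [Iso.trans, Iso.symm]
  calc _ = 𝟙 _ ⊗≫ (z ▷ M ≫ m) ⊗≫ 𝟙 _ := by bicategory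
    _ = _ := by rw [h]; bicategory

theorem leftUnitor_trans_rightUnitor_symm {K : Type u} [Bicategory.{w, v} K] [Strict K] {x y : K}
    (M : x ⟶ y) : λ_ M ≪≫ (ρ_ M).symm =
      eqToIso ((Strict.id_comp M).trans (Strict.comp_id M).symm) := by
  rw [Strict.leftUnitor_eqToIso, Strict.rightUnitor_eqToIso]
  exact eqToIso_trans _ (Strict.comp_id M).symm

variable [Strict K]

/-- Both are the zero field on `M`, by `z_law`; only the units differ. -/
theorem postcomp_zero (M : X ⟶ Y) :
    (postcomp X M).obj (zeroField X) = (induced (zeroField Y) X).obj M := by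
  refine VecField.ext_iso (λ_ M ≪≫ (ρ_ M).symm) ((Strict.id_comp M).trans (Strict.comp_id M).symm)
    (leftUnitor_trans_rightUnitor_symm M)
    (postcomp_zero_aux M (lawHom M) (zHom X) (zHom Y) (TanHom.ext' (LaxMor.z_law M)))

theorem VecField.zero_add_aux {K : Type u} [Bicategory.{w, v} K] {x y : K} {t : y ⟶ y}
    (M : x ⟶ y) (z : 𝟙 y ⟶ t) : (M ◁ (z ≫ (λ_ _).inv) ≫ (α_ _ _ _).inv) ≫ (ρ_ M).hom ▷ t =
      (ρ_ M).hom ≫ (ρ_ M).inv ≫ M ◁ z := by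
  bicategory

/-- Removes the unit from the base `G ≫ 𝟙 X`, so that the zero field can be added to fields on `G`.
-/
theorem VecField.induced_zero_eq (G : X' ⟶ X) : ∃ o : VecOn G,
    o.fld = (ρ_ (und G)).inv ≫ und G ◁ X.z ∧ (induced (zeroField X) X').obj G = ⟨G, o⟩ := by
  have h : ((ρ_ (und G)).inv ≫ und G ◁ X.z) ≫ und G ◁ X.p ≫ (ρ_ (und G)).hom = 𝟙 (und G) := by
    rw [Category.assoc, ← whiskerLeft_comp_assoc, X.z_p]
    simp
  let o : VecOn G := ⟨(ρ_ G).inv ≫ G ◁ zHom X, TanHom.ext' h⟩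
  exact ⟨o, rfl, VecField.ext_iso (ρ_ G) (Strict.comp_id G) (Strict.rightUnitor_eqToIso G)
    (VecField.zero_add_aux G (zHom X))⟩

theorem VecField.zero_add (w : VecField X' X) (h : ((induced (zeroField X) X').obj w.base).base =
    w.base) : VecField.add ((induced (zeroField X) X').obj w.base) w h = w := by
  obtain ⟨o, ho, ho'⟩ := VecField.induced_zero_eq w.base
  refine (VecField.add_congr ho' rfl h rfl).trans ?_
  exact congrArg (VecField.mk w.base) (VecOn.zero_add o w.vec ho)

theorem VecField.add_zero (w : VecField X' X) (h : w.base =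
    ((induced (zeroField X) X').obj w.base).base) :
    VecField.add w ((induced (zeroField X) X').obj w.base) h = w := by
  rw [VecField.add_comm, VecField.zero_add]

end

/-! ### Commuting vector fields -/

section
variable {K : Type u} [Bicategory.{w, v} K] {X X' Y : Tangentad K}

/-- The hypothesis `h` says that `u` is a tangent 2-morphism, and moves `u` past the law of `U` at
the cost of one `c`. The `c` in the commutation condition cancels it, and interchange of `f` and `u`
does the rest. -/
theorem commute_aux {K : Type u} [Bicategory.{w, v} K] {a x y : K} {t : x ⟶ x} {t' : y ⟶ y}
    (G : a ⟶ x) (U : x ⟶ y) (f : G ⟶ G ≫ t) (u : U ⟶ U ≫ t') (m : t ≫ U ⟶ U ≫ t')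
    (c : t' ≫ t' ⟶ t' ≫ t') (hc : c ≫ c = 𝟙 _)
    (h : m ≫ u ▷ t' = t ◁ u ≫ (α_ _ _ _).inv ≫ m ▷ t' ≫ (α_ _ _ _).hom ≫ U ◁ c ≫
      (α_ _ _ _).inv) :
    (G ◁ u ≫ (α_ _ _ _).inv) ≫ (f ▷ U ≫ (α_ _ _ _).hom ≫ G ◁ m ≫ (α_ _ _ _).inv) ▷ t' ≫
        (α_ _ _ _).hom =
      (f ▷ U ≫ (α_ _ _ _).hom ≫ G ◁ m ≫ (α_ _ _ _).inv) ≫ (G ◁ u ≫ (α_ _ _ _).inv) ▷ t' ≫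
        (α_ _ _ _).hom ≫ (G ≫ U) ◁ c := by
  symm
  calc _ = f ▷ U ⊗≫ G ◁ (m ≫ u ▷ t') ⊗≫ G ◁ U ◁ c ⊗≫ 𝟙 _ := by bicategory
    _ = f ▷ U ⊗≫ G ◁ t ◁ u ⊗≫ G ◁ m ▷ t' ⊗≫ G ◁ U ◁ (c ≫ c) ⊗≫ 𝟙 _ := by
        rw [h]; bicategory
    _ = 𝟙 _ ⊗≫ (f ▷ U ≫ (G ≫ t) ◁ u) ⊗≫ G ◁ m ▷ t' ⊗≫ 𝟙 _ := by rw [hc]; bicategory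
    _ = _ := by rw [← whisker_exchange]; bicategory

theorem VecField.cast_vec {a b : VecField X' X} (h : a = b) (h' : a.base = b.base) :
    VecOn.cast h' a.vec = b.vec := by
  subst h
  rfl

theorem VecOn.commute_postcomp {G : X' ⟶ Y} {U : Y ⟶ X} (f : VecOn G) (u : VecOn U) :
    VecOn.Commute (G := G ≫ U) ((induced ⟨U, u⟩ X').obj G).vec
      ((postcomp X' U).obj ⟨G, f⟩).vec :=
  commute_aux (und G) (und U) f.fld u.fld (LaxMor.law U) X.c X.c_c u.fld_comm

end

/-! ### The unit, the multiplication and the laws of the 2-monad -/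

section
variable {K : Type u} [Bicategory.{w, v} K] [Strict K] {X X' Y Z : Tangentad K}

theorem VFPairs.induced_comp_add {A : VFConstruction X} (D : VFPairs A) (H : X' ⟶ D.VF₂) :
    (induced A.univ X').obj (H ≫ D.add) =
      ((induced A.univ X').obj (H ≫ D.π₁)).add ((induced A.univ X').obj (H ≫ D.π₂))
        (by
          change (H ≫ D.π₁) ≫ A.U = (H ≫ D.π₂) ≫ A.U
          rw [Strict.assoc, Strict.assoc, D.is2Pullback.comm]) := by
  have h : (induced A.univ D.VF₂).obj D.add = VecField.add ((induced A.univ D.VF₂).obj D.π₁)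
    ((induced A.univ D.VF₂).obj D.π₂) D.is2Pullback.comm := A.induced_inverse _
  rw [induced_comp, h]
  exact (induced_add _ _ _ H).trans
    (VecField.add_congr (induced_comp _ _ _).symm (induced_comp _ _ _).symm _ _)

/-- The multiplication, for a chosen tangentad of vector fields of a tangentad of vector fields. -/
noncomputable def VFPairs.mul {A : VFConstruction X} (D : VFPairs A) (A' : VFConstruction A.VF) :
    A'.VF ⟶ A.VF :=
  D.is2Pullback.pair A'.U (A'.map A A.U) (A'.map_comp_U A A.U).symm ≫ D.add

variable {A : VFConstruction X} (D : VFPairs A) (A' : VFConstruction A.VF)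

theorem comp_U_comp_U (H : X' ⟶ A'.VF) : (H ≫ A'.U) ≫ A.U = (H ≫ A'.map A A.U) ≫ A.U := by
  rw [Strict.assoc, Strict.assoc, A'.map_comp_U]

/-- The formula behind all monad laws: a 1-morphism into `VF²` stands for two fields on one base,
and the multiplication adds them. -/
theorem VFPairs.induced_comp_mul (H : X' ⟶ A'.VF) :
    (induced A.univ X').obj (H ≫ D.mul A') =
      ((induced A.univ X').obj (H ≫ A'.U)).add ((induced A.univ X').obj (H ≫ A'.map A A.U))
        (comp_U_comp_U A' H) := by
  rw [mul, ← Strict.assoc, induced_comp_add]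
  have h := (D.is2Pullback.lift₁ A'.U (A'.map A A.U) (A'.map_comp_U A A.U).symm).choose_spec.1
  refine VecField.add_congr (congrArg _ ?_) (congrArg _ ?_) _ _
  · exact (Strict.assoc _ _ _).trans (congrArg (H ≫ ·) h.1)
  · exact (Strict.assoc _ _ _).trans (congrArg (H ≫ ·) h.2)

theorem VFPairs.induced_mul :
    (induced A.univ _).obj (D.mul A') =
      ((induced A.univ _).obj A'.U).add ((induced A.univ _).obj (A'.map A A.U))
        (A'.map_comp_U A A.U).symm := by
  have h := D.induced_comp_mul A' (𝟙 _)
  rw [Strict.id_comp] at h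
  refine h.trans (VecField.add_congr (congrArg _ ?_) (congrArg _ ?_) _ _)
  · exact Strict.id_comp _
  · exact Strict.id_comp _

theorem VFPairs.mul_comp_U : D.mul A' ≫ A.U = A'.U ≫ A.U :=
  congrArg VecField.base (D.induced_mul A')

/-- The two fields encoded by the zero are the universal field, since `U` retracts zero, and the
zero field, since `U` preserves zeros. -/
theorem VFPairs.zero_mul : A'.zero ≫ D.mul A' = 𝟙 A.VF := by
  apply A.obj_injective
  rw [D.induced_comp_mul, induced_id]
  have h₁ : (induced A.univ _).obj (A'.zero ≫ A'.U) = A.univ := by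
    rw [A'.zero_comp_U, induced_id]
  have h₂ : (induced A.univ _).obj (A'.zero ≫ A'.map A A.U) =
      (induced (zeroField X) _).obj A.univ.base := by
    rw [A'.induced_comp_map, ← postcomp_zero]
    exact congrArg _ (A'.induced_inverse _)
  exact (VecField.add_congr h₁ h₂ _ (Strict.comp_id _).symm).trans (A.univ.add_zero _)

theorem VFConstruction.zero_naturality {B : VFConstruction Y} (M : X ⟶ Y) :
    M ≫ B.zero = A.zero ≫ A.map B M := by
  apply B.obj_injective
  rw [A.induced_comp_map, induced_comp]
  have h₁ : (induced B.univ _).obj B.zero = zeroField Y := B.induced_inverse _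
  have h₂ : (induced A.univ _).obj A.zero = zeroField X := A.induced_inverse _
  rw [h₁, h₂, postcomp_zero]

/-- The roles are exchanged: the first field vanishes by naturality of `U`, and the second is the
universal one since `VF` applied to `A.zero ≫ A.U = 𝟙 X` is an identity. -/
theorem VFPairs.map_zero_mul : A.map A' A.zero ≫ D.mul A' = 𝟙 A.VF := by
  apply A.obj_injective
  rw [D.induced_comp_mul, induced_id]
  have h₁ : (induced A.univ _).obj (A.map A' A.zero ≫ A'.U) =
      (induced (zeroField X) _).obj A.univ.base := by
    rw [A.map_comp_U, induced_comp]
    have h₂ : (induced A.univ _).obj A.zero = zeroField X := A.induced_inverse _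
    rw [h₂]
    rfl
  have h₂ : (induced A.univ _).obj (A.map A' A.zero ≫ A'.map A A.U) = A.univ := by
    rw [← VFConstruction.map_comp, A.zero_comp_U, VFConstruction.map_id, induced_id]
  exact (VecField.add_congr h₁ h₂ _ (Strict.comp_id _)).trans (A.univ.zero_add _)

/-- Postcomposition with `M` is additive, and each of the two fields is natural in `M`. -/
theorem VFPairs.mul_naturality {B : VFConstruction Y} (E : VFPairs B) (B' : VFConstruction B.VF)
    (M : X ⟶ Y) : A'.map B' (A.map B M) ≫ E.mul B' = D.mul A' ≫ A.map B M := by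
  apply B.obj_injective
  rw [E.induced_comp_mul, A.induced_comp_map, D.induced_mul]
  refine (VecField.add_congr ?_ ?_ _ _).trans (postcomp_add _ _ _ M).symm
  · rw [A'.map_comp_U, A.induced_comp_map]
  · rw [← A'.map_comp, A.map_comp_U, A'.map_comp A, A.induced_comp_map]

/-- Let `a`, `b`, `c` be the fields of `A''.U ≫ A'.U`, `A''.U ≫ A'.map A A.U` and `A''.map A' A'.U ≫
A'.map A A.U`. The left side is `(a + b) + c`, as the multiplication does not change the base. The
right side is `a + (b + c)`, as postcomposition with `U` is additive. -/
theorem VFPairs.mul_assoc (D' : VFPairs A') (A'' : VFConstruction A'.VF) :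
    A''.map A' (D.mul A') ≫ D.mul A' = D'.mul A'' ≫ D.mul A' := by
  apply A.obj_injective
  have h₁ : (induced A.univ _).obj (A''.map A' (D.mul A') ≫ A'.U) =
      ((induced A.univ _).obj (A''.U ≫ A'.U)).add ((induced A.univ _).obj (A''.U ≫ A'.map A A.U))
        (comp_U_comp_U A' _) := by
    rw [A''.map_comp_U, D.induced_comp_mul]
  have h₂ : A''.map A' (D.mul A') ≫ A'.map A A.U = A''.map A' A'.U ≫ A'.map A A.U := by
    rw [← A''.map_comp, ← A''.map_comp, D.mul_comp_U]
  have h₀ : (A''.U ≫ A'.map A A.U) ≫ A.U = (A''.map A' A'.U ≫ A'.map A A.U) ≫ A.U := by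
    simp only [Strict.assoc, A'.map_comp_U]
    rw [← Strict.assoc, ← Strict.assoc, A''.map_comp_U]
  have h₃ : (induced A.univ _).obj (D'.mul A'' ≫ A'.map A A.U) =
      ((induced A.univ _).obj (A''.U ≫ A'.map A A.U)).add
        ((induced A.univ _).obj (A''.map A' A'.U ≫ A'.map A A.U)) h₀ := by
    rw [A'.induced_comp_map, D'.induced_mul]
    exact (postcomp_add _ _ _ _).trans (VecField.add_congr (A'.induced_comp_map A _ _).symm
      (A'.induced_comp_map A _ _).symm _ _)
  rw [D.induced_comp_mul, D.induced_comp_mul]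
  refine (VecField.add_congr h₁ (congrArg _ h₂) _ ((comp_U_comp_U A' _).trans h₀)).trans
    ((VecField.add_assoc _ _ _ _ h₀).trans
      (VecField.add_congr (congrArg _ (D'.mul_comp_U A'').symm) h₃.symm _ _))

/-- Whiskering with `U` turns both sides into `φ` up to transports, since `U` retracts zero. -/
theorem VFConstruction.zero_naturality₂ {B : VFConstruction Y} {M N : X ⟶ Y} (φ : M ⟶ N) :
    φ ▷ B.zero ≫ eqToHom (zero_naturality (A := A) N) =
      eqToHom (zero_naturality (A := A) M) ≫ A.zero ◁ A.map₂ B φ := by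
  apply B.whiskerRight_injective
  rw [comp_whiskerRight, comp_whiskerRight, whiskerRight_comp_symm,
    whiskerRight_congr B.zero_comp_U, whisker_assoc, map₂_comp_U, whiskerLeft_comp,
    whiskerLeft_comp, comp_whiskerLeft_symm A.zero, whiskerLeft_congr A.zero_comp_U]
  simp [Strict.associator_eqToIso, Strict.leftUnitor_eqToIso, Strict.rightUnitor_eqToIso]

/-- Whiskering with `U` leaves on both sides `φ` restricted along `A'.U ≫ A.U`, because the
multiplication preserves bases. -/
theorem VFPairs.mul_naturality₂ {B : VFConstruction Y} (E : VFPairs B)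
    (B' : VFConstruction B.VF) {M N : X ⟶ Y} (φ : M ⟶ N) :
    A'.map₂ B' (A.map₂ B φ) ▷ E.mul B' ≫ eqToHom (D.mul_naturality A' E B' N) =
      eqToHom (D.mul_naturality A' E B' M) ≫ D.mul A' ◁ A.map₂ B φ := by
  apply B.whiskerRight_injective
  rw [comp_whiskerRight, comp_whiskerRight, whiskerRight_comp_symm,
    whiskerRight_congr (E.mul_comp_U B'), whiskerRight_comp, VFConstruction.map₂_comp_U,
    whisker_assoc, VFConstruction.map₂_comp_U, whiskerLeft_comp,
    whiskerLeft_comp, comp_whiskerLeft_symm (D.mul A'), whiskerLeft_congr (D.mul_comp_U A'),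
    comp_whiskerRight, comp_whiskerRight, whisker_assoc, VFConstruction.map₂_comp_U]
  simp [Strict.associator_eqToIso]

end

theorem isTwoFunctor_VFmap {K : Type u} [Bicategory.{w, v} K] [Strict K]
    (V : ∀ X : Tangentad K, VFConstruction X) :
    ∃ Φ : StrictPseudofunctor (Tangentad K) (Tangentad K), Φ.toPrelaxFunctorStruct = VFmap V :=
  ⟨StrictPseudofunctor.mk'' (VFcore V), rfl⟩

theorem is2Monad_VFmap {K : Type u} [Bicategory.{w, v} K] [Strict K]
    (V : ∀ X : Tangentad K, VFConstruction X) (D : ∀ X : Tangentad K, VFPairs (V X)) :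
    Is2Monad (VFmap V) (fun X => (V X).zero) (mult V D) where
  isTwoFunctor := isTwoFunctor_VFmap V
  η_naturality M := VFConstruction.zero_naturality M
  η_naturality₂ φ := VFConstruction.zero_naturality₂ φ
  μ_naturality M := VFPairs.mul_naturality (D _) (V _) (D _) (V _) M
  μ_naturality₂ φ := VFPairs.mul_naturality₂ (D _) (V _) (D _) (V _) φ
  left_unit X := (D X).zero_mul (V _)
  right_unit X := (D X).map_zero_mul (V _)
  assoc X := (D X).mul_assoc (V _) (D _) (V _)

/-- The 1-morphism `H` classifies a field on `H ≫ U` in the tangentad `VF X`. The second field is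
its image under `U`, while the first is the universal field restricted along `H ≫ U`. -/
theorem commute_fstField_sndField {K : Type u} [Bicategory.{w, v} K] [Strict K]
    (V : ∀ X : Tangentad K, VFConstruction X) {X X' : Tangentad K}
    (H : X' ⟶ (VFmap V).obj ((VFmap V).obj X)) :
    (fstField V H).Commute (sndField V H) := by
  have h : sndField V H =
      ((postcomp X' (V X).U).obj ((induced (V (V X).VF).univ X').obj H)).vec :=
    VecField.cast_vec ((V (V X).VF).induced_comp_map (V X) H (V X).U) _
  rw [h]
  exact VecOn.commute_postcomp ((induced (V (V X).VF).univ X').obj H).vec (V X).v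

end TangentadTheory

theorem mainTheorem7 {K : Type u} [Bicategory.{w, v} K] [Bicategory.Strict K]
    (V : ∀ X : Tangentad K, VFConstruction X)
    (hV : ∀ X : Tangentad K, ∃ (P : K) (π₁ π₂ : P ⟶ (V X).VF.obj),
      Is2Pullback π₁ π₂
        (und (V X).U) (und (V X).U)) :
    (∀ X : Tangentad K, Nonempty (VFPairs (V X))) ∧
    ∀ D : ∀ X : Tangentad K, VFPairs (V X),
      Is2Monad (VFmap V) (fun X => (V X).zero)
        (mult V D) ∧
      ∀ (X X' : Tangentad K)
        (H : X' ⟶ (VFmap V).obj ((VFmap V).obj X)),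
        (fstField V H).Commute (sndField V H) ∧
        (induced (V X).univ X').obj (H ≫ mult V D X) =
          ⟨(H ≫ (V (V X).VF).U) ≫ (V X).U,
            (fstField V H).add (sndField V H)⟩ := by
  refine ⟨fun X => ?_, fun D => ⟨is2Monad_VFmap V D, fun X X' H =>
    ⟨commute_fstField_sndField V H, (D X).induced_comp_mul (V (V X).VF) H⟩⟩⟩
  obtain ⟨P, π₁, π₂, h⟩ := hV X
  exact VFPairs.nonempty h
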